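/- Let $l\ge 1$ and $k>2$ be integers, and write $q=e^{2\pi i\tau}$ with $\tau$ in the upper half plane. For $m\ge 1$ and $a\in\mathbb Z/l\mathbb Z$ put $$\tilde s^{(m)}_{a/l}=C^{(m)}_a+\sum_{n>0}q^n\sum_{d\mid n}d^{m-1}\bigl(\delta_d^{a \bmod l}+(-1)^m\delta_d^{-a \bmod l}\bigr),\qquad C^{(m)}_a=-\frac{l^{m-1}}{2m}\Bigl(B_m(\{a/l\})+(-1)^mB_m(\{-a/l\})\Bigr),$$ where $\delta_d^{a\bmod l}$ is $1$ if $d\equiv a \pmod l$ and $0$ otherwise, $B_m$ is the $m$-th Bernoulli polynomial and $\{\cdot\}$ is the fractional part (so $C^{(1)}_a=\frac12-\frac al$ for $0<a<l$, $C^{(1)}_0=0$ and $C^{(2)}_0=-l/12$). A quasimodular form of weight $k$ on $\Gamma_1(l)$ is a $\mathbb C$-linear combination of functions $E_2^{\,j}g$, where $j\ge 0$, $2j\le k$ and $g$ is a holomorphic modular form of weight $k-2j$ on $\Gamma_1(l)$. Let $M$ be the space of Manin symbols of weight $k$ and level $l$: the $\mathbb C$-vector space generated by the symbols $x^ry^s(u,v)$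 with $r,s\ge 0$, $r+s=k-2$, $u,v\in\mathbb Z/l\mathbb Z$ and $\mathbb Zu+\mathbb Zv=\mathbb Z/l\mathbb Z$, modulo the relations $$x^ry^s(u,v)+(-1)^rx^sy^r(v,-u)=0,$$ $$x^ry^s(u,v)+(-1)^ry^r(x-y)^s(v,-u-v)+(-1)^s(y-x)^rx^s(-u-v,u)=0,$$ where $P(u,v)$, for a homogeneous polynomial $P$ of degree $k-2$, is understood by expanding $P$ linearly into monomials. Then the following hold. 1. For all $m\ge1$ and $a\in\mathbb Z/l\mathbb Z$ with $(a,m)\ne(0,2)$, $C^{(m)}_a$ is the unique constant for which the above series is a holomorphic modular form of weight $m$ on $\Gamma_1(l)$; and $\tilde s^{(2)}_{0/l}$ is a quasimodular form of weight $2$. 2. The forms $\tilde s^{(k)}_{a/l}$ and the derivatives $\partial_\tau\tilde s^{(k-2)}_{a/l}$, $a\in\mathbb Z/l\mathbb Z$, are quasimodular forms of weight $k$ on $\Gamma_1(l)$. Let $\mathscr Q$ be the quotient of the space of all quasimodular forms of weight $k$ on $\Gamma_1(l)$ by their span. 3. Every product $\tilde s^{(s+1)}_{u/l}\tilde s^{(r+1)}_{v/l}$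 with $r+s=k-2$ and $\mathbb Zu+\mathbb Zv=\mathbb Z/l\mathbb Z$ is a quasimodular form of weight $k$ on $\Gamma_1(l)$, and there is a unique $\mathbb C$-linear map $\mu\colon M\to\mathscr Q$ such that $$\mu\bigl(x^ry^s(u,v)\bigr)=(-1)^s\,\tilde s^{(s+1)}_{u/l}\,\tilde s^{(r+1)}_{v/l}\ \text{ in }\mathscr Q$$ for all such $r,s,u,v$. -/

import Mathlib

open UpperHalfPlane hiding I
open Complex MvPolynomial
open scoped MatrixGroups CongruenceSubgroup

noncomputable section

namespace ToricForms

/-! ### The Eisenstein series `s̃^{(m)}_{a/l}` -/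

/-- The coefficient of `q ^ n` for `n > 0`:
`∑_{d ∣ n} d^(m-1) * (δ_d^{a mod l} + (-1)^m * δ_d^{-a mod l})`. -/
def stildeCoeff (l m : ℕ) (a : ZMod l) (n : ℕ) : ℂ :=
  ∑ d ∈ n.divisors, (d : ℂ) ^ (m - 1) *
    ((if (d : ZMod l) = a then 1 else 0) + (-1) ^ m * (if (d : ZMod l) = -a then 1 else 0))

/-- The series without its constant term, as a function of `τ`, with `q = exp (2 π i τ)`. -/
def stildeTail (l m : ℕ) (a : ZMod l) (τ : ℍ) : ℂ :=
  ∑' n : ℕ+, stildeCoeff l m a n * cexp (2 * Real.pi * I * τ) ^ (n : ℕ)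

/-- The constant term. With `0 ≤ a < l` it is `-l^(m-1) * B_m(a/l) / m`, where `B_m` is the Bernoulli
polynomial, except that it is `0` for `m = 1`, `a = 0`. In particular it is `1/2 - a/l` for `m = 1`,
`0 < a < l`, and `-l/12` for `m = 2`, `a = 0`. -/
def stildeConst (l m : ℕ) (a : ZMod l) : ℂ :=
  (((-(l : ℚ) ^ (m - 1) / (2 * m)) *
    ((Polynomial.bernoulli m).eval ((a.val : ℚ) / l)
      + (-1) ^ m * (Polynomial.bernoulli m).eval (((-a).val : ℚ) / l)) : ℚ) : ℂ)

/-- The form `s̃^{(m)}_{a/l}` of weight `m ≥ 1`, `a ∈ ℤ/l`. -/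
def stilde (l m : ℕ) (a : ZMod l) (τ : ℍ) : ℂ :=
  stildeConst l m a + stildeTail l m a τ

/-- The derivative `∂_τ` of a function on the upper half plane. -/
def dtau (f : ℍ → ℂ) (τ : ℍ) : ℂ := deriv (f ∘ ofComplex) (τ : ℂ)

/-! ### Modular and quasimodular forms on `Γ₁(l)` -/

/-- `f` is a holomorphic modular form of weight `m` on `Γ₁(l)`. -/
def IsModular (l m : ℕ) (f : ℍ → ℂ) : Prop :=
  ∃ g : ModularForm (CongruenceSubgroup.Gamma1 l : Subgroup (GL (Fin 2) ℝ)) (m : ℤ), ⇑g = f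

/-- The weight `k` quasimodular forms on `Γ₁(l)`: the weight `k` part of the ring of polynomials in
`E₂` whose coefficients are holomorphic modular forms on `Γ₁(l)`. -/
def Quasimodular (l k : ℕ) : Submodule ℂ (ℍ → ℂ) :=
  Submodule.span ℂ {f | ∃ (j m : ℕ) (g : ℍ → ℂ), m + 2 * j = k ∧ IsModular l m g ∧
    f = EisensteinSeries.E2 ^ j * g}

/-- The span of all `s̃^{(k)}_{a/l}` and all `∂_τ s̃^{(k-2)}_{a/l}`. -/
def eisensteinSpan (l k : ℕ) : Submodule ℂ (ℍ → ℂ) :=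
  Submodule.span ℂ
    (Set.range (fun a : ZMod l => stilde l k a) ∪
      Set.range (fun a : ZMod l => dtau (stilde l (k - 2) a)))

/-- The quotient `𝒬` of the weight `k` quasimodular forms. -/
abbrev QuasimodularQuotient (l k : ℕ) : Type :=
  Quasimodular l k ⧸ (eisensteinSpan l k).submoduleOf (Quasimodular l k)

/-! ### Manin symbols -/

/-- The pairs `(u, v)` in `(ℤ/l)²` with `ℤu + ℤv = ℤ/l`. -/
abbrev PairSet (l : ℕ) : Type :=
  {p : ZMod l × ZMod l // AddSubgroup.zmultiples p.1 ⊔ AddSubgroup.zmultiples p.2 = ⊤}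

namespace PairSet

variable {l : ℕ}

/-- `(u, v) ↦ (v, -u)`. -/
def sigma (e : PairSet l) : PairSet l :=
  ⟨(e.1.2, -e.1.1), by rw [AddSubgroup.zmultiples_neg, sup_comm]; exact e.2⟩

/-- `(u, v) ↦ (v, -u - v)`. -/
def rho (e : PairSet l) : PairSet l :=
  ⟨(e.1.2, -e.1.1 - e.1.2), by
    refine eq_top_iff.2 (e.2.symm.le.trans ?_)
    refine sup_le ?_ le_sup_left
    rw [AddSubgroup.zmultiples_le]
    have h1 : e.1.2 ∈ AddSubgroup.zmultiples e.1.2 ⊔ AddSubgroup.zmultiples (-e.1.1 - e.1.2) :=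
      le_sup_left (a := AddSubgroup.zmultiples e.1.2) (AddSubgroup.mem_zmultiples _)
    have h2 : -e.1.1 - e.1.2 ∈
        AddSubgroup.zmultiples e.1.2 ⊔ AddSubgroup.zmultiples (-e.1.1 - e.1.2) :=
      le_sup_right (a := AddSubgroup.zmultiples e.1.2) (AddSubgroup.mem_zmultiples _)
    have h3 := neg_mem (add_mem h1 h2)
    have h4 : -(e.1.2 + (-e.1.1 - e.1.2)) = e.1.1 := by ring
    rwa [h4] at h3⟩

/-- `(u, v) ↦ (-u - v, u)`. -/
def rho' (e : PairSet l) : PairSet l :=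
  ⟨(-e.1.1 - e.1.2, e.1.1), by
    have h := e.rho.rho.2
    have h4 : -e.1.2 - (-e.1.1 - e.1.2) = e.1.1 := by ring
    simpa only [rho, h4] using h⟩

end PairSet

/-- The vector space with basis the symbols `x^r y^s (u,v)`, where `r + s = k - 2` and `(u, v)` is in
`PairSet l`. -/
abbrev FreeSymbols (l k : ℕ) : Type := (Finset.HasAntidiagonal.antidiagonal (k - 2) × PairSet l) →₀ ℂ

/-- The basis element `x^r y^s (u,v)`. -/
def freeSymbol {l k : ℕ} (r s : ℕ) (h : r + s = k - 2) (e : PairSet l) : FreeSymbols l k :=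
  Finsupp.single (⟨(r, s), Finset.HasAntidiagonal.mem_antidiagonal.2 h⟩, e) 1

/-- The polynomial variable `x`. -/
abbrev x : MvPolynomial (Fin 2) ℂ := X 0

/-- The polynomial variable `y`. -/
abbrev y : MvPolynomial (Fin 2) ℂ := X 1

/-- The formal symbol `P(u,v)` for a polynomial `P` in `x`, `y` homogeneous of degree `k - 2`,
obtained by expanding `P` into monomials `x^r y^s`. -/
def polySymbol {l : ℕ} (k : ℕ) (P : MvPolynomial (Fin 2) ℂ) (e : PairSet l) : FreeSymbols l k :=
  ∑ p : Finset.HasAntidiagonal.antidiagonal (k - 2),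
    coeff (Finsupp.single 0 p.1.1 + Finsupp.single 1 p.1.2) P • Finsupp.single (p, e) 1

/-- `x^r y^s (u,v) + (-1)^r x^s y^r (v,-u)`. -/
def relator₁ {l k : ℕ} (r s : ℕ) (h : r + s = k - 2) (e : PairSet l) : FreeSymbols l k :=
  freeSymbol r s h e + (-1 : ℂ) ^ r • freeSymbol s r ((add_comm s r).trans h) e.sigma

/-- `x^r y^s (u,v) + (-1)^r y^r (x-y)^s (v,-u-v) + (-1)^s (y-x)^r x^s (-u-v,u)`. -/
def relator₂ {l k : ℕ} (r s : ℕ) (h : r + s = k - 2) (e : PairSet l) : FreeSymbols l k :=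
  freeSymbol r s h e
    + (-1 : ℂ) ^ r • polySymbol k (y ^ r * (x - y) ^ s) e.rho
    + (-1 : ℂ) ^ s • polySymbol k ((y - x) ^ r * x ^ s) e.rho'

/-- The span of the relations between Manin symbols. -/
def maninRelations (l k : ℕ) : Submodule ℂ (FreeSymbols l k) :=
  Submodule.span ℂ
    ({w | ∃ (r s : ℕ) (h : r + s = k - 2) (e : PairSet l), w = relator₁ r s h e} ∪
      {w | ∃ (r s : ℕ) (h : r + s = k - 2) (e : PairSet l), w = relator₂ r s h e})

/-- The space `M` of Manin symbols of weight `k` and level `l`. -/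
abbrev ManinSymbols (l k : ℕ) : Type := FreeSymbols l k ⧸ maninRelations l k

/-- The class of `x^r y^s (u,v)` in `M`. -/
def maninSymbol {l k : ℕ} (r s : ℕ) (h : r + s = k - 2) (e : PairSet l) : ManinSymbols l k :=
  (maninRelations l k).mkQ (freeSymbol r s h e)

/-- `(-1)^s s̃^{(s+1)}_{u/l} s̃^{(r+1)}_{v/l}`, the value of `μ` on `x^r y^s (u,v)`. -/
def muValue {l : ℕ} (r s : ℕ) (e : PairSet l) : ℍ → ℂ :=
  (-1 : ℂ) ^ s • (stilde l (s + 1) e.1.1 * stilde l (r + 1) e.1.2)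

end ToricForms

end

set_option linter.unusedSectionVars false

noncomputable section

namespace ToricForms

open Filter Topology Asymptotics EisensteinSeries

/-! ### The Weierstrass zeta function of the lattice `ℤτ + ℤ` -/

/-! The forms `stilde` are the Taylor coefficients in `z` of one function, and this gives their
transformation law. The zeta function of `ℤτ + ℤ`, corrected by `-z G₂`, is `latticeCot`: it equals
the symmetric sum of `π cot π(z + mτ)`, has quasi-periods `0` and `-2πi`, and is modular of weight
one in `(z, τ)` up to a term linear in `z`. Its finite Fourier transform over the points `j / l`
selects the divisors `d ≡ ±a`. With the generating function of the Bernoulli polynomials for the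
constant terms, `hasSum_stilde` identifies the expansion, and comparison of coefficients gives
`stilde_smul`. The only defect occurs for `a = 0` in weight two; it is that of `-E2 / 12`.
Polynomial bounds on the `q`-coefficients give holomorphy at every cusp (`isModular_of_modGrowth`).
Serre derivatives, together with the modularity of `D E2 - E2² / 12`, show that the derivatives are
quasimodular. Constant terms are unique because a nonzero constant is not quasimodular of positive
weight (`const_eq_zero_of_mem`).

For `μ`, the two-term relation holds exactly by parity of `stilde` in `a`. For the three-term
relation, write each tail as a signed sum of `q ^ (d n)` over integers `d`, `n` of the same sign. A
product of tails becomes a sum over pairs `(d, a)`, `(d', b)` of `q ^ (d a + d' b)` times `P(d',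
-d)`. The rotation `pairRot` of order three preserves the exponent, permutes the residue conditions
and matches `P` with `rot P`, so on generic configurations the three products cancel pointwise by an
identity of signs (`pairGeneric_cyclic`).

There remain the degenerate configurations `a = b` and `d + d' = 0`, and the products involving
constant terms. In the first configuration the inner sum is a finite sum of polynomial values over a
residue class; the Faulhaber formula `regConst_add_regConst` cancels it against constant-times-tail
terms, up to a pure power, which gives `stilde` of weight `k`, and endpoint terms. In the second,
counting lattice points gives a factor `n`, hence a derivative of `stilde` of weight `k - 2`, and
again endpoint terms. The endpoint terms telescope over the rotation (`class_contribution`). The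
outcome is an element of `eisensteinSpan` plus a constant, and the constant vanishes because it is
quasimodular of positive weight. -/

/-- The general term of the Weierstrass zeta function of `ℤτ + ℤ`; thanks to `0⁻¹ = 0` it is `z⁻¹`
at the origin. -/
def zetaTerm (z : ℂ) (τ : ℍ) (p : Fin 2 → ℤ) : ℂ :=
  (z + (p 0 * τ + p 1))⁻¹ - (p 0 * (τ : ℂ) + p 1)⁻¹ + z * ((p 0 * (τ : ℂ) + p 1) ^ 2)⁻¹

/-- The Weierstrass zeta function of the lattice `ℤτ + ℤ`. -/
def zetaFn (z : ℂ) (τ : ℍ) : ℂ := ∑' p, zetaTerm z τ p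

lemma tendsto_norm_lattice (τ : ℍ) :
    Tendsto (fun p : Fin 2 → ℤ => ‖(p 0 * (τ : ℂ) + p 1)‖) cofinite atTop := by
  have h1 : Tendsto (fun p : Fin 2 → ℤ => EisensteinSeries.r τ * ‖p‖) cofinite atTop :=
    (tendsto_norm_comp_cofinite_atTop_of_isClosedEmbedding
      (Topology.IsClosedEmbedding.id (X := Fin 2 → ℤ))).const_mul_atTop (EisensteinSeries.r_pos τ)
  refine tendsto_atTop_mono' _ ?_ h1
  filter_upwards [eventually_cofinite_ne 0] with p hp
  exact EisensteinSeries.r_mul_max_le τ hp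

/-- Removing the first two Taylor terms of `1 / (z + ω)` leaves `z² / (ω² (z + ω))`, of order
`‖ω‖⁻³`, which is summable over a lattice of rank two. -/
lemma summable_zetaTerm (z : ℂ) (τ : ℍ) : Summable (zetaTerm z τ) := by
  have hinv : (fun p : Fin 2 → ℤ => (p 0 * (τ : ℂ) + p 1)⁻¹) =O[cofinite] fun p => ‖p‖⁻¹ := by
    simpa using isBigO_linear_add_const_vec τ 0 0
  have hlo : (fun _ : Fin 2 → ℤ => z) =o[cofinite] fun p => (p 0 * (τ : ℂ) + p 1) :=
    isLittleO_const_left.2 (Or.inr (tendsto_norm_lattice τ))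
  have hinv' : (fun p : Fin 2 → ℤ => (z + (p 0 * (τ : ℂ) + p 1))⁻¹) =O[cofinite]
      fun p => ‖p‖⁻¹ :=
    ((hlo.add_isTheta (isTheta_refl _ _)).inv.isBigO).trans hinv
  have hev : ∀ᶠ p : Fin 2 → ℤ in cofinite, zetaTerm z τ p =
      z ^ 2 * ((p 0 * (τ : ℂ) + p 1)⁻¹ ^ 2 * (z + (p 0 * (τ : ℂ) + p 1))⁻¹) := by
    filter_upwards [(tendsto_norm_lattice τ).eventually_gt_atTop ‖z‖] with p hp
    have h0 : (p 0 * (τ : ℂ) + p 1) ≠ 0 := norm_pos_iff.1 ((norm_nonneg z).trans_lt hp)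
    have h1 : z + (p 0 * (τ : ℂ) + p 1) ≠ 0 := fun h => by
      rw [eq_neg_of_add_eq_zero_left h, norm_neg] at hp
      exact lt_irrefl _ hp
    unfold zetaTerm
    field_simp
    ring
  refine summable_of_isBigO_rpow_norm (a := 3) (by norm_num) ?_
  refine (IsBigO.congr' ?_ (hev.mono fun _ h => h.symm) EventuallyEq.rfl)
  refine IsBigO.const_mul_left ?_ _
  refine ((hinv.pow 2).mul hinv').congr_right fun p => ?_
  rw [← pow_succ, inv_pow]
  norm_cast

/-- The lattice of `γ • τ` is that of `τ` divided by `denom γ τ`, and the zeta function is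
homogeneous of degree `-1`. Absolute convergence permits the reindexing `p ↦ p γ`. -/
lemma zetaFn_smul (z : ℂ) (τ : ℍ) (γ : SL(2, ℤ)) :
    zetaFn (z / denom γ τ) (γ • τ) = denom γ τ * zetaFn z τ := by
  have hj : (denom γ τ : ℂ) ≠ 0 := denom_ne_zero γ τ
  let e : (Fin 2 → ℤ) ≃ (Fin 2 → ℤ) :=
    { toFun := fun p => Matrix.vecMul p γ.1
      invFun := fun p => Matrix.vecMul p (γ⁻¹).1
      left_inv := fun p => by
        simp only [Matrix.vecMul_vecMul, ← Matrix.SpecialLinearGroup.coe_mul, mul_inv_cancel,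
          Matrix.SpecialLinearGroup.coe_one, Matrix.vecMul_one]
      right_inv := fun p => by
        simp only [Matrix.vecMul_vecMul, ← Matrix.SpecialLinearGroup.coe_mul, inv_mul_cancel,
          Matrix.SpecialLinearGroup.coe_one, Matrix.vecMul_one] }
  unfold zetaFn
  rw [← tsum_mul_left, ← e.tsum_eq (fun p => denom γ τ * zetaTerm z τ p)]
  refine tsum_congr fun p => ?_
  have hω : (p 0 * ((γ • τ : ℍ) : ℂ) + p 1) =
      (((e p) 0 : ℤ) * (τ : ℂ) + ((e p) 1 : ℤ)) / denom γ τ := by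
    have hc : ((γ • τ : ℍ) : ℂ) =
        ((γ 0 0 : ℤ) * (τ : ℂ) + (γ 0 1 : ℤ)) / ((γ 1 0 : ℤ) * (τ : ℂ) + (γ 1 1 : ℤ)) := by
      rw [UpperHalfPlane.specialLinearGroup_apply]
      simp
    rw [eq_div_iff hj, hc]
    rw [ModularGroup.denom_apply] at hj ⊢
    simp only [e, Equiv.coe_fn_mk, Matrix.vecMul, dotProduct, Fin.sum_univ_two]
    push_cast
    rw [add_mul, mul_assoc, div_mul_cancel₀ _ hj]
    ring
  unfold zetaTerm
  rw [hω, ← add_div, inv_div, inv_div, div_pow, inv_div]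
  field_simp

/-! ### Symmetric summation -/

/-- `π cot (π w)`. -/
def picot (w : ℂ) : ℂ := Real.pi * cot (Real.pi * w)

lemma picot_zero : picot 0 = 0 := by simp [picot, cot]

lemma picot_neg (w : ℂ) : picot (-w) = -picot w := by
  simp [picot, cot, div_neg]

lemma picot_add_one (w : ℂ) : picot (w + 1) = picot w := by
  simp [picot, cot, mul_add, Complex.sin_add_pi, Complex.cos_add_pi]

lemma tendsto_sum_picot {w : ℂ} (hw : w ∈ Complex.integerComplement) :
    Tendsto (fun N : ℕ => ∑ n ∈ Finset.Icc (-(N : ℤ)) N, (w + n)⁻¹) atTop (𝓝 (picot w)) := by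
  have h := (tendsto_logDeriv_euler_cot_sub hw).add_const w⁻¹
  have hsum : ∀ N : ℕ, ∑ n ∈ Finset.Icc (-(N : ℤ)) N, (w + n)⁻¹ =
      ∑ j ∈ Finset.range N, cotTerm w j + w⁻¹ := by
    intro N
    induction N with
    | zero => simp
    | succ N ih =>
      rw [Finset.sum_range_succ, Nat.cast_succ, Finset.sum_Icc_succ_eq_add_endpoints, ih, cotTerm]
      push_cast
      rw [← sub_eq_add_neg]
      ring
  simp only [hsum]
  convert! h using 2
  simp [picot]

lemma sum_Icc_odd {f : ℤ → ℂ} (hf : ∀ n, f (-n) = -f n) (N : ℕ) :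
    ∑ n ∈ Finset.Icc (-(N : ℤ)) N, f n = 0 := by
  have h0 : f 0 = 0 := by
    have := hf 0
    rw [neg_zero] at this
    exact self_eq_neg.1 this
  induction N with
  | zero => simp [h0]
  | succ N ih =>
    rw [Nat.cast_succ, Finset.sum_Icc_succ_eq_add_endpoints, ih, hf]
    ring

/-- The conventions `0⁻¹ = 0` and `cot 0 = 0` agree here, so that the row `m = 0` of the lattice
needs no separate formula later. -/
lemma tendsto_sum_picot_zero :
    Tendsto (fun N : ℕ => ∑ n ∈ Finset.Icc (-(N : ℤ)) N, ((0 : ℂ) + n)⁻¹) atTop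
      (𝓝 (picot 0)) := by
  rw [picot_zero]
  refine tendsto_const_nhds.congr fun N => (sum_Icc_odd (fun n => ?_) N).symm
  rw [zero_add, zero_add, Int.cast_neg, inv_neg]

lemma HasSum.tendsto_sum_Icc {f : ℤ → ℂ} {s : ℂ} (h : HasSum f s) :
    Tendsto (fun N : ℕ => ∑ n ∈ Finset.Icc (-(N : ℤ)) N, f n) atTop (𝓝 s) :=
  h.comp Finset.tendsto_Icc_neg

/-- `ζ(z) - z G₂`, the regularised sum of `1 / (z + ω)` over the lattice `ℤτ + ℤ`. -/
def latticeCot (z : ℂ) (τ : ℍ) : ℂ := zetaFn z τ - z * G2 τ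

/-- `z` is not in the lattice `ℤτ + ℤ`. -/
def OffLattice (z : ℂ) (τ : ℍ) : Prop := ∀ m n : ℤ, z + m * τ + n ≠ 0

lemma OffLattice.mem_integerComplement {z : ℂ} {τ : ℍ} (hz : OffLattice z τ) (m : ℤ) :
    z + m * τ ∈ Complex.integerComplement := by
  rintro ⟨n, hn⟩
  apply hz m (-n)
  rw [← hn]
  simp

lemma tendsto_sum_picot_lattice (τ : ℍ) (m : ℤ) :
    Tendsto (fun N : ℕ => ∑ n ∈ Finset.Icc (-(N : ℤ)) N, (m * (τ : ℂ) + n)⁻¹) atTop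
      (𝓝 (picot (m * τ))) := by
  rcases eq_or_ne m 0 with rfl | hm
  · simpa using tendsto_sum_picot_zero
  · apply tendsto_sum_picot
    rintro ⟨n, hn⟩
    have := congrArg Complex.im hn
    simp [hm, τ.im_ne_zero] at this

/-- The row converges absolutely only as a whole; its value is found along symmetric partial sums,
where the reciprocal terms converge separately to cotangents. -/
lemma hasSum_zetaTerm_row {z : ℂ} {τ : ℍ} (hz : OffLattice z τ) (m : ℤ) :
    HasSum (fun n : ℤ => zetaTerm z τ ![m, n])
      (picot (z + m * τ) - picot (m * τ) + z * e2Summand m τ) := by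
  have hs : Summable fun n : ℤ => zetaTerm z τ ![m, n] := by
    have := (finTwoArrowEquiv ℤ).symm.summable_iff.2 (summable_zetaTerm z τ)
    exact this.prod_factor m
  have h1 := HasSum.tendsto_sum_Icc hs.hasSum
  have h2 : Tendsto (fun N : ℕ => ∑ n ∈ Finset.Icc (-(N : ℤ)) N, zetaTerm z τ ![m, n]) atTop
      (𝓝 (picot (z + m * τ) - picot (m * τ) + z * e2Summand m τ)) := by
    have h3 := (((tendsto_sum_picot (hz.mem_integerComplement m)).sub
      (tendsto_sum_picot_lattice τ m)).add
        ((HasSum.tendsto_sum_Icc (e2Summand_summable m τ).hasSum).const_mul z))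
    refine h3.congr fun N => ?_
    rw [Finset.mul_sum, ← Finset.sum_sub_distrib, ← Finset.sum_add_distrib]
    refine Finset.sum_congr rfl fun n _ => ?_
    simp [zetaTerm, eisSummand, add_assoc]
  rw [← tendsto_nhds_unique h1 h2]
  exact hs.hasSum

/-- Sum the rows symmetrically: the `picot (m * τ)` cancel by oddness, and the `e2Summand` rows add
up to `G2`, which is exactly what the term `-z G₂` removes. -/
lemma tendsto_sum_latticeCot {z : ℂ} {τ : ℍ} (hz : OffLattice z τ) :
    Tendsto (fun N : ℕ => ∑ m ∈ Finset.Icc (-(N : ℤ)) N, picot (z + m * τ)) atTop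
      (𝓝 (latticeCot z τ)) := by
  have hs : Summable fun p : ℤ × ℤ => zetaTerm z τ ![p.1, p.2] :=
    (finTwoArrowEquiv ℤ).symm.summable_iff.2 (summable_zetaTerm z τ)
  have h1 : HasSum (fun m : ℤ => picot (z + m * τ) - picot (m * τ) + z * e2Summand m τ)
      (zetaFn z τ) := by
    have h2 := hs.hasSum.prod_fiberwise (fun m => hasSum_zetaTerm_row hz m)
    convert! h2 using 1
    exact ((finTwoArrowEquiv ℤ).symm.tsum_eq _).symm
  have h3 : Tendsto (fun N : ℕ => ∑ m ∈ Finset.Icc (-(N : ℤ)) N, e2Summand m τ) atTop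
      (𝓝 (G2 τ)) := by
    have := hasSum_e2Summand_symmetricIcc τ
    rw [← G2_eq_tsum_cexp] at this
    rwa [SummationFilter.hasSum_symmetricIcc_iff] at this
  refine ((HasSum.tendsto_sum_Icc h1).sub (h3.const_mul z)).congr fun N => ?_
  have h4 : ∑ m ∈ Finset.Icc (-(N : ℤ)) N, picot (m * τ) = 0 :=
    sum_Icc_odd (fun n => by rw [Int.cast_neg, neg_mul, picot_neg]) N
  rw [Finset.sum_add_distrib, Finset.sum_sub_distrib, h4, Finset.mul_sum]
  ring

/-! ### Quasi-periodicity and modularity -/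

lemma latticeCot_add_one {z : ℂ} {τ : ℍ} (hz : OffLattice z τ) :
    latticeCot (z + 1) τ = latticeCot z τ := by
  have hz' : OffLattice (z + 1) τ := fun m n h => hz m (n + 1) (by rw [← h]; push_cast; ring)
  refine tendsto_nhds_unique (tendsto_sum_latticeCot hz') ?_
  refine (tendsto_sum_latticeCot hz).congr fun N => Finset.sum_congr rfl fun m _ => ?_
  rw [← picot_add_one]
  ring_nf

lemma picot_eq_of_im_pos {w : ℂ} (hw : 0 < w.im) :
    picot w = -(Real.pi * I) -
      2 * Real.pi * I * ∑' d : ℕ+, cexp (2 * Real.pi * I * w) ^ (d : ℕ) := by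
  have h := pi_mul_cot_pi_q_exp ⟨w, hw⟩
  have h1 : ‖cexp (2 * Real.pi * I * w)‖ < 1 := norm_exp_two_pi_I_lt_one ⟨w, hw⟩
  rw [tsum_pnat_eq_tsum_succ (f := fun n => cexp (2 * Real.pi * I * w) ^ n)]
  have h2 := (summable_geometric_of_norm_lt_one h1).tsum_eq_zero_add
  change picot w = _ at h
  rw [h]
  change _ - _ * ∑' n : ℕ, cexp (2 * Real.pi * I * w) ^ n = _
  rw [h2]
  ring

lemma picot_eq_exp (w : ℂ) : picot w =
    Real.pi * ((cexp (2 * Real.pi * I * w) + 1) / (I * (1 - cexp (2 * Real.pi * I * w)))) := by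
  rw [picot, Complex.cot_pi_eq_exp_ratio]

lemma tendsto_picot_add (z : ℂ) (τ : ℍ) :
    Tendsto (fun N : ℕ => picot (z + N * τ)) atTop (𝓝 (-(Real.pi * I))) := by
  have h0 : Tendsto (fun N : ℕ => cexp (2 * Real.pi * I * (z + N * τ))) atTop (𝓝 0) := by
    have h1 := (tendsto_pow_atTop_nhds_zero_of_norm_lt_one
      (norm_exp_two_pi_I_lt_one τ)).const_mul (cexp (2 * Real.pi * I * z))
    rw [mul_zero] at h1
    refine h1.congr fun N => ?_
    rw [← Complex.exp_nat_mul, ← Complex.exp_add]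
    ring_nf
  simp only [picot_eq_exp]
  have h2 := ((h0.add_const 1).div ((h0.const_sub 1).const_mul I) (by simp)).const_mul
    (Real.pi : ℂ)
  convert! h2 using 2
  simp

/-- A shift by `τ` replaces the lowest row of the partial sum by a new highest one. Each of these
two boundary terms contributes `-πi` in the limit. -/
lemma latticeCot_add_tau {z : ℂ} {τ : ℍ} (hz : OffLattice z τ) :
    latticeCot (z + τ) τ = latticeCot z τ - 2 * Real.pi * I := by
  have hz' : OffLattice (z + τ) τ := fun m n h => hz (m + 1) n (by rw [← h]; push_cast; ring)
  refine tendsto_nhds_unique (tendsto_sum_latticeCot hz') ?_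
  have h1 := ((tendsto_sum_latticeCot hz).add
    ((tendsto_picot_add (z + τ) τ).add (tendsto_picot_add (-z) τ)))
  have h2 : latticeCot z τ + (-(Real.pi * I) + -(Real.pi * I)) =
      latticeCot z τ - 2 * Real.pi * I := by ring
  rw [h2] at h1
  refine h1.congr fun N => ?_
  have h3 : picot (-z + N * τ) = -picot (z + (-(N : ℤ) : ℤ) * τ) := by
    rw [← picot_neg]
    push_cast
    ring_nf
  have h4 : ∀ m : ℤ, picot (z + τ + m * τ) = picot (z + (m + 1 : ℤ) * τ) := fun m => by
    push_cast
    ring_nf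
  have h5 : picot (z + τ + N * τ) = picot (z + (N + 1 : ℤ) * τ) := h4 N
  simp only [h4]
  rw [h3, h5]
  have h6 : ∀ f : ℤ → ℂ, ∑ m ∈ Finset.Icc (-(N : ℤ)) N, f (m + 1) =
      ∑ m ∈ Finset.Icc (-(N : ℤ)) N, f m + (f (N + 1) - f (-N)) := by
    intro f
    rw [← sub_eq_iff_eq_add', ← Finset.sum_sub_distrib]
    clear * -
    induction N with
    | zero => simp
    | succ N ih =>
      rw [Nat.cast_succ, Finset.sum_Icc_succ_eq_add_endpoints, ih]
      ring_nf
  rw [h6 (fun m => picot (z + m * τ))]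
  push_cast
  ring

lemma OffLattice.add {z : ℂ} {τ : ℍ} (hz : OffLattice z τ) (m n : ℤ) :
    OffLattice (z + m * τ + n) τ := fun m' n' h => hz (m' + m) (n' + n) (by
  rw [← h]; push_cast; ring)

lemma latticeCot_add_lattice {z : ℂ} {τ : ℍ} (hz : OffLattice z τ) (m n : ℤ) :
    latticeCot (z + m * τ + n) τ = latticeCot z τ - 2 * Real.pi * I * m := by
  have key : ∀ n : ℤ, ∀ w : ℂ, OffLattice w τ → latticeCot (w + n) τ = latticeCot w τ := by
    intro n
    induction n using Int.induction_on with
    | zero => simp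
    | succ i ih =>
      intro w hw
      rw [← ih w hw]
      have := latticeCot_add_one (by simpa using hw.add 0 i)
      push_cast at this ⊢
      rw [← this, add_assoc]
    | pred i ih =>
      intro w hw
      rw [← ih w hw]
      have := latticeCot_add_one (by simpa using hw.add 0 (-i - 1))
      push_cast at this ⊢
      rw [← this]
      ring_nf
  rw [key n _ (by simpa using hz.add m 0)]
  induction m using Int.induction_on with
  | zero => simp
  | succ i ih =>
    have := latticeCot_add_tau (by simpa using hz.add i 0)
    push_cast at this ⊢
    rw [show z + ((i : ℂ) + 1) * τ = z + i * τ + τ by ring, this]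
    push_cast at ih
    rw [ih]
    ring
  | pred i ih =>
    have := latticeCot_add_tau (by simpa using hz.add (-i - 1) 0)
    push_cast at this ih ⊢
    rw [show z + (-(i : ℂ) - 1) * τ + τ = z + -i * τ by ring, ih] at this
    linear_combination -this

/-- The zeta function transforms without error, so the linear term comes entirely from the
quasimodularity of `G2`. -/
lemma latticeCot_smul (z : ℂ) (τ : ℍ) (γ : SL(2, ℤ)) :
    latticeCot (z / denom γ τ) (γ • τ) =
      denom γ τ * latticeCot z τ + 2 * Real.pi * I * (γ 1 0 : ℤ) * z := by
  have hj : (denom γ τ : ℂ) ≠ 0 := denom_ne_zero γ τ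
  have h := congrFun (G2_slash_action γ) τ
  rw [ModularForm.SL_slash_apply, Pi.sub_apply, D2] at h
  have h2 : G2 (γ • τ) = denom γ τ ^ 2 * G2 τ - 2 * Real.pi * I * (γ 1 0 : ℤ) * denom γ τ := by
    rw [zpow_neg, ← div_eq_mul_inv, div_eq_iff (zpow_ne_zero _ hj)] at h
    rw [h, sub_mul]
    norm_cast
    field_simp
  rw [latticeCot, latticeCot, zetaFn_smul, h2]
  field_simp
  ring

end ToricForms

namespace ToricForms

open Filter Topology Asymptotics EisensteinSeries

/-! ### Expansion in powers of `q` -/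

/-- `e(w) = exp (2πiw)`. -/
def ex (w : ℂ) : ℂ := cexp (2 * Real.pi * I * w)

lemma ex_add (w w' : ℂ) : ex (w + w') = ex w * ex w' := by
  rw [ex, ex, ex, ← Complex.exp_add, mul_add]

lemma ex_natCast_mul (n : ℕ) (w : ℂ) : ex (n * w) = ex w ^ n := by
  rw [ex, ex, ← Complex.exp_nat_mul]
  ring_nf

lemma ex_intCast_mul (n : ℤ) (w : ℂ) : ex (n * w) = ex w ^ n := by
  rw [ex, ex, ← Complex.exp_int_mul]
  ring_nf

lemma ex_one : ex 1 = 1 := by simp [ex]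

lemma ex_intCast (n : ℤ) : ex n = 1 := by
  rw [← mul_one (n : ℂ), ex_intCast_mul, ex_one, one_zpow]

lemma ex_ne_zero (w : ℂ) : ex w ≠ 0 := Complex.exp_ne_zero _

lemma norm_ex (w : ℂ) : ‖ex w‖ = Real.exp (-2 * Real.pi * w.im) := by
  rw [ex, Complex.norm_exp]
  simp

lemma norm_ex_lt_one (τ : ℍ) : ‖ex τ‖ < 1 := norm_exp_two_pi_I_lt_one τ

lemma summable_pow_mul_pow {A ρ : ℝ} (hA : 1 ≤ A) (hρ : 0 ≤ ρ) (h : A * ρ < 1) :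
    Summable fun p : ℕ+ × ℕ+ => A ^ (p.1 : ℕ) * ρ ^ ((p.1 : ℕ) * p.2) := by
  have h0 : 0 ≤ A * ρ := by positivity
  have h1 : Summable fun c : ℕ+ × ℕ+ => (A * ρ) ^ ((c.1 : ℕ) * c.2) := by
    simpa using summable_prod_mul_pow (𝕜 := ℝ) 0 (r := A * ρ)
      (by rwa [Real.norm_of_nonneg h0])
  refine Summable.of_nonneg_of_le (fun p => by positivity) (fun p => ?_) h1
  rw [mul_pow]
  gcongr
  exact Nat.le_mul_of_pos_right _ p.2.pos

lemma norm_ex_le (w : ℂ) : ‖ex w‖ ≤ Real.exp (2 * Real.pi * |w.im|) := by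
  rw [norm_ex, Real.exp_le_exp]
  nlinarith [neg_abs_le w.im, Real.pi_pos]

lemma summable_ex_mul {z : ℂ} {τ : ℍ} (hz : |z.im| < τ.im) :
    Summable fun p : ℕ+ × ℕ+ => ex z ^ (p.1 : ℕ) * ex τ ^ ((p.1 : ℕ) * p.2) := by
  have hA : 1 ≤ Real.exp (2 * Real.pi * |z.im|) := by
    rw [Real.one_le_exp_iff]; positivity
  refine Summable.of_norm_bounded (summable_pow_mul_pow hA (norm_nonneg (ex τ)) ?_) fun p => ?_
  · rw [norm_ex, ← Real.exp_add, Real.exp_lt_one_iff, coe_im]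
    nlinarith [Real.pi_pos]
  · rw [norm_mul, norm_pow, norm_pow]
    gcongr
    exact norm_ex_le z

/-- The bound on `z.im` puts `z + m τ` and `-z + m τ` in the upper half plane; after oddness is
applied to the second cotangent, both expand in `q` and their constants cancel. -/
lemma picot_add_add_picot_sub {z : ℂ} {τ : ℍ} (hz : |z.im| < τ.im) (m : ℕ+) :
    picot (z + m * τ) + picot (z + -m * τ) =
      -(2 * Real.pi * I) * ∑' d : ℕ+, (ex z ^ (d : ℕ) - ex (-z) ^ (d : ℕ)) *
        ex τ ^ ((d : ℕ) * m) := by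
  have hm : (1 : ℝ) ≤ m := by exact_mod_cast m.pos
  obtain ⟨hz1, hz2⟩ := abs_lt.1 hz
  have hτ := τ.im_pos
  have h1 : 0 < (z + m * τ).im := by
    simp only [add_im, mul_im, natCast_re, coe_im, natCast_im, zero_mul, add_zero]
    nlinarith
  have h2 : 0 < (-z + m * τ).im := by
    simp only [add_im, neg_im, mul_im, natCast_re, coe_im, natCast_im, zero_mul, add_zero]
    nlinarith
  have h3 : picot (z + -m * τ) = -picot (-z + m * τ) := by
    rw [← picot_neg]
    ring_nf
  have hs : ∀ w : ℂ, |w.im| < τ.im → Summable fun d : ℕ+ => ex w ^ (d : ℕ) *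
      ex τ ^ ((d : ℕ) * m) := fun w hw =>
    (summable_ex_mul hw).comp_injective (i := fun d : ℕ+ => (d, m)) fun a b h => (Prod.ext_iff.1 h).1
  have h4 : ∀ w : ℂ, ∀ d : ℕ+, cexp (2 * Real.pi * I * (w + m * τ)) ^ (d : ℕ) =
      ex w ^ (d : ℕ) * ex τ ^ ((d : ℕ) * m) := by
    intro w d
    change ex (w + m * τ) ^ (d : ℕ) = _
    rw [ex_add, ex_natCast_mul, mul_pow, ← pow_mul, mul_comm (d : ℕ)]
  rw [h3, picot_eq_of_im_pos h1, picot_eq_of_im_pos h2]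
  simp only [h4, sub_mul]
  rw [(hs z hz).tsum_sub (hs (-z) (by simpa using hz))]
  ring

lemma latticeCot_eq {z : ℂ} {τ : ℍ} (hz : |z.im| < τ.im) (hz' : OffLattice z τ) :
    latticeCot z τ = picot z - 2 * Real.pi * I * ∑' p : ℕ+ × ℕ+,
      (ex z ^ (p.1 : ℕ) - ex (-z) ^ (p.1 : ℕ)) * ex τ ^ ((p.1 : ℕ) * p.2) := by
  have hs : Summable fun p : ℕ+ × ℕ+ =>
      (ex z ^ (p.1 : ℕ) - ex (-z) ^ (p.1 : ℕ)) * ex τ ^ ((p.1 : ℕ) * p.2) := by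
    simp only [sub_mul]
    exact (summable_ex_mul hz).sub (summable_ex_mul (by simpa using hz))
  have hs' : Summable fun p : ℕ+ × ℕ+ =>
      (ex z ^ (p.2 : ℕ) - ex (-z) ^ (p.2 : ℕ)) * ex τ ^ ((p.2 : ℕ) * p.1) :=
    (Equiv.prodComm ℕ+ ℕ+).summable_iff.2 hs
  have h1 : HasSum (fun m : ℕ+ => picot (z + m * τ) + picot (z + -m * τ))
      (-(2 * Real.pi * I) * ∑' p : ℕ+ × ℕ+,
      (ex z ^ (p.1 : ℕ) - ex (-z) ^ (p.1 : ℕ)) * ex τ ^ ((p.1 : ℕ) * p.2)) := by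
    simp only [picot_add_add_picot_sub hz]
    refine HasSum.mul_left _ ?_
    rw [← (Equiv.prodComm ℕ+ ℕ+).tsum_eq]
    exact hs'.hasSum.prod_fiberwise fun m => (hs'.prod_factor m).hasSum
  rw [hasSum_pnat_iff_hasSum_succ (f := fun m : ℕ => picot (z + m * τ) + picot (z + -m * τ))] at h1
  refine tendsto_nhds_unique (tendsto_sum_latticeCot hz') ?_
  rw [sub_eq_add_neg, ← neg_mul]
  refine (h1.tendsto_sum_nat.const_add (picot z)).congr fun N => ?_
  induction N with
  | zero => simp
  | succ N ih =>
    have hN : ((N + 1 : ℕ) : ℤ) = (N : ℤ) + 1 := by push_cast; ring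
    rw [Finset.sum_range_succ, hN, Finset.sum_Icc_succ_eq_add_endpoints, ← ih, ← add_assoc,
      add_comm (picot _ + _) (picot z + _)]
    congr 1
    push_cast
    ring_nf

/-! ### The finite Fourier transform -/

variable {l : ℕ} [NeZero l]

lemma ex_div_pow_card (k : ℤ) : ex (k / l) ^ l = 1 := by
  rw [← ex_natCast_mul, mul_div_cancel₀ _ (by exact_mod_cast NeZero.ne l), ex_intCast]

lemma ex_div_eq_one_iff (k : ℤ) : ex (k / l) = 1 ↔ (k : ZMod l) = 0 := by
  have hl : (l : ℂ) ≠ 0 := by exact_mod_cast NeZero.ne l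
  rw [ZMod.intCast_zmod_eq_zero_iff_dvd, ex, Complex.exp_eq_one_iff]
  constructor
  · rintro ⟨n, hn⟩
    refine ⟨n, ?_⟩
    have h1 : (k : ℂ) / l = n := by
      have h2 : (2 * Real.pi * I : ℂ) ≠ 0 := by simp
      exact mul_left_cancel₀ h2 (by rw [hn]; ring)
    rw [div_eq_iff hl] at h1
    have h3 : (k : ℂ) = ((l * n : ℤ) : ℂ) := by rw [h1]; push_cast; ring
    exact_mod_cast h3
  · rintro ⟨n, rfl⟩
    refine ⟨n, ?_⟩
    push_cast
    field_simp

lemma sum_ex_div (k : ℤ) : ∑ j ∈ Finset.range l, ex (k / l) ^ j =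
    if (k : ZMod l) = 0 then (l : ℂ) else 0 := by
  split_ifs with h
  · rw [(ex_div_eq_one_iff k).2 h]
    simp
  · have h1 : ex (k / l : ℂ) ≠ 1 := fun h' => h ((ex_div_eq_one_iff k).1 h')
    rw [geom_sum_eq h1, ex_div_pow_card, sub_self, zero_div]

/-- The finite Fourier transform of `latticeCot` along the `l`-division points of `ℤ`. -/
def latticeFourier (a : ZMod l) (z : ℂ) (τ : ℍ) : ℂ :=
  -(2 * Real.pi * I * l)⁻¹ *
    ∑ j ∈ Finset.range l, ex (((-a.val : ℤ) : ℂ) / l) ^ j * latticeCot (z + j / l) τ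

/-- Comparing imaginary parts forces `m = 0`; then `z` would be an integral multiple of `1 / l` of
norm below `1 / l`, hence zero. -/
lemma offLattice_of_small {z : ℂ} {τ : ℍ} (h0 : z ≠ 0) (h1 : ‖z‖ < 1 / l) (h2 : ‖z‖ < τ.im)
    (j : ℕ) : OffLattice (z + j / l) τ := by
  have hl : (0 : ℝ) < l := by exact_mod_cast Nat.pos_of_neZero l
  intro m n h
  have him := congrArg Complex.im h
  have hjl : ((j : ℂ) / l).im = 0 := by
    rw [show ((j : ℂ) / l) = ((j / l : ℝ) : ℂ) by push_cast; ring, ofReal_im]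
  simp only [add_im, hjl, mul_im, intCast_re, coe_im, intCast_im, zero_mul, add_zero, zero_im] at him
  have hm : m = 0 := by
    by_contra hm
    have hm1 : (1 : ℝ) ≤ |(m : ℝ)| := by exact_mod_cast Int.one_le_abs hm
    have : |z.im| = |(m : ℝ)| * τ.im := by
      rw [show z.im = -(m * τ.im) by linarith, abs_neg, abs_mul, abs_of_pos τ.im_pos]
    nlinarith [abs_im_le_norm z, τ.im_pos]
  subst hm
  have hz : z = ((-(j + n * l) : ℤ) : ℂ) / l := by
    have hl' : (l : ℂ) ≠ 0 := by exact_mod_cast hl.ne'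
    rw [eq_div_iff hl']
    have h3 : z = -(j / l + n) := by
      rw [Int.cast_zero, zero_mul, add_zero] at h
      linear_combination h
    rw [h3]
    push_cast
    field_simp
  rw [hz, norm_div, Complex.norm_natCast, div_lt_div_iff_of_pos_right hl, Complex.norm_intCast] at h1
  have h4 : -((j : ℤ) + n * l) = 0 := Int.abs_lt_one_iff.1 (by exact_mod_cast h1)
  rw [hz, h4] at h0
  simp at h0

/-- For `γ` in `Γ₁(l)`, multiplication by the denominator fixes each `j / l` modulo the lattice. The
quasi-period incurred cancels the part of the linear error of `latticeCot_smul` coming from `j / l`.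
What remains of the error does not depend on `j`, so its Fourier coefficient vanishes unless `a =
0`. -/
lemma latticeFourier_smul (a : ZMod l) {z : ℂ} {τ : ℍ} (h0 : z ≠ 0) (h1 : ‖z‖ < 1 / l)
    (h2 : ‖z‖ < τ.im) {γ : SL(2, ℤ)} (hγ : γ ∈ CongruenceSubgroup.Gamma1 l) :
    latticeFourier a (z / denom γ τ) (γ • τ) =
      denom γ τ * latticeFourier a z τ - if a = 0 then (γ 1 0 : ℤ) * z else 0 := by
  have hl' : (l : ℂ) ≠ 0 := by exact_mod_cast NeZero.ne l
  have hj : (denom γ τ : ℂ) ≠ 0 := denom_ne_zero γ τ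
  obtain ⟨-, h11, h10⟩ := (CongruenceSubgroup.Gamma1_mem l γ).1 hγ
  obtain ⟨c, hc⟩ := (ZMod.intCast_zmod_eq_zero_iff_dvd _ _).1 h10
  obtain ⟨d, hd⟩ := (ZMod.intCast_zmod_eq_zero_iff_dvd (γ 1 1 - 1) l).1 (by
    push_cast
    rw [h11, sub_self])
  have hd' : γ 1 1 = 1 + l * d := by linarith
  have hden : (denom γ τ : ℂ) = (l * c : ℤ) * τ + (1 + l * d : ℤ) := by
    rw [ModularGroup.denom_apply, hc, hd']
  have key : ∀ j : ℕ, latticeCot (z / denom γ τ + j / l) (γ • τ) =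
      denom γ τ * latticeCot (z + j / l) τ + 2 * Real.pi * I * (γ 1 0 : ℤ) * z := by
    intro j
    have e1 : z / denom γ τ + j / l = (z + j / l * denom γ τ) / denom γ τ := by
      rw [add_div, mul_div_cancel_right₀ _ hj]
    have e2 : z + j / l * denom γ τ = z + j / l + ((j * c : ℤ) : ℂ) * τ + (j * d : ℤ) := by
      rw [hden]
      push_cast
      field_simp
      ring
    rw [e1, latticeCot_smul, e2, latticeCot_add_lattice (offLattice_of_small h0 h1 h2 j), ← e2, hc]
    push_cast
    field_simp
    ring
  have ha : ∑ j ∈ Finset.range l, ex (((-a.val : ℤ) : ℂ) / l) ^ j =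
      if a = 0 then (l : ℂ) else 0 := by
    rw [sum_ex_div]
    simp
  rw [latticeFourier, latticeFourier]
  simp only [key, mul_add, Finset.sum_add_distrib]
  rw [← Finset.sum_mul, ha]
  have e3 : ∑ j ∈ Finset.range l, ex (((-a.val : ℤ) : ℂ) / l) ^ j *
      (denom γ τ * latticeCot (z + j / l) τ) =
      denom γ τ * ∑ j ∈ Finset.range l, ex (((-a.val : ℤ) : ℂ) / l) ^ j *
      latticeCot (z + j / l) τ := by
    rw [Finset.mul_sum]
    exact Finset.sum_congr rfl fun j _ => by ring
  rw [e3]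
  split_ifs with h
  · have h2 : (2 * Real.pi * I : ℂ) ≠ 0 := by simp
    field_simp
    ring
  · ring

end ToricForms

namespace ToricForms

open Filter Topology Asymptotics EisensteinSeries
open scoped Nat

/-! ### The generating function of the Bernoulli polynomials -/

/-- For `m ≥ 2` the Fourier series of the Bernoulli function is dominated by `∑ 2 / n²`, and the
factor `(2π)^m` only helps. The degrees `0` and `1` are checked by hand. -/
lemma norm_bernoulli_div_factorial_le : ∃ K : ℝ, ∀ (m : ℕ) (x : ℚ), 0 ≤ x → x ≤ 1 →
    ‖(((Polynomial.bernoulli m).eval x / m ! : ℚ) : ℂ)‖ ≤ K := by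
  set S : ℝ := ∑' n : ℕ, 2 / (n : ℝ) ^ 2 with hS
  have hs : Summable fun n : ℕ => 2 / (n : ℝ) ^ 2 := by
    simpa [div_eq_mul_inv] using (Real.summable_nat_pow_inv.2 one_lt_two).mul_left 2
  have hS0 : 0 ≤ S := tsum_nonneg fun n => by positivity
  refine ⟨S + 2, fun m x h0 h1 => ?_⟩
  rcases lt_or_ge m 2 with hm | hm
  · interval_cases m
    · simp; linarith
    · have : ‖((x - 2⁻¹ : ℚ) : ℂ)‖ ≤ 2 := by
        rw [show ((x - 2⁻¹ : ℚ) : ℂ) = ((x - 2⁻¹ : ℚ) : ℝ) by push_cast; rfl, Complex.norm_real,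
          Real.norm_eq_abs]
        have : |x - 2⁻¹| ≤ (2 : ℚ) := by rw [abs_le]; constructor <;> linarith
        exact_mod_cast this
      simp at this ⊢
      linarith
  · have hx : (x : ℝ) ∈ Set.Icc (0 : ℝ) 1 := ⟨by exact_mod_cast h0, by exact_mod_cast h1⟩
    have h := hasSum_one_div_nat_pow_mul_fourier hm hx
    have hb : ∀ n : ℕ, ‖(1 : ℂ) / (n : ℂ) ^ m * (fourier n ((x : ℝ) : UnitAddCircle) +
        (-1 : ℂ) ^ m * fourier (-n) ((x : ℝ) : UnitAddCircle))‖ ≤ 2 / (n : ℝ) ^ 2 := by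
      intro n
      rcases Nat.eq_zero_or_pos n with rfl | hn
      · simp [show m ≠ 0 by omega]
      · have hn1 : (1 : ℝ) ≤ n := by exact_mod_cast hn
        rw [norm_mul, norm_div, norm_one, norm_pow, Complex.norm_natCast, div_mul_eq_mul_div, one_mul]
        have h2 : ‖fourier (n : ℤ) ((x : ℝ) : UnitAddCircle) +
            (-1 : ℂ) ^ m * fourier (-n : ℤ) ((x : ℝ) : UnitAddCircle)‖ ≤ 2 := by
          refine (norm_add_le _ _).trans ?_
          rw [norm_mul, norm_pow, norm_neg, norm_one, one_pow, one_mul]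
          simp only [fourier_apply, Circle.norm_coe]
          norm_num
        gcongr
    have h3 := tsum_of_norm_bounded hs.hasSum hb
    rw [h.tsum_eq, norm_mul, norm_div, norm_neg, norm_pow] at h3
    have h4 : ‖(2 * Real.pi * I : ℂ)‖ = 2 * Real.pi := by
      simp [abs_of_pos Real.pi_pos]
    have h5 : (1 : ℝ) ≤ (2 * Real.pi) ^ m := one_le_pow₀ (by nlinarith [Real.pi_gt_three])
    rw [h4] at h3
    have h6 : (bernoulliFun m x : ℂ) = (((Polynomial.bernoulli m).eval x : ℚ) : ℂ) := by
      have : bernoulliFun m x = (((Polynomial.bernoulli m).eval x : ℚ) : ℝ) := by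
        rw [bernoulliFun, Polynomial.eval_map]
        exact Polynomial.eval₂_at_apply (algebraMap ℚ ℝ) x
      rw [this]
      push_cast
      rfl
    rw [h6, norm_natCast] at h3
    have h7 : ‖(((Polynomial.bernoulli m).eval x / m ! : ℚ) : ℂ)‖ =
        ‖(((Polynomial.bernoulli m).eval x : ℚ) : ℂ)‖ / m ! := by
      push_cast
      rw [norm_div, norm_natCast]
    rw [h7]
    have h8 : ‖(((Polynomial.bernoulli m).eval x : ℚ) : ℂ)‖ / m ! ≤
        (2 * Real.pi) ^ m / m ! * ‖(((Polynomial.bernoulli m).eval x : ℚ) : ℂ)‖ := by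
      rw [div_mul_eq_mul_div]
      gcongr
      exact le_mul_of_one_le_left (norm_nonneg _) h5
    linarith

lemma exp_ne_one_of_norm_lt {t : ℂ} (h0 : t ≠ 0) (h1 : ‖t‖ < 1) : cexp t ≠ 1 := by
  intro h
  obtain ⟨n, hn⟩ := Complex.exp_eq_one_iff.1 h
  have hn0 : n ≠ 0 := by
    rintro rfl
    simp at hn
    exact h0 hn
  have hn1 : (1 : ℝ) ≤ |(n : ℝ)| := by exact_mod_cast Int.one_le_abs hn0
  have h2 : ‖t‖ = |(n : ℝ)| * (2 * Real.pi) := by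
    rw [hn]
    simp [abs_of_pos Real.pi_pos]
  nlinarith [Real.pi_gt_three]

/-- The formal identity for the generating function becomes analytic through a Cauchy product with
the series of `e^t - 1`, which is nonzero for `0 < ‖t‖ < 1`. -/
lemma hasSum_bernoulli {x : ℚ} (hx0 : 0 ≤ x) (hx1 : x ≤ 1) {t : ℂ} (h0 : t ≠ 0) (h1 : ‖t‖ < 1) :
    HasSum (fun m => (((Polynomial.bernoulli m).eval x / m ! : ℚ) : ℂ) * t ^ m)
      (t * cexp (x * t) / (cexp t - 1)) := by
  obtain ⟨K, hK⟩ := norm_bernoulli_div_factorial_le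
  have hf : Summable fun m => ‖(((Polynomial.bernoulli m).eval x / m ! : ℚ) : ℂ) * t ^ m‖ := by
    refine Summable.of_nonneg_of_le (fun _ => norm_nonneg _) (fun m => ?_)
      ((summable_geometric_of_lt_one (norm_nonneg t) h1).mul_left K)
    rw [norm_mul, norm_pow]
    exact mul_le_mul_of_nonneg_right (hK m x hx0 hx1) (by positivity)
  have hexp : ∀ u : ℂ, HasSum (fun n : ℕ => u ^ n / n !) (cexp u) := fun u => by
    rw [Complex.exp_eq_exp_ℂ]
    exact NormedSpace.expSeries_div_hasSum_exp u
  have hexpn : Summable fun n : ℕ => ‖t ^ n / (n ! : ℂ)‖ := NormedSpace.norm_expSeries_div_summable t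
  have hg : HasSum (fun n : ℕ => t ^ n / (n ! : ℂ) - if n = 0 then 1 else 0) (cexp t - 1) :=
    (hexp t).sub (hasSum_ite_eq 0 1)
  have hgn : Summable fun n : ℕ => ‖t ^ n / (n ! : ℂ) - if n = 0 then 1 else 0‖ := by
    refine Summable.of_nonneg_of_le (fun _ => norm_nonneg _) (fun n => norm_sub_le _ _)
      (hexpn.add ((hasSum_ite_eq 0 (1 : ℝ)).summable.congr fun n => ?_))
    split_ifs <;> simp
  have hprod := tsum_mul_tsum_eq_tsum_sum_antidiagonal_of_summable_norm hf hgn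
  have hcoeff : ∀ n : ℕ, ∑ kl ∈ Finset.HasAntidiagonal.antidiagonal n,
      (((Polynomial.bernoulli kl.1).eval x / kl.1 ! : ℚ) : ℂ) * t ^ kl.1 *
        (t ^ kl.2 / (kl.2 ! : ℂ) - if kl.2 = 0 then 1 else 0) =
      PowerSeries.coeff n (PowerSeries.X * PowerSeries.rescale (x : ℂ) (PowerSeries.exp ℂ)) *
        t ^ n := by
    intro n
    rw [← Polynomial.bernoulli_generating_function (x : ℂ), PowerSeries.coeff_mul, Finset.sum_mul]
    refine Finset.sum_congr rfl fun kl hkl => ?_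
    rw [← Finset.HasAntidiagonal.mem_antidiagonal.1 hkl, PowerSeries.coeff_mk, map_sub, PowerSeries.coeff_exp,
      PowerSeries.coeff_one, pow_add]
    have e1 : (Polynomial.aeval (x : ℂ)) ((1 / (kl.1 ! : ℚ)) • Polynomial.bernoulli kl.1) =
        (((Polynomial.bernoulli kl.1).eval x / kl.1 ! : ℚ) : ℂ) := by
      rw [Polynomial.aeval_def]
      have := Polynomial.eval₂_at_apply (p := (1 / (kl.1 ! : ℚ)) • Polynomial.bernoulli kl.1)
        (algebraMap ℚ ℂ) x
      refine this.trans ?_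
      rw [Polynomial.eval_smul, smul_eq_mul, one_div_mul_eq_div]
      rfl
    rw [e1]
    split_ifs with h
    · simp [h]
    · simp
      ring
  simp only [hcoeff] at hprod
  rw [hg.tsum_eq] at hprod
  have hR : HasSum (fun n : ℕ => PowerSeries.coeff n (PowerSeries.X *
      PowerSeries.rescale (x : ℂ) (PowerSeries.exp ℂ)) * t ^ n) (t * cexp (x * t)) := by
    rw [← hasSum_nat_add_iff' 1]
    simp only [PowerSeries.coeff_succ_X_mul, PowerSeries.coeff_rescale, PowerSeries.coeff_exp,
      Finset.sum_range_one, PowerSeries.coeff_zero_X_mul, zero_mul, sub_zero]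
    refine ((hexp (x * t)).mul_left t).congr_fun fun n => ?_
    simp
    ring
  rw [hR.tsum_eq] at hprod
  have hne : cexp t - 1 ≠ 0 := sub_ne_zero.2 (exp_ne_one_of_norm_lt h0 h1)
  rw [← hprod, mul_div_cancel_right₀ _ hne]
  exact hf.of_norm.hasSum

variable {l : ℕ} [NeZero l]

/-- The reflection `B_n(1 - x) = (-1)^n B_n(x)` merges the two Bernoulli values. For `a = 0` both
are taken at `0`, where parity does the same except for `B_1(0) = -1/2`; this exception is the
correction term. -/
lemma stildeConst_succ (m : ℕ) (a : ZMod l) : stildeConst l (m + 1) a =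
    -((l : ℂ) ^ m * m ! * (((Polynomial.bernoulli (m + 1)).eval ((a.val : ℚ) / l) /
      (m + 1)! : ℚ) : ℂ)) - if m = 0 ∧ a = 0 then 1 / 2 else 0 := by
  have hl : (l : ℚ) ≠ 0 := by exact_mod_cast NeZero.ne l
  have hm : (m ! : ℚ) ≠ 0 := by exact_mod_cast Nat.factorial_ne_zero m
  have hfac : ((m + 1)! : ℚ) = (m + 1) * m ! := by rw [Nat.factorial_succ]; push_cast; ring
  have key : (-(l : ℚ) ^ m / (2 * (m + 1 : ℕ))) *
    ((Polynomial.bernoulli (m + 1)).eval ((a.val : ℚ) / l)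
      + (-1) ^ (m + 1) * (Polynomial.bernoulli (m + 1)).eval (((-a).val : ℚ) / l)) =
    -((l : ℚ) ^ m * m ! * ((Polynomial.bernoulli (m + 1)).eval ((a.val : ℚ) / l) /
      (m + 1)!)) - if m = 0 ∧ a = 0 then 1 / 2 else 0 := by
    have hsq : ((-1 : ℚ) ^ (m + 1)) * (-1) ^ (m + 1) = 1 := by
      rw [← mul_pow]; simp
    rcases eq_or_ne a 0 with rfl | ha
    · have hneg := Polynomial.bernoulli_eval_neg (m + 1) 0
      rw [neg_zero] at hneg
      simp only [neg_zero, ZMod.val_zero, Nat.cast_zero, zero_div, and_true]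
      rcases Nat.eq_zero_or_pos m with rfl | hm0
      · simp
      · have h2 : (-1 : ℚ) ^ (m + 1) * (Polynomial.bernoulli (m + 1)).eval 0 =
            (Polynomial.bernoulli (m + 1)).eval 0 := by
          simp only [Nat.add_sub_cancel, zero_pow hm0.ne', mul_zero, add_zero] at hneg
          exact hneg.symm
        rw [h2, hfac, if_neg hm0.ne']
        push_cast
        field_simp
        ring
    · have : NeZero a := ⟨ha⟩
      have hv : ((-a).val : ℚ) / l = 1 - (a.val : ℚ) / l := by
        rw [ZMod.val_neg_of_ne_zero, Nat.cast_sub a.val_lt.le]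
        field_simp
      rw [hv, Polynomial.bernoulli_eval_one_sub, ← mul_assoc, hsq, hfac,
        if_neg (fun h => ha h.2)]
      push_cast
      field_simp
      ring
  rw [stildeConst, Nat.add_sub_cancel, key]
  push_cast
  split_ifs <;> simp

/-- Put `t = 2πi z l` in the Bernoulli generating function, drop its term of index zero and divide
by `-t`; the dropped term is the pole `1 / t`. -/
lemma hasSum_stildeConst (a : ZMod l) {z : ℂ} (h0 : z ≠ 0) (h1 : ‖2 * Real.pi * I * z * l‖ < 1) :
    HasSum (fun m => stildeConst l (m + 1) a * ((2 * Real.pi * I * z) ^ m / m !))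
      (ex (a.val * z) / (1 - ex (l * z)) - (if a = 0 then 1 / 2 else 0) +
        (2 * Real.pi * I * z * l)⁻¹) := by
  have hl : (l : ℂ) ≠ 0 := by exact_mod_cast NeZero.ne l
  have hlq : (0 : ℚ) < l := by exact_mod_cast Nat.pos_of_neZero l
  set t : ℂ := 2 * Real.pi * I * z * l with ht
  have ht0 : t ≠ 0 := by simp [ht, h0, hl]
  have hb := hasSum_bernoulli (x := (a.val : ℚ) / l) (by positivity)
    ((div_le_one hlq).2 (by exact_mod_cast a.val_lt.le)) ht0 h1
  rw [← hasSum_nat_add_iff' 1] at hb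
  simp only [Finset.sum_range_one, Polynomial.bernoulli_zero, Polynomial.eval_one,
    Nat.factorial_zero, Nat.cast_one, div_one, Rat.cast_one, pow_zero, mul_one] at hb
  have hb' := (hb.mul_left (-t⁻¹)).sub (hasSum_ite_eq 0 (if a = 0 then (1 / 2 : ℂ) else 0))
  convert! hb' using 1
  · ext m
    have hmf : (m ! : ℂ) ≠ 0 := by exact_mod_cast Nat.factorial_ne_zero m
    rw [stildeConst_succ, pow_succ t]
    have e1 : (l : ℂ) ^ m * (2 * Real.pi * I * z) ^ m = t ^ m := by
      rw [← mul_pow, ht]; ring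
    have e2 : (if m = 0 ∧ a = 0 then (1 / 2 : ℂ) else 0) * ((2 * Real.pi * I * z) ^ m / m !) =
        if m = 0 then (if a = 0 then (1 / 2 : ℂ) else 0) else 0 := by
      rcases Nat.eq_zero_or_pos m with rfl | hm
      · simp
      · simp [hm.ne']
    rw [sub_mul, e2]
    congr 1
    field_simp
    rw [← e1]
    ring
  · have hexp : ex (a.val * z) = cexp ((((a.val : ℚ) / l : ℚ) : ℂ) * t) := by
      rw [ex, ht]
      push_cast
      field_simp
    have hexp2 : ex (l * z) = cexp t := by
      rw [ex, ht]
      ring_nf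
    have hne : cexp t - 1 ≠ 0 := sub_ne_zero.2 (exp_ne_one_of_norm_lt ht0 h1)
    have hne' : 1 - cexp t ≠ 0 := sub_ne_zero.2 (exp_ne_one_of_norm_lt ht0 h1).symm
    rw [hexp, hexp2]
    field_simp
    ring

end ToricForms

namespace ToricForms

open Filter Topology Asymptotics EisensteinSeries
open scoped Nat

variable {l : ℕ}

/-! ### The generating function of the forms `s̃` -/

/-- The indicator of `d ≡ a mod l`. -/
def resInd (a : ZMod l) (d : ℤ) : ℂ := if (d : ZMod l) = a then 1 else 0

lemma norm_resInd_le (a : ZMod l) (d : ℤ) : ‖resInd a d‖ ≤ 1 := by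
  rw [resInd]
  split_ifs <;> simp

lemma inv_one_sub_eq_geom {E : ℂ} {n : ℕ} (h : E ^ n ≠ 1) :
    (1 - E)⁻¹ = (∑ i ∈ Finset.range n, E ^ i) / (1 - E ^ n) := by
  have h1 : 1 - E ^ n ≠ 0 := sub_ne_zero.2 h.symm
  have h2 : 1 - E ≠ 0 := fun h3 => h (by rw [← sub_eq_zero.1 h3, one_pow])
  rw [eq_div_iff h1, ← mul_neg_geom_sum]
  field_simp

variable [NeZero l]

/-- All `E = ex (z + j / l)` have the same `l`-th power, so `1 / (1 - E)` is a geometric sum of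
length `l` over a common denominator; orthogonality of characters keeps only the exponent `a.val`.
-/
lemma sum_ex_mul_inv_one_sub (a : ZMod l) {z : ℂ} (hz : ex (l * z) ≠ 1) :
    ∑ j ∈ Finset.range l, ex (((-a.val : ℤ) : ℂ) / l) ^ j * (1 - ex (z + j / l))⁻¹ =
      l * (ex (a.val * z) / (1 - ex (l * z))) := by
  have hl : (l : ℂ) ≠ 0 := by exact_mod_cast NeZero.ne l
  have hE : ∀ j : ℕ, ex (z + j / l) ^ l = ex (l * z) := by
    intro j
    have := ex_div_pow_card (l := l) j
    push_cast at this
    rw [ex_add, mul_pow, this, mul_one, ex_natCast_mul]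
  have hterm : ∀ j i : ℕ, ex (((-a.val : ℤ) : ℂ) / l) ^ j * ex (z + j / l) ^ i =
      ex z ^ i * ex (((i - a.val : ℤ) : ℂ) / l) ^ j := by
    intro j i
    rw [← ex_natCast_mul, ← ex_natCast_mul, ← ex_natCast_mul, ← ex_natCast_mul, ← ex_add, ← ex_add]
    congr 1
    push_cast
    field_simp
    ring
  have h1 : ∀ j ∈ Finset.range l, ex (((-a.val : ℤ) : ℂ) / l) ^ j * (1 - ex (z + j / l))⁻¹ =
      (∑ i ∈ Finset.range l, ex z ^ i * ex (((i - a.val : ℤ) : ℂ) / l) ^ j) /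
        (1 - ex (l * z)) := by
    intro j _
    rw [inv_one_sub_eq_geom (n := l) (by rwa [hE]), hE, ← mul_div_assoc, Finset.mul_sum]
    simp only [hterm]
  rw [Finset.sum_congr rfl h1, ← Finset.sum_div, Finset.sum_comm, ← mul_div_assoc]
  congr 1
  simp only [← Finset.mul_sum, sum_ex_div]
  rw [Finset.sum_eq_single a.val]
  · rw [if_pos (by simp), ex_natCast_mul, mul_comm]
  · intro i hi hia
    rw [if_neg, mul_zero]
    push_cast
    rw [ZMod.natCast_zmod_val, sub_eq_zero]
    intro h
    apply hia
    rw [← h, ZMod.val_cast_of_lt (Finset.mem_range.1 hi)]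
  · intro h
    exact absurd (Finset.mem_range.2 a.val_lt) h

/-- The Fourier sum acts on each exponential: positive frequencies `d` survive for `d ≡ a`, negative
ones for `d ≡ -a`, and the constant in the cotangent survives only for `a = 0`. -/
lemma latticeFourier_eq (a : ZMod l) {z : ℂ} {τ : ℍ} (h0 : z ≠ 0) (h1 : ‖z‖ < 1 / l)
    (h2 : ‖z‖ < τ.im) (h3 : ex (l * z) ≠ 1) :
    latticeFourier a z τ = ex (a.val * z) / (1 - ex (l * z)) - (if a = 0 then 1 / 2 else 0) +
      ∑' p : ℕ+ × ℕ+, (resInd a p.1 * ex z ^ (p.1 : ℕ) - resInd (-a) p.1 * ex (-z) ^ (p.1 : ℕ)) *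
        ex τ ^ ((p.1 : ℕ) * p.2) := by
  have hl : (l : ℂ) ≠ 0 := by exact_mod_cast NeZero.ne l
  have hpi : (2 * Real.pi * I : ℂ) ≠ 0 := by simp
  have him : ∀ j : ℕ, (z + j / l).im = z.im := by
    intro j
    rw [show ((j : ℂ) / l) = ((j / l : ℝ) : ℂ) by push_cast; ring, add_im, ofReal_im, add_zero]
  have hzim : ∀ j : ℕ, |(z + j / l).im| < τ.im := fun j => by
    rw [him]
    exact (abs_im_le_norm z).trans_lt h2
  have hE : ∀ j : ℕ, ex (z + j / l) ≠ 1 := by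
    intro j h
    apply h3
    have h4 := ex_div_pow_card (l := l) j
    push_cast at h4
    have h5 : ex z ^ l * ex (j / l) ^ l = 1 := by rw [← mul_pow, ← ex_add, h, one_pow]
    rwa [h4, mul_one, ← ex_natCast_mul] at h5
  have hcot : ∀ j : ℕ, picot (z + j / l) =
      -(2 * Real.pi * I) * ((1 - ex (z + j / l))⁻¹ - 1 / 2) := by
    intro j
    have h4 : 1 - ex (z + j / l) ≠ 0 := sub_ne_zero.2 (hE j).symm
    rw [picot_eq_exp]
    change (Real.pi : ℂ) * ((ex (z + j / l) + 1) / (I * (1 - ex (z + j / l)))) = _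
    have hI : I ≠ 0 := I_ne_zero
    generalize ex (z + j / l) = E at h4
    field_simp
    rw [I_sq]
    ring
  have hs : ∀ j : ℕ, Summable fun p : ℕ+ × ℕ+ =>
      ex (((-a.val : ℤ) : ℂ) / l) ^ j * ((ex (z + j / l) ^ (p.1 : ℕ) -
        ex (-(z + j / l)) ^ (p.1 : ℕ)) * ex τ ^ ((p.1 : ℕ) * p.2)) := by
    intro j
    refine Summable.mul_left _ ?_
    simp only [sub_mul]
    exact (summable_ex_mul (hzim j)).sub (summable_ex_mul (by rw [neg_im, abs_neg]; exact hzim j))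
  have hsum : ∀ j ∈ Finset.range l,
      ex (((-a.val : ℤ) : ℂ) / l) ^ j * latticeCot (z + j / l) τ =
      -(2 * Real.pi * I) * (ex (((-a.val : ℤ) : ℂ) / l) ^ j * (1 - ex (z + j / l))⁻¹) +
      (2 * Real.pi * I) * (1 / 2) * ex (((-a.val : ℤ) : ℂ) / l) ^ j +
      -(2 * Real.pi * I) * ∑' p : ℕ+ × ℕ+,
      ex (((-a.val : ℤ) : ℂ) / l) ^ j * ((ex (z + j / l) ^ (p.1 : ℕ) -
        ex (-(z + j / l)) ^ (p.1 : ℕ)) * ex τ ^ ((p.1 : ℕ) * p.2)) := by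
    intro j _
    rw [latticeCot_eq (hzim j) (offLattice_of_small h0 h1 h2 j), tsum_mul_left, hcot]
    ring
  have hterm : ∀ p : ℕ+ × ℕ+, ∑ j ∈ Finset.range l,
      ex (((-a.val : ℤ) : ℂ) / l) ^ j * ((ex (z + j / l) ^ (p.1 : ℕ) -
        ex (-(z + j / l)) ^ (p.1 : ℕ)) * ex τ ^ ((p.1 : ℕ) * p.2)) =
      l * ((resInd a p.1 * ex z ^ (p.1 : ℕ) - resInd (-a) p.1 * ex (-z) ^ (p.1 : ℕ)) *
        ex τ ^ ((p.1 : ℕ) * p.2)) := by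
    intro p
    have e1 : ∀ j : ℕ, ex (((-a.val : ℤ) : ℂ) / l) ^ j * ex (z + j / l) ^ (p.1 : ℕ) =
        ex z ^ (p.1 : ℕ) * ex ((((p.1 : ℕ) - a.val : ℤ) : ℂ) / l) ^ j := by
      intro j
      rw [← ex_natCast_mul, ← ex_natCast_mul, ← ex_natCast_mul, ← ex_natCast_mul, ← ex_add,
        ← ex_add]
      congr 1
      push_cast
      field_simp
      ring
    have e2 : ∀ j : ℕ, ex (((-a.val : ℤ) : ℂ) / l) ^ j * ex (-(z + j / l)) ^ (p.1 : ℕ) =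
        ex (-z) ^ (p.1 : ℕ) * ex (((-(p.1 : ℕ) - a.val : ℤ) : ℂ) / l) ^ j := by
      intro j
      rw [← ex_natCast_mul, ← ex_natCast_mul, ← ex_natCast_mul, ← ex_natCast_mul, ← ex_add,
        ← ex_add]
      congr 1
      push_cast
      field_simp
      ring
    have e3 : ∑ j ∈ Finset.range l, ex (((-a.val : ℤ) : ℂ) / l) ^ j *
        ((ex (z + j / l) ^ (p.1 : ℕ) -
        ex (-(z + j / l)) ^ (p.1 : ℕ)) * ex τ ^ ((p.1 : ℕ) * p.2)) =
        (ex z ^ (p.1 : ℕ) * ∑ j ∈ Finset.range l, ex ((((p.1 : ℕ) - a.val : ℤ) : ℂ) / l) ^ j -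
        ex (-z) ^ (p.1 : ℕ) * ∑ j ∈ Finset.range l, ex (((-(p.1 : ℕ) - a.val : ℤ) : ℂ) / l) ^ j) *
        ex τ ^ ((p.1 : ℕ) * p.2) := by
      rw [Finset.mul_sum, Finset.mul_sum, ← Finset.sum_sub_distrib, Finset.sum_mul]
      refine Finset.sum_congr rfl fun j _ => ?_
      rw [← e1, ← e2]
      ring
    have c1 : ((((p.1 : ℕ) - a.val : ℤ) : ZMod l) = 0) ↔ (((p.1 : ℕ) : ℤ) : ZMod l) = a := by
      push_cast
      rw [ZMod.natCast_zmod_val, sub_eq_zero]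
    have c2 : (((-(p.1 : ℕ) - a.val : ℤ) : ZMod l) = 0) ↔ (((p.1 : ℕ) : ℤ) : ZMod l) = -a := by
      push_cast
      rw [ZMod.natCast_zmod_val, sub_eq_zero, neg_eq_iff_eq_neg]
    rw [e3, sum_ex_div, sum_ex_div]
    simp only [c1, c2, resInd]
    split_ifs <;> ring
  have ha : ∑ j ∈ Finset.range l, ex (((-a.val : ℤ) : ℂ) / l) ^ j =
      if a = 0 then (l : ℂ) else 0 := by
    rw [sum_ex_div]
    simp
  rw [latticeFourier, Finset.sum_congr rfl hsum, Finset.sum_add_distrib, Finset.sum_add_distrib,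
    ← Finset.mul_sum, ← Finset.mul_sum, ← Finset.mul_sum, sum_ex_mul_inv_one_sub a h3, ha,
    ← Summable.tsum_finsetSum fun j _ => hs j]
  simp only [hterm]
  rw [tsum_mul_left]
  split_ifs <;> field_simp <;> ring

/-! ### The tail as a double series -/

lemma summable_pow_mul_ex (k : ℕ) (τ : ℍ) :
    Summable fun p : ℕ+ × ℕ+ => ((p.1 : ℕ) : ℂ) ^ k * ex τ ^ ((p.1 : ℕ) * p.2) := by
  have h := summable_prod_mul_pow (𝕜 := ℂ) k (norm_ex_lt_one τ)
  refine ((Equiv.prodComm ℕ+ ℕ+).summable_iff.2 h).congr fun p => ?_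
  simp [mul_comm]

lemma tsum_pnat_divisors {f : ℕ → ℕ → ℂ} {τ : ℍ}
    (hf : Summable fun p : ℕ+ × ℕ+ => f p.1 p.2 * ex τ ^ ((p.1 : ℕ) * p.2)) :
    ∑' n : ℕ+, (∑ d ∈ (n : ℕ).divisors, f d (n / d)) * ex τ ^ (n : ℕ) =
      ∑' p : ℕ+ × ℕ+, f p.1 p.2 * ex τ ^ ((p.1 : ℕ) * p.2) := by
  rw [← sigmaAntidiagonalEquivProd.tsum_eq]
  have hs := sigmaAntidiagonalEquivProd.summable_iff.2 hf
  refine Eq.trans ?_ hs.tsum_sigma.symm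
  refine tsum_congr fun n => ?_
  rw [tsum_fintype, Finset.univ_eq_attach, Finset.sum_mul]
  have e1 : ∀ x : (n : ℕ).divisorsAntidiagonal,
      ((fun p : ℕ+ × ℕ+ => f p.1 p.2 * ex τ ^ ((p.1 : ℕ) * p.2)) ∘ sigmaAntidiagonalEquivProd)
        ⟨n, x⟩ = (fun y : ℕ × ℕ => f y.1 y.2 * ex τ ^ (n : ℕ)) x := by
    intro x
    simp only [Function.comp_apply]
    have := (Nat.mem_divisorsAntidiagonal.1 x.2).1
    change f x.1.1 x.1.2 * ex τ ^ (x.1.1 * x.1.2) = _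
    rw [this]
  simp only [e1]
  rw [Finset.sum_attach ((n : ℕ).divisorsAntidiagonal) (fun y => f y.1 y.2 * ex τ ^ (n : ℕ)),
    Nat.sum_divisorsAntidiagonal (fun d e => f d e * ex τ ^ (n : ℕ))]

lemma summable_stildeTail (k : ℕ) (a : ZMod l) (τ : ℍ) :
    Summable fun p : ℕ+ × ℕ+ => ((p.1 : ℕ) : ℂ) ^ k * (resInd a p.1 + (-1) ^ (k + 1) *
      resInd (-a) p.1) * ex τ ^ ((p.1 : ℕ) * p.2) := by
  refine Summable.of_norm_bounded ((summable_pow_mul_ex k τ).norm.mul_left 2) fun p => ?_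
  rw [norm_mul, norm_mul, norm_mul]
  have : ‖resInd a p.1 + (-1) ^ (k + 1) * resInd (-a) p.1‖ ≤ 2 := by
    refine (norm_add_le _ _).trans ?_
    rw [norm_mul, norm_pow, norm_neg, norm_one, one_pow, one_mul]
    linarith [norm_resInd_le a p.1, norm_resInd_le (-a) p.1]
  nlinarith [mul_nonneg (norm_nonneg (((p.1 : ℕ) : ℂ) ^ k))
    (norm_nonneg (ex τ ^ ((p.1 : ℕ) * p.2)))]

lemma stildeTail_succ (k : ℕ) (a : ZMod l) (τ : ℍ) : stildeTail l (k + 1) a τ =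
    ∑' p : ℕ+ × ℕ+, ((p.1 : ℕ) : ℂ) ^ k * (resInd a p.1 + (-1) ^ (k + 1) *
      resInd (-a) p.1) * ex τ ^ ((p.1 : ℕ) * p.2) := by
  rw [← tsum_pnat_divisors (f := fun d _ => (d : ℂ) ^ k * (resInd a d + (-1) ^ (k + 1) *
      resInd (-a) d)) (summable_stildeTail k a τ)]
  simp [stildeTail, stildeCoeff, ex, resInd]

/-- The general term of the exponential generating function of the tails. -/
def genTerm (a : ZMod l) (w : ℂ) (τ : ℍ) (p : ℕ+ × ℕ+) (m : ℕ) : ℂ :=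
  ((p.1 : ℕ) : ℂ) ^ m * (resInd a p.1 + (-1) ^ (m + 1) * resInd (-a) p.1) *
    ex τ ^ ((p.1 : ℕ) * p.2) * (w ^ m / m !)

lemma hasSum_genTerm (a : ZMod l) (z : ℂ) (τ : ℍ) (p : ℕ+ × ℕ+) :
    HasSum (genTerm a (2 * Real.pi * I * z) τ p)
      ((resInd a p.1 * ex z ^ (p.1 : ℕ) - resInd (-a) p.1 * ex (-z) ^ (p.1 : ℕ)) *
        ex τ ^ ((p.1 : ℕ) * p.2)) := by
  have hexp : ∀ u : ℂ, HasSum (fun n : ℕ => u ^ n / n !) (cexp u) := fun u => by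
    rw [Complex.exp_eq_exp_ℂ]
    exact NormedSpace.expSeries_div_hasSum_exp u
  obtain ⟨w, hw⟩ : ∃ w : ℂ, w = 2 * Real.pi * I * z := ⟨_, rfl⟩
  rw [← hw]
  have h3 := (((hexp ((p.1 : ℕ) * w)).mul_left (resInd a p.1)).sub
    ((hexp (-((p.1 : ℕ) * w))).mul_left (resInd (-a) p.1))).mul_right (ex τ ^ ((p.1 : ℕ) * p.2))
  have e1 : cexp ((p.1 : ℕ) * w) = ex z ^ (p.1 : ℕ) := by
    rw [Complex.exp_nat_mul, hw, ex]
  have e2 : cexp (-((p.1 : ℕ) * w)) = ex (-z) ^ (p.1 : ℕ) := by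
    rw [← mul_neg, Complex.exp_nat_mul, hw, ex]
    ring_nf
  rw [e1, e2] at h3
  refine h3.congr_fun fun m => ?_
  rw [genTerm, neg_pow, mul_pow, pow_succ (-1 : ℂ)]
  ring

/-- This justifies exchanging the Taylor expansion with the sum over `(d, n)`: summing absolute
values over the Taylor index gives at most `2 e^(d‖w‖) |q|^(d n)`, and the hypothesis says `e^‖w‖
|q| < 1`. -/
lemma summable_genTerm (a : ZMod l) {w : ℂ} {τ : ℍ} (h2 : ‖w‖ < 2 * Real.pi * τ.im) :
    Summable fun x : (ℕ+ × ℕ+) × ℕ => genTerm a w τ x.1 x.2 := by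
  have hexpr : ∀ u : ℝ, HasSum (fun n : ℕ => u ^ n / n !) (Real.exp u) := fun u => by
    rw [Real.exp_eq_exp_ℝ]
    exact NormedSpace.expSeries_div_hasSum_exp u
  have hnn : Summable fun x : (ℕ+ × ℕ+) × ℕ => 2 * ‖ex τ‖ ^ ((x.1.1 : ℕ) * x.1.2) *
      ((((x.1.1 : ℕ) : ℝ) * ‖w‖) ^ x.2 / x.2 !) := by
    rw [summable_prod_of_nonneg fun x => by positivity]
    refine ⟨fun p => ?_, ?_⟩
    · have h := (hexpr (((p.1 : ℕ) : ℝ) * ‖w‖)).summable.mul_left (2 * ‖ex τ‖ ^ ((p.1 : ℕ) * p.2))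
      exact h
    have hA : 1 ≤ Real.exp ‖w‖ := by
      rw [Real.one_le_exp_iff]; positivity
    refine ((summable_pow_mul_pow hA (norm_nonneg (ex τ)) ?_).mul_left 2).congr fun p => ?_
    · rw [norm_ex, ← Real.exp_add, Real.exp_lt_one_iff, coe_im]
      linarith
    · have h := ((hexpr (((p.1 : ℕ) : ℝ) * ‖w‖)).mul_left (2 * ‖ex τ‖ ^ ((p.1 : ℕ) * p.2))).tsum_eq
      refine Eq.trans ?_ h.symm
      rw [Real.exp_nat_mul]
      ring
  refine Summable.of_norm_bounded hnn fun x => ?_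
  have h4 : ‖resInd a x.1.1 + (-1) ^ (x.2 + 1) * resInd (-a) x.1.1‖ ≤ 2 := by
    refine (norm_add_le _ _).trans ?_
    rw [norm_mul, norm_pow, norm_neg, norm_one, one_pow, one_mul]
    linarith [norm_resInd_le a x.1.1, norm_resInd_le (-a) x.1.1]
  have h5 : 0 ≤ (((x.1.1 : ℕ) : ℝ) ^ x.2 * ‖ex τ‖ ^ ((x.1.1 : ℕ) * x.1.2) *
      (‖w‖ ^ x.2 / x.2 !)) := by positivity
  rw [genTerm, norm_mul, norm_mul, norm_mul, norm_div, norm_pow, norm_pow, norm_pow,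
    Complex.norm_natCast, Complex.norm_natCast, mul_pow]
  refine le_trans (le_of_eq ?_) ((mul_le_mul_of_nonneg_right h4 h5).trans (le_of_eq ?_))
  · ring
  · ring

lemma hasSum_stildeTail (a : ZMod l) {z : ℂ} {τ : ℍ} (h2 : ‖z‖ < τ.im) :
    HasSum (fun m => stildeTail l (m + 1) a τ * ((2 * Real.pi * I * z) ^ m / m !))
      (∑' p : ℕ+ × ℕ+, (resInd a p.1 * ex z ^ (p.1 : ℕ) - resInd (-a) p.1 * ex (-z) ^ (p.1 : ℕ)) *
        ex τ ^ ((p.1 : ℕ) * p.2)) := by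
  have hwn : ‖2 * Real.pi * I * z‖ < 2 * Real.pi * τ.im := by
    have : ‖2 * Real.pi * I * z‖ = 2 * Real.pi * ‖z‖ := by simp [abs_of_pos Real.pi_pos]
    rw [this]
    gcongr
  have h6 := (summable_genTerm a hwn).hasSum
  have h5 := (h6.prod_fiberwise (hasSum_genTerm a z τ)).tsum_eq
  rw [h5]
  have h7 : HasSum (fun x : ℕ × (ℕ+ × ℕ+) => genTerm a (2 * Real.pi * I * z) τ x.2 x.1)
      (∑' x : (ℕ+ × ℕ+) × ℕ, genTerm a (2 * Real.pi * I * z) τ x.1 x.2) :=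
    (Equiv.prodComm ℕ (ℕ+ × ℕ+)).hasSum_iff.2 h6
  refine h7.prod_fiberwise fun m => ?_
  rw [stildeTail_succ]
  have h8 := (summable_stildeTail m a τ).hasSum.mul_right ((2 * Real.pi * I * z) ^ m / (m ! : ℂ))
  simpa only [genTerm] using h8

/-- The cotangent part yields the constant terms and the exponential part the tails. The added
reciprocal cancels the pole of `latticeFourier` at `z = 0`. -/
lemma hasSum_stilde (a : ZMod l) {z : ℂ} {τ : ℍ} (h0 : z ≠ 0)
    (h1 : ‖2 * Real.pi * I * z * l‖ < 1) (h2 : ‖z‖ < τ.im) :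
    HasSum (fun m => stilde l (m + 1) a τ * ((2 * Real.pi * I * z) ^ m / m !))
      (latticeFourier a z τ + (2 * Real.pi * I * z * l)⁻¹) := by
  have hl : (0 : ℝ) < l := by exact_mod_cast Nat.pos_of_neZero l
  have hz1 : ‖z‖ < 1 / l := by
    rw [lt_div_iff₀ hl]
    have : ‖2 * Real.pi * I * z * l‖ = 2 * Real.pi * (‖z‖ * l) := by
      simp [abs_of_pos Real.pi_pos]
      ring
    rw [this] at h1
    have h3 : 0 ≤ ‖z‖ * l := by positivity
    nlinarith [Real.pi_gt_three]
  have h3 : ex (l * z) ≠ 1 := by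
    have := exp_ne_one_of_norm_lt (t := 2 * Real.pi * I * z * l)
      (by simp [h0, (Nat.cast_ne_zero.2 (NeZero.ne l) : (l : ℂ) ≠ 0)]) h1
    rw [ex]
    convert! this using 2
    ring
  have h4 := (hasSum_stildeConst a h0 h1).add (hasSum_stildeTail a h2)
  rw [latticeFourier_eq a h0 hz1 h2 h3]
  convert! h4 using 1
  · ext m
    rw [stilde]
    ring
  · ring

end ToricForms

/-! ### The transformation law of the forms, by comparison of Taylor coefficients -/

namespace ToricForms

open Filter Topology Asymptotics EisensteinSeries
open scoped Nat

/-- A power series vanishing on a punctured disc is zero. -/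
lemma coeff_eq_zero_of_hasSum_zero {c : ℕ → ℂ} {ε : ℝ} (hε : 0 < ε)
    (h : ∀ w : ℂ, w ≠ 0 → ‖w‖ < ε → HasSum (fun m => c m * w ^ m) 0) (m : ℕ) : c m = 0 := by
  -- The hypothesis says nothing at `w = 0`, so the series represents zero modified at the origin;
  -- continuity of the sum then forces `c 0 = 0`.
  set g : ℂ → ℂ := Function.update 0 0 (c 0) with hg
  have H : HasFPowerSeriesAt g (.ofScalars ℂ c) 0 := by
    refine ⟨ENNReal.ofReal (ε / 2), ?_, by simpa using hε, ?_⟩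
    · have h1 := (h ((ε / 2 : ℝ) : ℂ) (by simpa using hε.ne')
        (by rw [Complex.norm_real, Real.norm_of_nonneg (by linarith)]; linarith)).summable.norm
      refine FormalMultilinearSeries.le_radius_of_summable (r := (ε / 2).toNNReal) _ ?_
      refine h1.congr fun n => ?_
      rw [norm_mul, norm_pow, Complex.norm_real, Real.norm_of_nonneg (by linarith),
        Real.coe_toNNReal _ (by linarith)]
      simp
    · intro w hw
      have hw' : ‖w‖ < ε := by
        have h2 : ‖w‖ < ε / 2 := by
          simpa [Metric.eball_ofReal] using hw
        linarith
      rcases eq_or_ne w 0 with rfl | h0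
      · simpa +contextual [zero_pow_eq, hg] using hasSum_ite_eq 0 (c 0)
      · simpa [hg, Function.update_of_ne h0, mul_comm] using h w h0 hw'
  have hz : (0 : ℂ) = c 0 := by
    have L1 := H.continuousAt
    have := (L1.eventuallyEq_nhds_iff_eventuallyEq_nhdsNE
      (continuousAt_const (y := (0 : ℂ)))).mp <|
      by filter_upwards [self_mem_nhdsWithin] with a ha using Function.update_of_ne ha ..
    simpa [hg] using this.eq_of_nhds.symm
  have hg0 : g = 0 := by
    rw [hg, ← hz]
    exact Function.update_eq_self 0 _
  rw [hg0] at H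
  have h3 := H.eq_zero
  rw [← FormalMultilinearSeries.coeff_ofScalars (𝕜 := ℂ) (p := c) (n := m), h3]
  rfl

/-- Compare the generating function at `(w / J, γ • τ)` with `J` times that at `(w, τ)`. The polar
terms agree, and the discrepancy from `latticeFourier_smul` is linear in `w`, so it affects only the
coefficient `m = 1`. -/
theorem stilde_smul {l : ℕ} [NeZero l] (a : ZMod l) (m : ℕ) {γ : SL(2, ℤ)}
    (hγ : γ ∈ CongruenceSubgroup.Gamma1 l) (τ : ℍ) :
    stilde l (m + 1) a (γ • τ) = denom γ τ ^ (m + 1) * stilde l (m + 1) a τ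
      - if a = 0 ∧ m = 1 then (γ 1 0 : ℤ) * denom γ τ / (2 * Real.pi * I) else 0 := by
  set J : ℂ := denom γ τ with hJ
  have hJ0 : J ≠ 0 := denom_ne_zero _ _
  have hl : (0 : ℝ) < l := Nat.cast_pos.2 (NeZero.pos l)
  have hpi : (2 * Real.pi * I : ℂ) ≠ 0 := Complex.two_pi_I_ne_zero
  -- The bounds on `‖w‖` keep the translates of the division points off the lattice and make both
  -- series, at `w` and at `w / J`, converge.
  have key : ∀ w : ℂ, w ≠ 0 → ‖w‖ < min (min (1 / (l : ℝ)) τ.im)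
      (min (min (1 / (2 * Real.pi * l)) (‖J‖ * (1 / (2 * Real.pi * l)))) (‖J‖ * (γ • τ).im)) →
      HasSum (fun n => ((stilde l (n + 1) a (γ • τ) * (J ^ n)⁻¹ - J * stilde l (n + 1) a τ)
        * ((2 * Real.pi * I) ^ n / n !)
        + if n = 1 then (if a = 0 then ((γ 1 0 : ℤ) : ℂ) else 0) else 0) * w ^ n) 0 := by
    intro w hw0 hw
    simp only [lt_min_iff] at hw
    obtain ⟨⟨h1, h2⟩, ⟨h3, h4⟩, h5⟩ := hw
    have hJn : 0 < ‖J‖ := norm_pos_iff.2 hJ0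
    have hb : ∀ z : ℂ, ‖z‖ < 1 / (2 * Real.pi * l) → ‖2 * Real.pi * I * z * l‖ < 1 := by
      intro z hz
      rw [lt_div_iff₀ (by positivity)] at hz
      simp only [norm_mul, Complex.norm_real, Complex.norm_I, Complex.norm_ofNat,
        Complex.norm_natCast, Real.norm_of_nonneg Real.pi_pos.le]
      linarith
    have hwJ : ∀ c, ‖w‖ < ‖J‖ * c → ‖w / J‖ < c := by
      intro c hc
      rw [norm_div, div_lt_iff₀ hJn]; linarith
    have s1 := hasSum_stilde (l := l) a (z := w / J) (τ := γ • τ) (div_ne_zero hw0 hJ0)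
      (hb _ (hwJ _ h4)) (hwJ _ h5)
    have s2 := (hasSum_stilde (l := l) a (z := w) (τ := τ) hw0 (hb _ h3) h2).mul_left J
    have s3 := hasSum_ite_eq 1 ((if a = 0 then ((γ 1 0 : ℤ) : ℂ) else 0) * w)
    have s4 := (s1.sub s2).add s3
    rw [latticeFourier_smul a hw0 h1 h2 hγ] at s4
    rw [← hJ] at s4
    have hl' : (l : ℂ) ≠ 0 := Nat.cast_ne_zero.2 (NeZero.ne l)
    have hv : ∀ A B : ℂ, HasSum (fun n => stilde l (n + 1) a (γ • τ) *
        ((2 * Real.pi * I * (w / J)) ^ n / n !) - J * (stilde l (n + 1) a τ *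
        ((2 * Real.pi * I * w) ^ n / n !)) + if n = 1 then A * w else 0) B → B = 0 →
        HasSum (fun n => ((stilde l (n + 1) a (γ • τ) * (J ^ n)⁻¹ - J * stilde l (n + 1) a τ)
        * ((2 * Real.pi * I) ^ n / n !) + if n = 1 then A else 0) * w ^ n) 0 := by
      intro A B h hB
      rw [hB] at h
      refine h.congr_fun fun n => ?_
      by_cases hn : n = 1
      · subst hn; simp; field_simp
      · simp [hn, mul_pow, div_pow]; field_simp
    refine hv _ _ s4 ?_
    split_ifs <;> · field_simp; ring
  have hε : 0 < min (min (1 / (l : ℝ)) τ.im)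
      (min (min (1 / (2 * Real.pi * l)) (‖J‖ * (1 / (2 * Real.pi * l)))) (‖J‖ * (γ • τ).im)) := by
    have hJn : 0 < ‖J‖ := norm_pos_iff.2 hJ0
    have := τ.im_pos
    have := (γ • τ).im_pos
    simp only [lt_min_iff]
    refine ⟨⟨?_, ?_⟩, ⟨?_, ?_⟩, ?_⟩ <;> positivity
  have h := coeff_eq_zero_of_hasSum_zero hε key m
  have hm : ((m ! : ℕ) : ℂ) ≠ 0 := Nat.cast_ne_zero.2 (Nat.factorial_ne_zero m)
  have hp : (2 * Real.pi * I : ℂ) ^ m ≠ 0 := pow_ne_zero _ hpi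
  by_cases hm1 : m = 1
  · subst hm1
    by_cases ha : a = 0
    · simp only [ha, if_true, and_self, pow_one, Nat.factorial_one, Nat.cast_one, div_one] at h ⊢
      field_simp at h ⊢
      linear_combination h
    · simp only [ha, if_false, false_and, pow_one, Nat.factorial_one, Nat.cast_one, div_one,
        if_true, add_zero, mul_eq_zero, hpi, or_false] at h ⊢
      field_simp at h ⊢
      linear_combination h
  · simp only [hm1, if_false, and_false, add_zero, mul_eq_zero, div_eq_zero_iff, hp, hm, or_false]
      at h ⊢
    field_simp at h ⊢
    linear_combination h

end ToricForms

namespace ToricForms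

open Filter Topology Asymptotics EisensteinSeries
open scoped Nat Manifold

/-! ### `q`-series with coefficients of polynomial growth -/

/-- The coefficients grow at most polynomially. -/
def PolyBounded (c : ℕ → ℂ) : Prop := ∃ (A : ℝ) (B : ℕ), ∀ n, ‖c n‖ ≤ A * (n : ℝ) ^ B

/-- The function `∑_{n > 0} c_n q^n` on the upper half plane. -/
def qTail (c : ℕ → ℂ) (τ : ℍ) : ℂ := ∑' n : ℕ+, c n * ex τ ^ (n : ℕ)

/-- At most polynomial growth in `1 / Im τ`, uniformly. -/
def ModGrowth (f : ℍ → ℂ) : Prop := ∃ (A : ℝ) (k : ℕ), ∀ τ : ℍ, ‖f τ‖ ≤ A * (1 + τ.im⁻¹) ^ k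

lemma PolyBounded.mul_natCast {c : ℕ → ℂ} (hc : PolyBounded c) (t : ℂ) :
    PolyBounded fun n => t * n * c n := by
  obtain ⟨A, B, h⟩ := hc
  refine ⟨‖t‖ * A, B + 1, fun n => ?_⟩
  rw [norm_mul, norm_mul, Complex.norm_natCast]
  have := mul_le_mul_of_nonneg_left (h n) (by positivity : 0 ≤ ‖t‖ * n)
  refine this.trans_eq (by ring)

lemma summable_pnat_pow_mul_exp (B : ℕ) {ε : ℝ} (hε : 0 < ε) :
    Summable fun n : ℕ+ => (n : ℝ) ^ B * Real.exp (-2 * Real.pi * ε) ^ (n : ℕ) := by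
  have h := (Real.summable_pow_mul_exp_neg_nat_mul B (r := 2 * Real.pi * ε) (by positivity)).comp_injective
    PNat.coe_injective
  refine h.congr fun n => ?_
  rw [← Real.exp_nat_mul]
  simp only [Function.comp]
  congr 2; ring

lemma norm_qTail_term_le {c : ℕ → ℂ} {A : ℝ} {B : ℕ} (h : ∀ n, ‖c n‖ ≤ A * (n : ℝ) ^ B)
    {ε : ℝ} {w : ℂ} (hw : ε ≤ w.im) (n : ℕ) :
    ‖c n * ex w ^ n‖ ≤ A * ((n : ℝ) ^ B * Real.exp (-2 * Real.pi * ε) ^ n) := by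
  rw [norm_mul, norm_pow, norm_ex, ← mul_assoc]
  refine mul_le_mul (h n) (pow_le_pow_left₀ (Real.exp_pos _).le (Real.exp_le_exp.2 ?_) _)
    (by positivity) ((norm_nonneg _).trans (h n))
  nlinarith [Real.pi_pos]

lemma summable_qTail {c : ℕ → ℂ} (hc : PolyBounded c) (τ : ℍ) :
    Summable fun n : ℕ+ => c n * ex τ ^ (n : ℕ) := by
  obtain ⟨A, B, h⟩ := hc
  exact Summable.of_norm_bounded ((summable_pnat_pow_mul_exp B τ.im_pos).mul_left A)
    fun n => norm_qTail_term_le h le_rfl n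

lemma hasDerivAt_ex_pow (n : ℕ) (w : ℂ) :
    HasDerivAt (fun w => ex w ^ n) (2 * Real.pi * I * n * ex w ^ n) w := by
  have h1 : HasDerivAt (fun w : ℂ => ex (n * w)) (cexp (2 * Real.pi * I * (n * w))
      * (2 * Real.pi * I * (n * 1))) w :=
    (((hasDerivAt_id w).const_mul (n : ℂ)).const_mul (2 * Real.pi * I)).cexp
  simp only [ex_natCast_mul] at h1
  refine h1.congr_deriv ?_
  rw [← ex_natCast_mul, ex]; ring

lemma hasDerivAt_qTail {c : ℕ → ℂ} (hc : PolyBounded c) (τ : ℍ) :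
    HasDerivAt (qTail c ∘ ofComplex) (qTail (fun n => 2 * Real.pi * I * n * c n) τ) τ := by
  obtain ⟨A, B, h⟩ := hc.mul_natCast (2 * Real.pi * I)
  have ht : IsOpen {w : ℂ | τ.im / 2 < w.im} := isOpen_lt continuous_const Complex.continuous_im
  have hmem : (τ : ℂ) ∈ {w : ℂ | τ.im / 2 < w.im} := by
    have := τ.im_pos
    simp only [Set.mem_ofPred_eq, coe_im]; linarith
  have H := hasDerivAt_tsum_of_isPreconnected (𝕜 := ℂ)
    (g := fun (n : ℕ+) w => c n * ex w ^ (n : ℕ))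
    (g' := fun (n : ℕ+) w => 2 * Real.pi * I * n * c n * ex w ^ (n : ℕ))
    (u := fun n : ℕ+ => A * ((n : ℝ) ^ B * Real.exp (-2 * Real.pi * (τ.im / 2)) ^ (n : ℕ)))
    (t := {w : ℂ | τ.im / 2 < w.im}) (y₀ := τ) (y := τ)
    ((summable_pnat_pow_mul_exp B (half_pos τ.im_pos)).mul_left A) ht
    (convex_halfSpace_im_gt _).isPreconnected
    (fun n w _ => ((hasDerivAt_ex_pow n w).const_mul (c n)).congr_deriv (by ring))
    (fun n w hw => norm_qTail_term_le (c := fun n => 2 * Real.pi * I * n * c n) h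
      (le_of_lt hw) n)
    hmem (summable_qTail hc τ) hmem
  refine H.congr_of_eventuallyEq ?_
  filter_upwards [isOpen_upperHalfPlaneSet.mem_nhds τ.im_pos] with w hw
  simp only [Function.comp, qTail, ofComplex_apply_of_im_pos hw]

lemma mdifferentiable_qTail {c : ℕ → ℂ} (hc : PolyBounded c) : MDiff (qTail c) := fun τ =>
  UpperHalfPlane.mdifferentiableAt_iff.2 (hasDerivAt_qTail hc τ).differentiableAt

lemma dtau_qTail {c : ℕ → ℂ} (hc : PolyBounded c) :
    dtau (qTail c) = qTail fun n => 2 * Real.pi * I * n * c n :=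
  funext fun τ => (hasDerivAt_qTail hc τ).deriv

/-- The inequality `e^t ≥ t^(B+2) / (B+2)!` with `t = n Im τ` turns `n^B |q|^n` into a multiple of
`n⁻² (Im τ)^-(B+2)`; the exponent `B + 2` is chosen to leave a summable power of `n`. -/
lemma modGrowth_qTail {c : ℕ → ℂ} (hc : PolyBounded c) : ModGrowth (qTail c) := by
  obtain ⟨A, B, h⟩ := hc
  have hA : 0 ≤ A := by have := (norm_nonneg _).trans (h 1); simpa using this
  have hs : Summable fun n : ℕ+ => ((n : ℝ) ^ 2)⁻¹ :=
    (Real.summable_nat_pow_inv.2 one_lt_two).comp_injective PNat.coe_injective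
  refine ⟨A * ((B + 2)! * ∑' n : ℕ+, ((n : ℝ) ^ 2)⁻¹), B + 2, fun τ => ?_⟩
  have hy := τ.im_pos
  have hterm : ∀ n : ℕ+, ‖c n * ex τ ^ (n : ℕ)‖ ≤
      A * (((B + 2)! : ℝ) * ((n : ℝ) ^ 2)⁻¹) * (1 + τ.im⁻¹) ^ (B + 2) := by
    intro n
    refine (norm_qTail_term_le h (w := τ) le_rfl n).trans ?_
    rw [mul_assoc A (_ * _) _]
    refine mul_le_mul_of_nonneg_left ?_ hA
    have hn : (0 : ℝ) < n := Nat.cast_pos.2 n.pos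
    have h1 := Real.pow_div_factorial_le_exp (n * τ.im) (by positivity) (B + 2)
    have h2 : Real.exp (-2 * Real.pi * (τ : ℂ).im) ^ (n : ℕ) ≤ (Real.exp (n * τ.im))⁻¹ := by
      rw [← Real.exp_nat_mul, ← Real.exp_neg]
      refine Real.exp_le_exp.2 ?_
      have : 0 < n * τ.im := by positivity
      simp only [coe_im]
      nlinarith [Real.pi_gt_three]
    have h3 : (Real.exp (n * τ.im))⁻¹ ≤ ((n * τ.im) ^ (B + 2) / (B + 2)!)⁻¹ :=
      inv_anti₀ (by positivity) h1
    have h4 : τ.im⁻¹ ^ (B + 2) ≤ (1 + τ.im⁻¹) ^ (B + 2) :=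
      pow_le_pow_left₀ (by positivity) (by linarith) _
    calc (n : ℝ) ^ B * Real.exp (-2 * Real.pi * (τ : ℂ).im) ^ (n : ℕ)
        ≤ (n : ℝ) ^ B * ((n * τ.im) ^ (B + 2) / (B + 2)!)⁻¹ :=
          mul_le_mul_of_nonneg_left (h2.trans h3) (by positivity)
      _ = ((B + 2)! : ℝ) * ((n : ℝ) ^ 2)⁻¹ * τ.im⁻¹ ^ (B + 2) := by
          rw [inv_pow, mul_pow]; field_simp; ring
      _ ≤ _ := mul_le_mul_of_nonneg_left h4 (by positivity)
  have hs' := ((hs.mul_left ((B + 2)! : ℝ)).mul_left A).mul_right ((1 + τ.im⁻¹) ^ (B + 2))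
  refine (tsum_of_norm_bounded hs'.hasSum hterm).trans_eq ?_
  rw [tsum_mul_right, tsum_mul_left, tsum_mul_left]

lemma ModGrowth.const (t : ℂ) : ModGrowth fun _ => t := ⟨‖t‖, 0, fun τ => by simp⟩

lemma one_le_one_add_inv (τ : ℍ) : 1 ≤ 1 + τ.im⁻¹ := by
  have := inv_pos.2 τ.im_pos; linarith

lemma ModGrowth.exists_nonneg {f : ℍ → ℂ} (hf : ModGrowth f) :
    ∃ (A : ℝ) (k : ℕ), 0 ≤ A ∧ ∀ τ : ℍ, ‖f τ‖ ≤ A * (1 + τ.im⁻¹) ^ k := by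
  obtain ⟨A, k, h⟩ := hf
  refine ⟨|A|, k, abs_nonneg _, fun τ => (h τ).trans ?_⟩
  have := one_le_one_add_inv τ
  exact mul_le_mul_of_nonneg_right (le_abs_self A) (by positivity)

lemma ModGrowth.mul {f g : ℍ → ℂ} (hf : ModGrowth f) (hg : ModGrowth g) : ModGrowth (f * g) := by
  obtain ⟨A, k, hA, h⟩ := hf.exists_nonneg
  obtain ⟨A', k', hA', h'⟩ := hg.exists_nonneg
  refine ⟨A * A', k + k', fun τ => ?_⟩
  have := one_le_one_add_inv τ
  rw [Pi.mul_apply, norm_mul]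
  exact (mul_le_mul (h τ) (h' τ) (norm_nonneg _) (by positivity)).trans_eq (by ring)

lemma ModGrowth.add {f g : ℍ → ℂ} (hf : ModGrowth f) (hg : ModGrowth g) : ModGrowth (f + g) := by
  obtain ⟨A, k, hA, h⟩ := hf.exists_nonneg
  obtain ⟨A', k', hA', h'⟩ := hg.exists_nonneg
  refine ⟨A + A', k + k', fun τ => ?_⟩
  have h1 := one_le_one_add_inv τ
  refine (norm_add_le _ _).trans ?_
  rw [add_mul]
  refine add_le_add ((h τ).trans ?_) ((h' τ).trans ?_)
  · exact mul_le_mul_of_nonneg_left (pow_le_pow_right₀ h1 (by omega)) hA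
  · exact mul_le_mul_of_nonneg_left (pow_le_pow_right₀ h1 (by omega)) hA'

lemma ModGrowth.smul {f : ℍ → ℂ} (hf : ModGrowth f) (t : ℂ) : ModGrowth (t • f) :=
  (ModGrowth.const t).mul hf

lemma ModGrowth.sub {f g : ℍ → ℂ} (hf : ModGrowth f) (hg : ModGrowth g) : ModGrowth (f - g) := by
  have h := hf.add (hg.smul (-1))
  rwa [neg_one_smul, ← sub_eq_add_neg] at h

end ToricForms

namespace ToricForms

open Filter Topology Asymptotics EisensteinSeries
open scoped Nat Manifold ModularForm

/-! ### A criterion for modularity -/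

lemma periodic_comp_ofComplex {F : ℍ → ℂ} {h : ℝ} (hF : ∀ τ : ℍ, F (h +ᵥ τ) = F τ) :
    Function.Periodic (F ∘ ofComplex) h := by
  intro w
  by_cases! hw : 0 < w.im
  · have : 0 < (w + h).im := by simp [hw]
    simp only [Function.comp_apply, ofComplex_apply_of_im_pos this, ofComplex_apply_of_im_pos hw]
    rw [← hF ⟨w, hw⟩]
    congr 1
    ext
    simp [add_comm]
  · have : (w + h).im ≤ 0 := by simpa using hw
    simp [ofComplex_apply_of_im_nonpos this, ofComplex_apply_of_im_nonpos hw]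

lemma exists_int_vadd_re_mem {h : ℝ} (hh : 0 < h) (τ : ℍ) :
    ∃ n : ℤ, |(((n * h : ℝ) +ᵥ τ : ℍ) : ℂ).re| ≤ h := by
  refine ⟨-⌊τ.re / h⌋, ?_⟩
  have h1 := Int.floor_le (τ.re / h)
  have h2 := Int.lt_floor_add_one (τ.re / h)
  rw [le_div_iff₀ hh] at h1
  rw [div_lt_iff₀ hh] at h2
  rw [coe_vadd, add_re, ofReal_re, coe_re, abs_le]
  push_cast
  constructor <;> linarith

/-- A periodic holomorphic function on the upper half plane growing at most polynomially in the
imaginary part is bounded at infinity. -/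
lemma isBoundedAtImInfty_of_polynomial_growth {F : ℍ → ℂ} {h : ℝ} (hh : 0 < h) (hF : MDiff F)
    (hper : ∀ τ : ℍ, F (h +ᵥ τ) = F τ) {A K : ℝ} {k : ℕ}
    (hb : ∀ τ : ℍ, 1 ≤ τ.im → |(τ : ℂ).re| ≤ h → ‖F τ‖ ≤ A * (K * τ.im) ^ k) :
    IsBoundedAtImInfty F := by
  have hZ : ∀ (n : ℤ) (τ : ℍ), F ((n * h : ℝ) +ᵥ τ) = F τ := by
    intro n
    induction n using Int.induction_on with
    | zero => intro τ; simp
    | succ n ih =>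
      intro τ
      rw [show (((n : ℤ) + 1 : ℤ) * h : ℝ) = (n : ℤ) * h + h by push_cast; ring, add_vadd, ih, hper]
    | pred n ih =>
      intro τ
      rw [← ih τ, show ((-(n : ℤ) : ℤ) * h : ℝ) = h + (-(n : ℤ) - 1 : ℤ) * h by push_cast; ring,
        add_vadd, hper]
  have hb' : ∀ τ : ℍ, 1 ≤ τ.im → ‖F τ‖ ≤ A * (K * τ.im) ^ k := by
    intro τ hτ
    obtain ⟨n, hn⟩ := exists_int_vadd_re_mem hh τ
    have := hb _ (by simpa using hτ) hn
    simpa [hZ] using this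
  -- One extra power of the local parameter beats polynomial growth, so `G` vanishes at infinity.
  -- Its automatic decay rate `exp (-2π Im τ / h)` is exactly the norm of the factor, so dividing it
  -- out leaves `F` bounded.
  set G : ℍ → ℂ := fun τ => F τ * ex (τ / h) with hG
  have hnorm : ∀ τ : ℍ, ‖ex (τ / h)‖ = Real.exp (-2 * Real.pi * τ.im / h) := by
    intro τ
    rw [norm_ex, div_ofReal_im, coe_im, mul_div_assoc]
  have hGm : MDiff G := by
    refine hF.mul ?_
    rw [UpperHalfPlane.mdifferentiable_iff]
    have : Differentiable ℂ fun w : ℂ => ex (w / h) := by unfold ex; fun_prop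
    refine this.differentiableOn.congr fun w hw => ?_
    simp only [Function.comp, ofComplex_apply_of_im_pos hw]
  have hGper : Function.Periodic (G ∘ ofComplex) h := by
    refine periodic_comp_ofComplex fun τ => ?_
    simp only [hG, hper, coe_vadd]
    rw [add_div, div_self (ofReal_ne_zero.2 hh.ne'), ex_add, ex_one, one_mul]
  have hlim : Tendsto (fun y : ℝ => A * (K * y) ^ k * Real.exp (-2 * Real.pi * y / h)) atTop
      (𝓝 0) := by
    have h1 := tendsto_rpow_mul_exp_neg_mul_atTop_nhds_zero k (2 * Real.pi / h) (by positivity)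
    simp only [Real.rpow_natCast] at h1
    have h2 := h1.const_mul (A * K ^ k)
    rw [mul_zero] at h2
    refine h2.congr fun y => ?_
    rw [mul_pow, show -(2 * Real.pi / h) * y = -2 * Real.pi * y / h by ring]
    ring
  have hGb : ∀ τ : ℍ, 1 ≤ τ.im → ‖G τ‖ ≤ A * (K * τ.im) ^ k * Real.exp (-2 * Real.pi * τ.im / h) := by
    intro τ hτ
    simp only [hG]
    rw [norm_mul, hnorm]
    exact mul_le_mul_of_nonneg_right (hb' τ hτ) (Real.exp_pos _).le
  have hG0 : IsZeroAtImInfty G := by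
    rw [isZeroAtImInfty_iff]
    intro ε hε
    obtain ⟨Y, hY⟩ := eventually_atTop.1 (hlim.eventually (gt_mem_nhds hε))
    refine ⟨max 1 Y, fun τ hτ => ?_⟩
    exact (hGb τ ((le_max_left _ _).trans hτ)).trans (hY _ ((le_max_right _ _).trans hτ)).le
  have hdecay := hG0.exp_decay_atImInfty hh hGper hGm hG0.isBoundedAtImInfty
  obtain ⟨B, hB⟩ := hdecay.bound
  rw [isBoundedAtImInfty_iff]
  obtain ⟨Y, hY⟩ := (atImInfty_mem _).1 hB
  refine ⟨B, Y, fun τ hτ => ?_⟩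
  have h1 : ‖G τ‖ ≤ B * ‖Real.exp (-2 * Real.pi * τ.im / h)‖ := hY τ hτ
  simp only [hG] at h1
  rw [norm_mul, hnorm, Real.norm_of_nonneg (Real.exp_pos _).le] at h1
  exact le_of_mul_le_mul_right h1 (Real.exp_pos _)

lemma conj_T_pow_mem_Gamma1 (l : ℕ) (γ : SL(2, ℤ)) :
    γ * ModularGroup.T ^ l * γ⁻¹ ∈ CongruenceSubgroup.Gamma1 l := by
  have h1 : ModularGroup.T ^ l ∈ CongruenceSubgroup.Gamma l :=
    by simpa using CongruenceSubgroup.ModularGroup_T_pow_mem_Gamma l l (dvd_refl _)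
  have h2 := (CongruenceSubgroup.Gamma_normal l).conj_mem _ h1 γ
  rw [CongruenceSubgroup.Gamma_mem] at h2
  exact (CongruenceSubgroup.Gamma1_mem _ _).2 ⟨h2.1, h2.2.2.2, h2.2.2.1⟩

lemma one_le_norm_denom (γ : SL(2, ℤ)) {τ : ℍ} (hτ : 1 ≤ τ.im) : 1 ≤ ‖denom γ τ‖ := by
  rw [ModularGroup.denom_apply]
  by_cases hc : γ 1 0 = 0
  · have hdet := γ.det_coe
    rw [Matrix.det_fin_two, hc, mul_zero, sub_zero] at hdet
    have hd : |γ 1 1| = 1 := Int.isUnit_iff_abs_eq.1 (IsUnit.of_mul_eq_one _ ((mul_comm _ _).trans hdet))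
    rw [hc]
    simp only [Int.cast_zero, zero_mul, zero_add]
    rw [Complex.norm_intCast]
    exact_mod_cast hd.ge
  · refine le_trans ?_ (Complex.abs_im_le_norm _)
    simp only [add_im, mul_im, intCast_re, intCast_im, zero_mul, add_zero, coe_im]
    rw [abs_mul]
    have h1 : (1 : ℝ) ≤ |((γ 1 0 : ℤ) : ℝ)| := by exact_mod_cast Int.one_le_abs hc
    have h2 : (1 : ℝ) ≤ |τ.im| := hτ.trans (le_abs_self _)
    nlinarith

lemma norm_denom_le (γ : SL(2, ℤ)) {τ : ℍ} {h : ℝ} (hτ : 1 ≤ τ.im) (hre : |(τ : ℂ).re| ≤ h) :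
    ‖denom γ τ‖ ≤ (|(γ 1 0 : ℝ)| * (h + 1) + |(γ 1 1 : ℝ)|) * τ.im := by
  rw [ModularGroup.denom_apply]
  have h1 : ‖(τ : ℂ)‖ ≤ h + τ.im := by
    refine (Complex.norm_le_abs_re_add_abs_im _).trans ?_
    rw [coe_im, abs_of_pos τ.im_pos]; linarith
  refine (norm_add_le _ _).trans ?_
  rw [norm_mul, Complex.norm_intCast, Complex.norm_intCast]
  have h0 : 0 ≤ h := (abs_nonneg _).trans hre
  have h2 : h + τ.im ≤ (h + 1) * τ.im := by nlinarith
  have h3 := mul_le_mul_of_nonneg_left (h1.trans h2) (abs_nonneg ((γ 1 0 : ℤ) : ℝ))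
  have h4 := mul_le_mul_of_nonneg_left hτ (abs_nonneg ((γ 1 1 : ℤ) : ℝ))
  linarith

/-- The slash by `γ` has period `l` because conjugates of `T ^ l` stay in `Γ(l)`, hence in `Γ₁(l)`.
In a vertical strip with `Im τ ≥ 1` the denominator lies between `1` and a multiple of `Im τ`, so
growth in the inverse imaginary part becomes polynomial growth in `Im τ`. -/
lemma isBoundedAtImInfty_slash {l m : ℕ} [NeZero l] {f : ℍ → ℂ} (hf : MDiff f)
    (hg : ModGrowth f) (hinv : ∀ γ ∈ CongruenceSubgroup.Gamma1 l, f ∣[(m : ℤ)] γ = f)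
    (γ : SL(2, ℤ)) : IsBoundedAtImInfty (f ∣[(m : ℤ)] γ) := by
  have hl : (0 : ℝ) < l := Nat.cast_pos.2 (NeZero.pos l)
  have hslash : (f ∣[(m : ℤ)] γ) ∣[(m : ℤ)] (ModularGroup.T ^ l) = f ∣[(m : ℤ)] γ := by
    conv_rhs => rw [← hinv _ (conj_T_pow_mem_Gamma1 l γ)]
    rw [← SlashAction.slash_mul, ← SlashAction.slash_mul]
    congr 1
    group
  have hper : ∀ τ : ℍ, (f ∣[(m : ℤ)] γ) ((l : ℝ) +ᵥ τ) = (f ∣[(m : ℤ)] γ) τ := by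
    intro τ
    have h1 := congrFun hslash τ
    rw [ModularForm.SL_slash_apply] at h1
    have h2 : (ModularGroup.T ^ l) • τ = (l : ℝ) +ᵥ τ := by
      have := modular_T_zpow_smul τ l
      simpa using this
    have h3 : denom (ModularGroup.T ^ l : SL(2, ℤ)) τ = 1 := by
      rw [ModularGroup.denom_apply]
      have := ModularGroup.coe_T_zpow l
      rw [zpow_natCast] at this
      rw [this]; simp
    rw [h2, h3, one_zpow, mul_one] at h1
    exact h1
  obtain ⟨A, k, hA, hb⟩ := hg.exists_nonneg
  set K := |(γ 1 0 : ℝ)| * (l + 1) + |(γ 1 1 : ℝ)| with hK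
  have hK0 : 0 ≤ K := by positivity
  have hmd : MDiff (f ∣[(m : ℤ)] γ) := by
    rw [ModularForm.SL_slash]
    exact hf.slash _ _
  refine isBoundedAtImInfty_of_polynomial_growth hl hmd hper (A := A) (K := 1 + K ^ 2) (k := k) ?_
  intro τ hτ hre
  have hy := τ.im_pos
  have hJ1 := one_le_norm_denom γ hτ
  have hJ2 := norm_denom_le γ hτ hre
  rw [ModularForm.SL_slash_apply, norm_mul, norm_zpow]
  have h1 : ‖denom γ τ‖ ^ (-(m : ℤ)) ≤ 1 := by
    rw [zpow_neg, zpow_natCast]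
    exact inv_le_one_of_one_le₀ (one_le_pow₀ hJ1)
  have h2 : (γ • τ).im⁻¹ ≤ K ^ 2 * τ.im := by
    rw [ModularGroup.im_smul_eq_div_normSq, inv_div, Complex.normSq_eq_norm_sq, div_le_iff₀ hy]
    calc _ ≤ (K * τ.im) ^ 2 := pow_le_pow_left₀ (norm_nonneg _) hJ2 2
      _ = _ := by ring
  calc _ ≤ ‖f (γ • τ)‖ * 1 := mul_le_mul_of_nonneg_left h1 (norm_nonneg _)
    _ ≤ A * (1 + (γ • τ).im⁻¹) ^ k := by rw [mul_one]; exact hb _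
    _ ≤ _ := by
      refine mul_le_mul_of_nonneg_left (pow_le_pow_left₀ ?_ ?_ _) hA
      · exact zero_le_one.trans (one_le_one_add_inv _)
      · linarith

theorem isModular_of_modGrowth {l m : ℕ} [NeZero l] {f : ℍ → ℂ} (hf : MDiff f)
    (hg : ModGrowth f) (hinv : ∀ γ ∈ CongruenceSubgroup.Gamma1 l, f ∣[(m : ℤ)] γ = f) :
    IsModular l m f := by
  refine ⟨⟨⟨f, ?_⟩, hf, ?_⟩, rfl⟩
  · rintro _ ⟨γ, hγ, rfl⟩
    exact hinv γ hγ
  · intro c hc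
    rw [Subgroup.IsArithmetic.isCusp_iff_isCusp_SL2Z] at hc
    rw [OnePoint.isBoundedAt_iff_forall_SL2Z hc]
    intro γ _
    exact isBoundedAtImInfty_slash hf hg hinv γ

lemma slash_eq_iff {m : ℕ} {f g : ℍ → ℂ} {γ : SL(2, ℤ)} :
    f ∣[(m : ℤ)] γ = g ↔ ∀ τ, f (γ • τ) = denom γ τ ^ m * g τ := by
  rw [funext_iff]
  refine forall_congr' fun τ => ?_
  rw [ModularForm.SL_slash_apply, zpow_neg, zpow_natCast,
    mul_inv_eq_iff_eq_mul₀ (pow_ne_zero _ (denom_ne_zero _ _)), mul_comm]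

end ToricForms

namespace ToricForms

open Filter Topology Asymptotics EisensteinSeries
open scoped Nat Manifold ModularForm Derivative

/-! ### Quasimodularity of the Eisenstein series and of their derivatives -/

lemma polyBounded_stildeCoeff (l m : ℕ) (a : ZMod l) : PolyBounded (stildeCoeff l m a) := by
  refine ⟨2, m - 1 + 1, fun n => ?_⟩
  have hb : ∀ d ∈ n.divisors, ‖(d : ℂ) ^ (m - 1) * ((if (d : ZMod l) = a then 1 else 0) +
      (-1) ^ m * (if (d : ZMod l) = -a then 1 else 0))‖ ≤ (n : ℝ) ^ (m - 1) * 2 := by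
    intro d hd
    rw [norm_mul, norm_pow, Complex.norm_natCast]
    refine mul_le_mul (pow_le_pow_left₀ (Nat.cast_nonneg _)
      (Nat.cast_le.2 (Nat.divisor_le hd)) _) ?_ (norm_nonneg _) (by positivity)
    refine (norm_add_le _ _).trans ?_
    rw [norm_mul, norm_pow, norm_neg, norm_one, one_pow, one_mul]
    split_ifs <;> norm_num
  refine (norm_sum_le_of_le _ hb).trans ?_
  rw [Finset.sum_const, nsmul_eq_mul]
  have h1 : (n.divisors.card : ℝ) ≤ n := Nat.cast_le.2 (Nat.card_divisors_le_self n)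
  calc _ ≤ (n : ℝ) * ((n : ℝ) ^ (m - 1) * 2) := mul_le_mul_of_nonneg_right h1 (by positivity)
    _ = _ := by ring

lemma stilde_eq (l m : ℕ) (a : ZMod l) :
    stilde l m a = (fun _ => stildeConst l m a) + qTail (stildeCoeff l m a) := rfl

lemma mdifferentiable_stilde (l m : ℕ) (a : ZMod l) : MDiff (stilde l m a) :=
  mdifferentiable_const.add (mdifferentiable_qTail (polyBounded_stildeCoeff l m a))

lemma modGrowth_stilde (l m : ℕ) (a : ZMod l) : ModGrowth (stilde l m a) :=
  (ModGrowth.const _).add (modGrowth_qTail (polyBounded_stildeCoeff l m a))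

lemma dtau_eq (f : ℍ → ℂ) : dtau f = (2 * Real.pi * I : ℂ) • D f := by
  funext τ
  rw [Pi.smul_apply, smul_eq_mul, Derivative.normalizedDerivOfComplex,
    mul_inv_cancel_left₀ Complex.two_pi_I_ne_zero]
  rfl

lemma normalizedDeriv_eq (f : ℍ → ℂ) : D f = (2 * Real.pi * I : ℂ)⁻¹ • dtau f := rfl

lemma dtau_stilde (l m : ℕ) (a : ZMod l) :
    dtau (stilde l m a) = qTail fun n => 2 * Real.pi * I * n * stildeCoeff l m a n := by
  rw [← dtau_qTail (polyBounded_stildeCoeff l m a), dtau_eq, dtau_eq, stilde_eq,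
    Derivative.normalizedDerivOfComplex_add _ _ mdifferentiable_const
      (mdifferentiable_qTail (polyBounded_stildeCoeff l m a)),
    Derivative.normalizedDerivOfComplex_const, zero_add]

lemma modGrowth_D_stilde (l m : ℕ) (a : ZMod l) : ModGrowth (D (stilde l m a)) := by
  rw [normalizedDeriv_eq, dtau_stilde]
  exact (modGrowth_qTail ((polyBounded_stildeCoeff l m a).mul_natCast _)).smul _

/-- `E2` is the case `l = 1` of the family, so its transformation law and growth follow from those
of `stilde`. -/
lemma E2_eq_stilde : E2 = (-12 : ℂ) • stilde 1 2 0 := by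
  funext τ
  rw [E2_eq_tsum_cexp, Pi.smul_apply, smul_eq_mul, stilde]
  have h1 : stildeConst 1 2 0 = -1 / 12 := by
    simp [stildeConst, Polynomial.bernoulli_eval_zero, bernoulli_two]; norm_num
  have h2 : stildeTail 1 2 0 τ =
      2 * ∑' n : ℕ+, (ArithmeticFunction.sigma 1 n : ℂ) * cexp (2 * Real.pi * I * τ) ^ (n : ℕ) := by
    rw [stildeTail, ← tsum_mul_left]
    refine tsum_congr fun n => ?_
    rw [← mul_assoc]
    congr 1
    rw [stildeCoeff, ArithmeticFunction.sigma_one_apply, Nat.cast_sum, Finset.mul_sum]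
    refine Finset.sum_congr rfl fun d _ => ?_
    rw [if_pos (Subsingleton.elim _ _), if_pos (Subsingleton.elim _ _)]
    ring
  rw [h1, h2]
  ring

lemma E2_smul (γ : SL(2, ℤ)) (τ : ℍ) :
    E2 (γ • τ) = denom γ τ ^ 2 * E2 τ + 12 * ((γ 1 0 : ℤ) * denom γ τ) / (2 * Real.pi * I) := by
  have hγ : γ ∈ CongruenceSubgroup.Gamma1 1 :=
    (CongruenceSubgroup.Gamma1_mem _ _).2
      ⟨Subsingleton.elim _ _, Subsingleton.elim _ _, Subsingleton.elim _ _⟩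
  have h := stilde_smul (l := 1) 0 1 hγ τ
  rw [E2_eq_stilde, Pi.smul_apply, Pi.smul_apply, h, if_pos ⟨rfl, rfl⟩]
  simp only [smul_eq_mul, Nat.reduceAdd]
  ring

lemma modGrowth_E2 : ModGrowth E2 := by
  rw [E2_eq_stilde]
  exact (modGrowth_stilde _ _ _).smul _

variable {l : ℕ} [NeZero l]

theorem isModular_stilde (m : ℕ) (a : ZMod l) (h : ¬ (a = 0 ∧ m = 1)) :
    IsModular l (m + 1) (stilde l (m + 1) a) := by
  refine isModular_of_modGrowth (mdifferentiable_stilde _ _ _) (modGrowth_stilde _ _ _)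
    fun γ hγ => slash_eq_iff.2 fun τ => ?_
  rw [stilde_smul a m hγ, if_neg h, sub_zero]

/-- The defect of the exceptional form does not depend on `l`, so `E2` cancels it at every level. -/
theorem isModular_stilde_two_add : IsModular l 2 (stilde l 2 0 + (12 : ℂ)⁻¹ • E2) := by
  refine isModular_of_modGrowth ((mdifferentiable_stilde _ _ _).add
    (E2_mdifferentiable.const_smul _)) ((modGrowth_stilde _ _ _).add (modGrowth_E2.smul _))
    fun γ hγ => slash_eq_iff.2 fun τ => ?_
  have h := stilde_smul (l := l) 0 1 hγ τ
  simp only [Pi.add_apply, Pi.smul_apply, smul_eq_mul, E2_smul]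
  rw [if_pos ⟨rfl, rfl⟩] at h
  simp only [Nat.reduceAdd] at h
  rw [h]
  ring

lemma IsModular.mem {m : ℕ} {f : ℍ → ℂ} (hf : IsModular l m f) : f ∈ Quasimodular l m :=
  Submodule.subset_span ⟨0, m, f, by simp, hf, by simp⟩

lemma E2_pow_mul_mem {m j k : ℕ} (hk : m + 2 * j = k) {f : ℍ → ℂ} (hf : IsModular l m f) :
    E2 ^ j * f ∈ Quasimodular l k :=
  Submodule.subset_span ⟨j, m, f, hk, hf, rfl⟩

lemma isModular_one : IsModular l 0 1 := ⟨ModularForm.mcast Nat.cast_zero.symm 1, rfl⟩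

lemma IsModular.mul {m n : ℕ} {f g : ℍ → ℂ} (hf : IsModular l m f) (hg : IsModular l n g) :
    IsModular l (m + n) (f * g) := by
  obtain ⟨F, rfl⟩ := hf
  obtain ⟨G, rfl⟩ := hg
  exact ⟨ModularForm.mcast (by push_cast; rfl) (F.mul G), rfl⟩

lemma mul_mem_quasimodular {m n : ℕ} {f g : ℍ → ℂ} (hf : f ∈ Quasimodular l m)
    (hg : g ∈ Quasimodular l n) : f * g ∈ Quasimodular l (m + n) := by
  have h := Submodule.mul_mem_mul hf hg
  rw [Quasimodular, Quasimodular, Submodule.span_mul_span] at h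
  refine Submodule.span_le.2 ?_ h
  rintro _ ⟨_, ⟨j, p, F, hj, hF, rfl⟩, _, ⟨j', p', G, hj', hG, rfl⟩, rfl⟩
  exact Submodule.subset_span ⟨j + j', p + p', F * G, by omega, hF.mul hG, by
    simp only [pow_add]; ring⟩

lemma E2_mem : E2 ∈ Quasimodular l 2 := by
  have h := E2_pow_mul_mem (l := l) (m := 0) (j := 1) (k := 2) rfl isModular_one
  rwa [pow_one, mul_one] at h

theorem stilde_mem (m : ℕ) (a : ZMod l) : stilde l (m + 1) a ∈ Quasimodular l (m + 1) := by
  by_cases h : a = 0 ∧ m = 1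
  · obtain ⟨rfl, rfl⟩ := h
    have h1 := (Quasimodular l 2).sub_mem isModular_stilde_two_add.mem
      ((Quasimodular l 2).smul_mem (12 : ℂ)⁻¹ E2_mem)
    rwa [add_sub_cancel_right] at h1
  · exact (isModular_stilde m a h).mem

/-- The derivative is the Serre derivative, which is modular, plus a multiple of `E2 * f`. The
growth hypotheses supply holomorphy of the Serre derivative at the cusps. -/
lemma D_mem_of_isModular {m : ℕ} {f : ℍ → ℂ} (hf : IsModular l m f) (hg : ModGrowth f)
    (hg' : ModGrowth (D f)) : D f ∈ Quasimodular l (m + 2) := by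
  have hmd : MDiff f := by
    obtain ⟨F, rfl⟩ := hf
    exact F.holo'
  have hinv : ∀ γ ∈ CongruenceSubgroup.Gamma1 l, f ∣[(m : ℤ)] γ = f := by
    obtain ⟨F, rfl⟩ := hf
    intro γ hγ
    exact F.slash_action_eq' _ ⟨γ, hγ, rfl⟩
  have e : D f = Derivative.serreDerivative m f + ((m : ℂ) * 12⁻¹) • (E2 * f) := by
    funext τ
    simp [mul_assoc]
  have h1 : IsModular l (m + 2) (Derivative.serreDerivative m f) := by
    refine isModular_of_modGrowth (Derivative.serreDerivative_mdifferentiable _ hmd) ?_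
      fun γ hγ => ?_
    · rw [← sub_eq_iff_eq_add] at e
      rw [← e]
      exact hg'.sub ((modGrowth_E2.mul hg).smul _)
    · have := Derivative.serreDerivative_slash_invariant hmd (hinv γ hγ)
      exact_mod_cast this
  rw [e]
  refine Submodule.add_mem _ h1.mem (Submodule.smul_mem _ _ ?_)
  have := mul_mem_quasimodular (E2_mem (l := l)) hf.mem
  rwa [add_comm] at this

lemma modGrowth_D_E2 : ModGrowth (D E2) := by
  rw [E2_eq_stilde, Derivative.normalizedDerivOfComplex_smul _ _ (mdifferentiable_stilde _ _ _)]
  exact (modGrowth_D_stilde _ _ _).smul _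

lemma hasDerivAt_inv_denom (γ : SL(2, ℤ)) (τ : ℍ) :
    HasDerivAt ((fun τ : ℍ => ((γ 1 0 : ℤ) : ℂ) / denom γ τ) ∘ ofComplex)
      (-(((γ 1 0 : ℤ) : ℂ) / denom γ τ) ^ 2) τ := by
  have h0 : ((γ 1 0 : ℤ) : ℂ) * τ + (γ 1 1 : ℤ) ≠ 0 := by
    rw [← ModularGroup.denom_apply]; exact denom_ne_zero _ _
  have h1 : HasDerivAt (fun w : ℂ => ((γ 1 0 : ℤ) : ℂ) * w + (γ 1 1 : ℤ)) ((γ 1 0 : ℤ) : ℂ) τ := by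
    simpa using ((hasDerivAt_id (τ : ℂ)).const_mul ((γ 1 0 : ℤ) : ℂ)).add_const ((γ 1 1 : ℤ) : ℂ)
  have h2 := (h1.fun_inv h0).const_mul ((γ 1 0 : ℤ) : ℂ)
  rw [ModularGroup.denom_apply]
  refine (h2.congr_of_eventuallyEq ?_).congr_deriv (by field_simp)
  filter_upwards [isOpen_upperHalfPlaneSet.mem_nhds τ.im_pos] with w hw
  simp only [Function.comp]
  rw [ModularGroup.denom_apply, ofComplex_apply_of_im_pos hw, div_eq_mul_inv]

/-- By Ramanujan's identity this is `-E₄ / 12`, but only modularity is needed: differentiate the law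
`E2 ∣ γ = E2 + const · c / J` and use `(c / J)' = -(c / J)²`. -/
lemma isModular_D_E2_sub : IsModular l 4 (D E2 - (12 : ℂ)⁻¹ • (E2 * E2)) := by
  refine isModular_of_modGrowth ((Derivative.normalizedDerivOfComplex_mdifferentiable
    E2_mdifferentiable).sub ((E2_mdifferentiable.mul E2_mdifferentiable).const_smul _))
    (modGrowth_D_E2.sub ((modGrowth_E2.mul modGrowth_E2).smul _))
    fun γ hγ => slash_eq_iff.2 fun τ => ?_
  have hJ : denom γ τ ≠ 0 := denom_ne_zero _ _
  have hpi : (2 * Real.pi * I : ℂ) ≠ 0 := Complex.two_pi_I_ne_zero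
  have hs : E2 ∣[(2 : ℤ)] γ = E2 + (12 / (2 * Real.pi * I) : ℂ) •
      (fun τ : ℍ => ((γ 1 0 : ℤ) : ℂ) / denom γ τ) := by
    refine (slash_eq_iff (m := 2)).2 fun τ => ?_
    have hJ : denom γ τ ≠ 0 := denom_ne_zero _ _
    rw [E2_smul, Pi.add_apply, Pi.smul_apply, smul_eq_mul]
    field_simp
  have h1 := congrFun (Derivative.normalizedDerivOfComplex_SL_slash (k := 2)
    E2_mdifferentiable (γ := γ)) τ
  have h2 : D (E2 ∣[(2 : ℤ)] γ) τ = D E2 τ + (2 * Real.pi * I)⁻¹ * ((12 / (2 * Real.pi * I) : ℂ) *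
      (-(((γ 1 0 : ℤ) : ℂ) / denom γ τ) ^ 2)) := by
    rw [hs]
    simp only [Derivative.normalizedDerivOfComplex]
    rw [← mul_add]
    congr 1
    have d1 := (UpperHalfPlane.mdifferentiableAt_iff.1 (E2_mdifferentiable τ)).hasDerivAt
    exact (d1.add ((hasDerivAt_inv_denom γ τ).const_mul _)).deriv
  rw [h2, Pi.sub_apply, hs] at h1
  have h3 := (slash_eq_iff (m := 4) (f := D E2) (γ := γ)).1 rfl τ
  simp only [Pi.sub_apply, Pi.smul_apply, Pi.mul_apply, smul_eq_mul]
  rw [h3, E2_smul]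
  simp only [Pi.add_apply, Pi.smul_apply, smul_eq_mul, Int.reduceAdd, Int.cast_ofNat] at h1
  have h4 : (D E2 ∣[((4 : ℕ) : ℤ)] γ) τ = D E2 τ + (2 * Real.pi * I)⁻¹ *
      ((12 / (2 * Real.pi * I) : ℂ) * (-(((γ 1 0 : ℤ) : ℂ) / denom γ τ) ^ 2)) +
      2 * (2 * Real.pi * I)⁻¹ * (((γ 1 0 : ℤ) : ℂ) / denom γ τ) * (E2 τ +
      12 / (2 * Real.pi * I) * (((γ 1 0 : ℤ) : ℂ) / denom γ τ)) := by
    rw [eq_sub_iff_add_eq] at h1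
    exact h1.symm
  rw [h4]
  field_simp
  ring

theorem D_stilde_mem (m : ℕ) (a : ZMod l) :
    D (stilde l (m + 1) a) ∈ Quasimodular l (m + 1 + 2) := by
  by_cases h : a = 0 ∧ m = 1
  · obtain ⟨rfl, rfl⟩ := h
    have e : D (stilde l 2 0 + (12 : ℂ)⁻¹ • E2) = D (stilde l 2 0) + (12 : ℂ)⁻¹ • D E2 := by
      rw [Derivative.normalizedDerivOfComplex_add _ _ (mdifferentiable_stilde _ _ _)
        (E2_mdifferentiable.const_smul _), Derivative.normalizedDerivOfComplex_smul _ _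
        E2_mdifferentiable]
    have h1 := D_mem_of_isModular (isModular_stilde_two_add (l := l))
      ((modGrowth_stilde _ _ _).add (modGrowth_E2.smul _))
      (by rw [e]; exact (modGrowth_D_stilde _ _ _).add (modGrowth_D_E2.smul _))
    rw [e] at h1
    have h2 : D E2 ∈ Quasimodular l 4 := by
      have := (Quasimodular l 4).add_mem (isModular_D_E2_sub (l := l)).mem
        ((Quasimodular l 4).smul_mem (12 : ℂ)⁻¹ (mul_mem_quasimodular (m := 2) (n := 2) E2_mem E2_mem))
      rwa [sub_add_cancel] at this
    have h3 := (Quasimodular l 4).sub_mem h1 ((Quasimodular l 4).smul_mem (12 : ℂ)⁻¹ h2)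
    rwa [add_sub_cancel_right] at h3
  · exact D_mem_of_isModular (isModular_stilde m a h) (modGrowth_stilde _ _ _)
      (modGrowth_D_stilde _ _ _)

theorem eisensteinSpan_le {k : ℕ} (hk : 2 < k) : eisensteinSpan l k ≤ Quasimodular l k := by
  obtain ⟨n, rfl⟩ : ∃ n, k = n + 1 + 2 := ⟨k - 3, by omega⟩
  refine Submodule.span_le.2 (Set.union_subset ?_ ?_)
  · rintro _ ⟨a, rfl⟩
    exact stilde_mem (n + 2) a
  · rintro _ ⟨a, rfl⟩
    simp only [Nat.add_sub_cancel, dtau_eq]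
    exact Submodule.smul_mem _ _ (D_stilde_mem n a)

/-! ### Constants are not quasimodular of positive weight -/

/-- The matrix with rows `(1, 0)` and `(l n, 1)`. -/
def lowerUnipotent (c : ℤ) : SL(2, ℤ) := ⟨!![1, 0; c, 1], by simp⟩

lemma lowerUnipotent_mem (n : ℤ) : lowerUnipotent (l * n) ∈ CongruenceSubgroup.Gamma1 l := by
  rw [CongruenceSubgroup.Gamma1_mem]
  simp [lowerUnipotent]

lemma denom_lowerUnipotent (c : ℤ) (τ : ℍ) : denom (lowerUnipotent c) τ = c * τ + 1 := by
  rw [ModularGroup.denom_apply]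
  simp [lowerUnipotent]

/-- With `c = l n` the lower left entry, a modular factor contributes a power of `c τ + 1` and the
law of `E2` has `c τ + 1` as a factor. Positive weight therefore forces a zero of the polynomial at
`c = -1 / τ`. -/
lemma exists_polynomial_of_mem {k : ℕ} (hk : 1 ≤ k) {f : ℍ → ℂ} (hf : f ∈ Quasimodular l k)
    (τ : ℍ) : ∃ p : Polynomial ℂ, p.eval (-(τ : ℂ)⁻¹) = 0 ∧
      ∀ n : ℤ, f (lowerUnipotent (l * n) • τ) = p.eval ((l * n : ℤ) : ℂ) := by
  have hτ : (τ : ℂ) ≠ 0 := τ.ne_zero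
  induction hf using Submodule.span_induction with
  | mem f hf =>
    obtain ⟨j, m, g, hj, ⟨F, rfl⟩, rfl⟩ := hf
    refine ⟨((Polynomial.X * Polynomial.C (τ : ℂ) + 1) ^ 2 * Polynomial.C (E2 τ) +
      Polynomial.C (12 / (2 * Real.pi * I)) *
      (Polynomial.X * (Polynomial.X * Polynomial.C (τ : ℂ) + 1))) ^ j *
      ((Polynomial.X * Polynomial.C (τ : ℂ) + 1) ^ m * Polynomial.C (F τ)), ?_, fun n => ?_⟩
    · have h0 : -(τ : ℂ)⁻¹ * τ + 1 = 0 := by field_simp; ring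
      simp only [Polynomial.eval_mul, Polynomial.eval_pow, Polynomial.eval_add, Polynomial.eval_X,
        Polynomial.eval_C, Polynomial.eval_one, h0]
      rcases Nat.eq_zero_or_pos m with rfl | hm
      · have : j ≠ 0 := by omega
        simp [this]
      · simp [hm.ne']
    · have h1 := slash_eq_iff.1 (F.slash_action_eq' _ ⟨_, lowerUnipotent_mem (l := l) n, rfl⟩) τ
      have h1' : F (lowerUnipotent (l * n) • τ) = (((l * n : ℤ) : ℂ) * τ + 1) ^ m * F τ := by
        rw [← denom_lowerUnipotent]; exact h1
      have h2 : ((lowerUnipotent (l * n) 1 0 : ℤ) : ℂ) = ((l * n : ℤ) : ℂ) := rfl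
      simp only [Polynomial.eval_mul, Polynomial.eval_pow, Polynomial.eval_add, Polynomial.eval_X,
        Polynomial.eval_C, Polynomial.eval_one, Pi.mul_apply, Pi.pow_apply]
      rw [h1', E2_smul, denom_lowerUnipotent, h2]
      congr 2
      ring
  | zero => exact ⟨0, by simp, by simp⟩
  | add f g _ _ hf hg =>
    obtain ⟨p, hp, hp'⟩ := hf
    obtain ⟨r, hr, hr'⟩ := hg
    exact ⟨p + r, by simp [hp, hr], fun n => by simp only [Pi.add_apply, hp', hr', Polynomial.eval_add]⟩
  | smul t f _ hf =>
    obtain ⟨p, hp, hp'⟩ := hf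
    exact ⟨Polynomial.C t * p, by simp [hp], fun n => by
      simp only [Pi.smul_apply, smul_eq_mul, hp', Polynomial.eval_mul, Polynomial.eval_C]⟩

/-- The polynomial attached to a constant function takes the same value at infinitely many integers,
so it is constant, yet it has a zero. -/
theorem const_eq_zero_of_mem {k : ℕ} (hk : 1 ≤ k) {t : ℂ}
    (ht : (fun _ => t : ℍ → ℂ) ∈ Quasimodular l k) : t = 0 := by
  obtain ⟨p, hp, hp'⟩ := exists_polynomial_of_mem hk ht UpperHalfPlane.I
  have h : p = Polynomial.C t := by
    refine Polynomial.eq_of_infinite_eval_eq _ _ ?_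
    refine Set.Infinite.mono (s := Set.range fun n : ℤ => ((l * n : ℤ) : ℂ)) ?_
      (Set.infinite_range_of_injective ?_)
    · rintro _ ⟨n, rfl⟩
      exact (hp' n).symm.trans Polynomial.eval_C.symm
    · intro a b hab
      have h1 : (l : ℤ) * a = l * b := by exact Int.cast_injective hab
      exact mul_left_cancel₀ (Nat.cast_ne_zero.2 (NeZero.ne l)) h1
  rw [h, Polynomial.eval_C] at hp
  exact hp

end ToricForms

namespace ToricForms

open scoped Nat

/-! ### Regularized sums of polynomials over residue classes -/

/-- The addition formula for Bernoulli polynomials. -/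
lemma bernoulli_eval_add (n : ℕ) (s t : ℚ) : (Polynomial.bernoulli n).eval (s + t) =
    ∑ p ∈ Finset.HasAntidiagonal.antidiagonal n, (n.choose p.1 : ℚ) *
      (Polynomial.bernoulli p.1).eval s * t ^ p.2 := by
  have h1 := Polynomial.bernoulli_generating_function (A := ℚ) s
  have h2 := Polynomial.bernoulli_generating_function (A := ℚ) (s + t)
  have h3 : PowerSeries.mk (fun n => Polynomial.aeval (s + t) ((1 / n ! : ℚ) • Polynomial.bernoulli n)) =
      PowerSeries.mk (fun n => Polynomial.aeval s ((1 / n ! : ℚ) • Polynomial.bernoulli n)) *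
        PowerSeries.rescale t (PowerSeries.exp ℚ) := by
    have h0 : (PowerSeries.exp ℚ - 1) ≠ 0 := by
      intro h
      have := congrArg (PowerSeries.coeff 1) h
      simp [PowerSeries.coeff_exp, PowerSeries.coeff_one] at this
    refine mul_right_cancel₀ h0 ?_
    rw [h2, mul_right_comm, h1, mul_assoc, PowerSeries.exp_mul_exp_eq_exp_add]
  have h4 := congrArg (PowerSeries.coeff n) h3
  rw [PowerSeries.coeff_mul, PowerSeries.coeff_mk] at h4
  simp only [PowerSeries.coeff_mk, PowerSeries.coeff_rescale, PowerSeries.coeff_exp, map_smul,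
    Polynomial.coe_aeval_eq_eval, smul_eq_mul, Algebra.algebraMap_self, RingHom.id_apply] at h4
  have hn : (n ! : ℚ) ≠ 0 := Nat.cast_ne_zero.2 (Nat.factorial_ne_zero n)
  have h5 : (Polynomial.bernoulli n).eval (s + t) = n ! * (1 / (n ! : ℚ) *
      (Polynomial.bernoulli n).eval (s + t)) := by field_simp
  rw [h5, h4, Finset.mul_sum]
  refine Finset.sum_congr rfl fun p hp => ?_
  have hp' := Finset.HasAntidiagonal.mem_antidiagonal.1 hp
  have hc : (n ! : ℚ) = n.choose p.1 * p.1 ! * p.2 ! := by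
    rw [← hp']
    exact_mod_cast ((Nat.choose_symm_add (a := p.1) (b := p.2)) ▸
      Nat.add_choose_mul_factorial_mul_factorial p.1 p.2).symm
  have h6 : (p.1 ! : ℚ) ≠ 0 := Nat.cast_ne_zero.2 (Nat.factorial_ne_zero _)
  have h7 : (p.2 ! : ℚ) ≠ 0 := Nat.cast_ne_zero.2 (Nat.factorial_ne_zero _)
  rw [hc]
  field_simp

/-- The linear functional on polynomials with prescribed values on the powers of `X`. -/
def polyFunctional (f : ℕ → ℂ) : Polynomial ℂ →ₗ[ℂ] ℂ := (Polynomial.basisMonomials ℂ).constr ℂ f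

lemma polyFunctional_X_pow (f : ℕ → ℂ) (n : ℕ) : polyFunctional f (Polynomial.X ^ n) = f n := by
  rw [← Polynomial.monomial_one_right_eq_X_pow]
  simpa [polyFunctional] using (Polynomial.basisMonomials ℂ).constr_basis ℂ f n

lemma polyLinearMap_ext {F G : Polynomial ℂ →ₗ[ℂ] ℂ}
    (h : ∀ n, F (Polynomial.X ^ n) = G (Polynomial.X ^ n)) : F = G := by
  refine (Polynomial.basisMonomials ℂ).ext fun n => ?_
  simpa [Polynomial.monomial_one_right_eq_X_pow] using h n

/-- The integral of a polynomial from `0` to `c`. -/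
def polyIntegral (c : ℂ) : Polynomial ℂ →ₗ[ℂ] ℂ := polyFunctional fun n => c ^ (n + 1) / (n + 1)

/-- The regularized value of `∑ p(j)` over `j = t, t + l, t + 2 l, …`. -/
def regSum (l : ℕ) (t : ℚ) : Polynomial ℂ →ₗ[ℂ] ℂ :=
  polyFunctional fun n => ((-((l : ℚ) ^ n * (Polynomial.bernoulli (n + 1)).eval (t / l) / (n + 1)) : ℚ) : ℂ)

/-- The functional sending `X ^ n` to the constant term of `s̃^{(n+1)}_{a/l}`. -/
def regConst {l : ℕ} (a : ZMod l) : Polynomial ℂ →ₗ[ℂ] ℂ :=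
  polyFunctional fun n => stildeConst l (n + 1) a

variable {l : ℕ} [NeZero l]

lemma regSum_sub_regSum_add (t : ℚ) (p : Polynomial ℂ) :
    regSum l t p - regSum l (t + l) p = p.eval (t : ℂ) := by
  have hl : (l : ℚ) ≠ 0 := Nat.cast_ne_zero.2 (NeZero.ne l)
  have h : regSum l t - regSum l (t + l) = (Polynomial.aeval (R := ℂ) (t : ℂ)).toLinearMap := by
    refine polyLinearMap_ext fun n => ?_
    simp only [LinearMap.sub_apply, regSum, polyFunctional_X_pow, AlgHom.toLinearMap_apply, map_pow,
      Polynomial.aeval_X]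
    rw [← Rat.cast_sub, ← Rat.cast_pow]
    congr 1
    rw [add_div, div_self hl, add_comm (t / l) 1, Polynomial.bernoulli_eval_one_add]
    have hn : ((n : ℚ) + 1) ≠ 0 := by positivity
    push_cast
    rw [div_pow]
    field_simp
    ring
  have := LinearMap.congr_fun h p
  rwa [LinearMap.sub_apply, AlgHom.toLinearMap_apply, Polynomial.coe_aeval_eq_eval] at this

/-- The regularized sum over a whole residue class vanishes: the reflected half-line covers `t - l,
t - 2 l, …`. This is the reflection formula for Bernoulli polynomials. -/
lemma regSum_add_regSum_neg (t : ℚ) (p : Polynomial ℂ) :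
    regSum l t p + regSum l (l - t) (Polynomial.aeval (-Polynomial.X : Polynomial ℂ) p) = 0 := by
  have hl : (l : ℚ) ≠ 0 := Nat.cast_ne_zero.2 (NeZero.ne l)
  have h : regSum l t + regSum l (l - t) ∘ₗ
      (Polynomial.aeval (R := ℂ) (-Polynomial.X : Polynomial ℂ)).toLinearMap = 0 := by
    refine polyLinearMap_ext fun n => ?_
    have e : (-Polynomial.X : Polynomial ℂ) ^ n = ((-1 : ℂ) ^ n) • Polynomial.X ^ n := by
      rw [← neg_one_smul ℂ (Polynomial.X : Polynomial ℂ), smul_pow]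
    simp only [LinearMap.add_apply, LinearMap.comp_apply, AlgHom.toLinearMap_apply, map_pow,
      Polynomial.aeval_X, LinearMap.zero_apply, e, map_smul, smul_eq_mul]
    simp only [regSum, polyFunctional_X_pow]
    rw [sub_div, div_self hl, Polynomial.bernoulli_eval_one_sub]
    push_cast
    rw [pow_succ]
    have h1 : ((-1 : ℂ) ^ n) * (-1) ^ n = 1 := by rw [← mul_pow]; simp
    linear_combination ((l : ℂ) ^ n * ((Polynomial.eval (t / l) (Polynomial.bernoulli (n + 1)) : ℚ) : ℂ)
      / (n + 1)) * h1
  exact LinearMap.congr_fun h p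

/-- Regularization is not translation invariant. The integral is the anomaly; it comes from the
`B_0` term of the addition formula. -/
lemma regSum_add (t c : ℚ) (p : Polynomial ℂ) :
    regSum l (t + c) p = regSum l t (Polynomial.aeval (Polynomial.X + Polynomial.C (c : ℂ)) p)
      - (l : ℂ)⁻¹ * polyIntegral c p := by
  have hl : (l : ℂ) ≠ 0 := Nat.cast_ne_zero.2 (NeZero.ne l)
  have h : regSum l (t + c) = regSum l t ∘ₗ
      (Polynomial.aeval (R := ℂ) (Polynomial.X + Polynomial.C (c : ℂ))).toLinearMap -
      (l : ℂ)⁻¹ • polyIntegral c := by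
    refine polyLinearMap_ext fun n => ?_
    have e : (Polynomial.X + Polynomial.C (c : ℂ)) ^ n =
        ∑ k ∈ Finset.range (n + 1), ((n.choose k : ℂ) * (c : ℂ) ^ (n - k)) • Polynomial.X ^ k := by
      rw [add_pow]
      refine Finset.sum_congr rfl fun k _ => ?_
      rw [Polynomial.smul_eq_C_mul, map_mul, map_pow, map_natCast]
      ring
    simp only [LinearMap.sub_apply, LinearMap.comp_apply, AlgHom.toLinearMap_apply, map_pow,
      Polynomial.aeval_X, LinearMap.smul_apply, e, map_sum, map_smul, smul_eq_mul]
    simp only [regSum, polyIntegral, polyFunctional_X_pow]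
    rw [add_div, bernoulli_eval_add, Finset.Nat.sum_antidiagonal_eq_sum_range_succ_mk,
      Finset.sum_range_succ']
    have hn : ((n : ℂ) + 1) ≠ 0 := by exact_mod_cast Nat.succ_ne_zero n
    push_cast
    have hk : ∀ k ∈ Finset.range (n + 1), (((n + 1).choose (k + 1) : ℕ) : ℂ) *
        ((Polynomial.eval (t / l) (Polynomial.bernoulli (k + 1)) : ℚ) : ℂ) *
        ((c : ℂ) / l) ^ (n - k) = - ((n + 1) / (l : ℂ) ^ n) *
        ((n.choose k : ℂ) * (c : ℂ) ^ (n - k) *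
        -((l : ℂ) ^ k * ((Polynomial.eval (t / l) (Polynomial.bernoulli (k + 1)) : ℚ) : ℂ) / (k + 1))) := by
      intro k hk
      have hk' : k ≤ n := by simpa [Nat.lt_succ_iff] using hk
      have hk1 : ((k : ℂ) + 1) ≠ 0 := by exact_mod_cast Nat.succ_ne_zero k
      have hch : (((n + 1).choose (k + 1) : ℕ) : ℂ) = (n + 1) * n.choose k / (k + 1) := by
        rw [eq_div_iff hk1]
        exact_mod_cast (Nat.add_one_mul_choose_eq n k).symm
      have hpow : (l : ℂ) ^ n = (l : ℂ) ^ k * (l : ℂ) ^ (n - k) := by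
        rw [← pow_add, Nat.add_sub_cancel' hk']
      rw [hch, hpow, div_pow]
      field_simp
    rw [Finset.sum_congr rfl hk, ← Finset.mul_sum]
    simp only [Nat.choose_zero_right, Nat.cast_one, Polynomial.bernoulli_zero, Polynomial.eval_one,
      Rat.cast_one, one_mul, div_pow]
    rw [pow_succ (l : ℂ)]
    field_simp
    ring
  have := LinearMap.congr_fun h p
  simpa using this

/-- Constant terms are regularized sums over the nonnegative members of the class, an element `0`
being counted with weight one half. -/
lemma regConst_eq (a : ZMod l) (p : Polynomial ℂ) :
    regConst a p = regSum l a.val p - if a = 0 then p.eval 0 / 2 else 0 := by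
  have h : regConst a = regSum l a.val - if a = 0 then (2 : ℂ)⁻¹ •
      (Polynomial.aeval (R := ℂ) (0 : ℂ)).toLinearMap else 0 := by
    refine polyLinearMap_ext fun n => ?_
    simp only [regConst, regSum, LinearMap.sub_apply, polyFunctional_X_pow, stildeConst_succ]
    have hn : ((n : ℂ) + 1) ≠ 0 := by exact_mod_cast Nat.succ_ne_zero n
    have hf : (n ! : ℂ) ≠ 0 := Nat.cast_ne_zero.2 (Nat.factorial_ne_zero n)
    congr 1
    · rw [Nat.factorial_succ]
      push_cast
      field_simp
    · by_cases ha : a = 0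
      · by_cases h0 : n = 0 <;> simp [ha, h0]
      · simp [ha]
  have h' := LinearMap.congr_fun h p
  rw [h', LinearMap.sub_apply]
  congr 1
  split_ifs
  · simp only [LinearMap.smul_apply, AlgHom.toLinearMap_apply, Polynomial.coe_aeval_eq_eval,
      smul_eq_mul]
    ring
  · rfl

/-- The sum of `p` over the elements of a finite set of integers in a residue class. -/
def classSum (u : ZMod l) (s : Finset ℤ) (p : Polynomial ℂ) : ℂ :=
  ∑ j ∈ s.filter (fun j : ℤ => (j : ZMod l) = u), p.eval (j : ℂ)

lemma filter_Ico_add_eq_singleton (s : ℤ) :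
    (Finset.Ico s (s + l)).filter (fun j : ℤ => (j : ZMod l) = (s : ZMod l)) = {s} := by
  have hl : (0 : ℤ) < l := Int.natCast_pos.2 (NeZero.pos l)
  ext j
  simp only [Finset.mem_filter, Finset.mem_Ico, Finset.mem_singleton]
  constructor
  · rintro ⟨⟨h1, h2⟩, h3⟩
    rw [ZMod.intCast_eq_intCast_iff_dvd_sub] at h3
    have h4 : s - j = 0 := by
      refine Int.eq_zero_of_abs_lt_dvd h3 ?_
      rw [abs_lt]; constructor <;> linarith
    linarith
  · rintro rfl
    exact ⟨⟨le_rfl, by linarith⟩, rfl⟩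

lemma regSum_sub_regSum_add_mul (s : ℤ) (n : ℕ) (p : Polynomial ℂ) :
    regSum l s p - regSum l ((s + l * n : ℤ) : ℚ) p = classSum (s : ZMod l) (Finset.Ico s (s + l * n)) p := by
  have hl : (0 : ℤ) < l := Int.natCast_pos.2 (NeZero.pos l)
  induction n with
  | zero => simp [classSum]
  | succ n ih =>
    have h1 := regSum_sub_regSum_add (l := l) ((s + l * n : ℤ) : ℚ) p
    have h2 : (((s + l * n : ℤ) : ℚ) + l) = ((s + l * (n + 1 : ℕ) : ℤ) : ℚ) := by push_cast; ring
    rw [h2] at h1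
    have h3 : Finset.Ico s (s + l * (n + 1 : ℕ)) =
        Finset.Ico s (s + l * n) ∪ Finset.Ico (s + l * n) (s + l * n + l) := by
      rw [Finset.Ico_union_Ico_eq_Ico]
      · congr 1; push_cast; ring
      · nlinarith [Int.natCast_nonneg n]
      · linarith
    have hc : ((s + l * n : ℤ) : ZMod l) = (s : ZMod l) := by push_cast; simp
    have h4 : classSum (s : ZMod l) (Finset.Ico (s + l * n) (s + l * n + l)) p =
        p.eval ((s + l * n : ℤ) : ℂ) := by
      rw [classSum, ← hc, filter_Ico_add_eq_singleton, Finset.sum_singleton]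
    rw [h3, classSum, Finset.filter_union, Finset.sum_union, ← classSum, ← classSum, h4, ← ih]
    · rw [Rat.cast_intCast] at h1
      linear_combination h1
    · exact Finset.disjoint_filter_filter (Finset.Ico_disjoint_Ico_consecutive _ _ _)

lemma regSum_sub_regSum {s t : ℤ} (h : s ≤ t) (hst : (s : ZMod l) = t) (p : Polynomial ℂ) :
    regSum l s p - regSum l t p = classSum (s : ZMod l) (Finset.Ico s t) p := by
  rw [ZMod.intCast_eq_intCast_iff_dvd_sub] at hst
  obtain ⟨c, hc⟩ := hst
  have hl : (0 : ℤ) < l := Int.natCast_pos.2 (NeZero.pos l)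
  have hc0 : 0 ≤ c := by
    by_contra hneg
    nlinarith
  obtain ⟨n, rfl⟩ := Int.eq_ofNat_of_zero_le hc0
  obtain rfl : t = s + l * n := by linarith
  exact regSum_sub_regSum_add_mul s n p

lemma le_of_sub_lt_of_intCast_eq {j k : ℤ} (h : (j : ZMod l) = k) (hlt : k - l < j) : k ≤ j := by
  rw [ZMod.intCast_eq_intCast_iff_dvd_sub] at h
  obtain ⟨c, hc⟩ := h
  have hl : (0 : ℤ) < l := Int.natCast_pos.2 (NeZero.pos l)
  have : c < 1 := by nlinarith
  nlinarith

/-- The integers strictly between `0` and `e`. -/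
def strictBetween (e : ℤ) : Finset ℤ := Finset.Ioo (min 0 e) (max 0 e)

lemma polyIntegral_neg (c : ℂ) (p : Polynomial ℂ) :
    polyIntegral c (Polynomial.aeval (-Polynomial.X : Polynomial ℂ) p) = -polyIntegral (-c) p := by
  have h : polyIntegral c ∘ₗ
      (Polynomial.aeval (R := ℂ) (-Polynomial.X : Polynomial ℂ)).toLinearMap = -polyIntegral (-c) := by
    refine polyLinearMap_ext fun n => ?_
    have e : (-Polynomial.X : Polynomial ℂ) ^ n = ((-1 : ℂ) ^ n) • Polynomial.X ^ n := by
      rw [← neg_one_smul ℂ (Polynomial.X : Polynomial ℂ), smul_pow]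
    simp only [LinearMap.neg_apply, LinearMap.comp_apply, AlgHom.toLinearMap_apply, map_pow,
      Polynomial.aeval_X, e, map_smul, smul_eq_mul]
    simp only [polyIntegral, polyFunctional_X_pow]
    rw [neg_pow c]
    ring
  exact LinearMap.congr_fun h p

lemma classSum_congr {u : ZMod l} {s t : Finset ℤ}
    (h : ∀ j : ℤ, (j : ZMod l) = u → (j ∈ s ↔ j ∈ t)) (p : Polynomial ℂ) :
    classSum u s p = classSum u t p := by
  rw [classSum, classSum]
  refine Finset.sum_congr ?_ fun _ _ => rfl
  ext j
  simp only [Finset.mem_filter]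
  exact ⟨fun hj => ⟨(h j hj.2).1 hj.1, hj.2⟩, fun hj => ⟨(h j hj.2).2 hj.1, hj.2⟩⟩

lemma classSum_Icc (u : ZMod l) {e : ℤ} (he : 0 < e) (p : Polynomial ℂ) :
    classSum u (Finset.Icc 0 e) p = classSum u (Finset.Ioo 0 e) p +
      (if u = 0 then p.eval 0 else 0) + (if (e : ZMod l) = u then p.eval (e : ℂ) else 0) := by
  simp only [classSum, Finset.sum_filter]
  rw [← Finset.Ico_insert_right he.le, Finset.sum_insert (by simp), ← Finset.Ioo_insert_left he,
    Finset.sum_insert (by simp)]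
  simp only [Int.cast_zero, eq_comm (a := (0 : ZMod l))]
  ring

/-- A form of Faulhaber's formula: the regularized sums over two complementary half-lines in a
residue class differ from a finite sum by an integral. -/
lemma regConst_add_regConst {u w : ZMod l} {e : ℤ} (he : e ≠ 0) (h : u + w = e)
    (p : Polynomial ℂ) :
    regConst u p + regConst w (Polynomial.aeval (Polynomial.C (e : ℂ) - Polynomial.X) p) =
      e.sign * classSum u (strictBetween e) p + e.sign / 2 * ((if u = 0 then p.eval 0 else 0) +
        (if w = 0 then p.eval (e : ℂ) else 0)) - (l : ℂ)⁻¹ * polyIntegral e p := by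
  have hl : (0 : ℤ) < l := Int.natCast_pos.2 (NeZero.pos l)
  set g : Polynomial ℂ := Polynomial.aeval (-Polynomial.X : Polynomial ℂ) p with hg
  have hq : Polynomial.aeval (Polynomial.C (e : ℂ) - Polynomial.X) p =
      Polynomial.aeval (Polynomial.X + Polynomial.C (((-e : ℤ) : ℚ) : ℂ)) g := by
    rw [hg, ← Polynomial.aeval_algHom_apply]
    congr 2
    simp [sub_eq_add_neg]
  have h1 := regSum_add (l := l) (w.val : ℚ) ((-e : ℤ) : ℚ) g
  rw [← hq, hg, polyIntegral_neg, ← hg] at h1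
  -- This `t` lies in the class of `u`, and `l - t = w.val - e`, so the half-line of `w` reflected
  -- through `e` completes the one starting at `t` to a full class.
  set t : ℤ := l - w.val + e with ht
  have h2 := regSum_add_regSum_neg (l := l) (t : ℚ) p
  have h3 : (l : ℚ) - t = w.val + ((-e : ℤ) : ℚ) := by rw [ht]; push_cast; ring
  rw [h3, ← hg] at h2
  have h4 : ((-(((-e : ℤ) : ℚ) : ℂ)) : ℂ) = e := by push_cast; ring
  rw [h4] at h1
  have hq0 : (Polynomial.aeval (Polynomial.C (e : ℂ) - Polynomial.X) p).eval 0 = p.eval (e : ℂ) := by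
    rw [← Polynomial.coe_aeval_eq_eval, ← Polynomial.aeval_algHom_apply, ← Polynomial.coe_aeval_eq_eval]
    simp
  have hu0 : ((u.val : ℤ) : ZMod l) = u := by simp
  have hw0 : ((w.val : ℤ) : ZMod l) = w := by simp
  have htu : (t : ZMod l) = u := by
    rw [ht]; push_cast; rw [← h]; simp
  have hul : (u.val : ℤ) < l := by exact_mod_cast ZMod.val_lt u
  have hwl : (w.val : ℤ) < l := by exact_mod_cast ZMod.val_lt w
  have hun : (0 : ℤ) ≤ u.val := Int.natCast_nonneg _
  have hwn : (0 : ℤ) ≤ w.val := Int.natCast_nonneg _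
  have hew : (e : ZMod l) = u ↔ w = 0 := by
    rw [← h]; simp
  rw [regConst_eq, regConst_eq, hq0]
  -- For `e > 0` the half-lines overlap in the closed interval from `0` to `e`, and the half weights
  -- at its ends turn full contributions into halves. For `e < 0` they miss the open interval, and
  -- the halves enter with a minus sign.
  rcases lt_or_gt_of_ne he with hneg | hpos
  · have hle : t ≤ u.val := le_of_sub_lt_of_intCast_eq (hu0.trans htu.symm) (by omega)
    have h5 := regSum_sub_regSum (l := l) hle (htu.trans hu0.symm) p
    have h6 : classSum (t : ZMod l) (Finset.Ico t u.val) p = classSum u (strictBetween e) p := by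
      rw [htu]
      refine classSum_congr (fun j hj => ?_) p
      rw [strictBetween, min_eq_right hneg.le, max_eq_left hneg.le, Finset.mem_Ico, Finset.mem_Ioo]
      constructor
      · rintro ⟨ha, hb⟩
        refine ⟨by omega, ?_⟩
        by_contra hc
        have := le_of_sub_lt_of_intCast_eq (hj.trans hu0.symm) (by omega)
        omega
      · rintro ⟨ha, hb⟩
        exact ⟨le_of_sub_lt_of_intCast_eq (hj.trans htu.symm) (by omega), by omega⟩
    rw [h6] at h5
    rw [Int.sign_eq_neg_one_of_neg hneg]
    push_cast at h5 h1 h2 ⊢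
    split_ifs <;> linear_combination h2 - h1 - h5
  · have hle : (u.val : ℤ) ≤ t := le_of_sub_lt_of_intCast_eq (htu.trans hu0.symm) (by omega)
    have h5 := regSum_sub_regSum (l := l) hle (hu0.trans htu.symm) p
    have h6 : classSum ((u.val : ℤ) : ZMod l) (Finset.Ico (u.val : ℤ) t) p =
        classSum u (Finset.Icc 0 e) p := by
      rw [hu0]
      refine classSum_congr (fun j hj => ?_) p
      rw [Finset.mem_Ico, Finset.mem_Icc]
      constructor
      · rintro ⟨ha, hb⟩
        refine ⟨by omega, ?_⟩
        by_contra hc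
        have := le_of_sub_lt_of_intCast_eq (hj.trans htu.symm) (by omega)
        omega
      · rintro ⟨ha, hb⟩
        exact ⟨le_of_sub_lt_of_intCast_eq (hj.trans hu0.symm) (by omega), by omega⟩
    rw [h6, classSum_Icc u hpos] at h5
    rw [Int.sign_eq_one_of_pos hpos, strictBetween, min_eq_left hpos.le, max_eq_right hpos.le]
    simp only [hew] at h5
    push_cast at h5 h1 h2 ⊢
    split_ifs at h5 ⊢ <;> linear_combination h2 - h1 + h5

end ToricForms

namespace ToricForms

open Filter Topology
open scoped Nat

/-! ### Sums over pairs of integers of the same sign -/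

/-- A sign times `q ^ (d n)`, for pairs `(d, n)` with `d n > 0` and `d ≡ v`. -/
def signWeight {l : ℕ} (τ : ℍ) (v : ZMod l) (x : ℤ × ℤ) : ℂ :=
  if 0 < x.1 * x.2 ∧ (x.1 : ZMod l) = v then x.1.sign * ex τ ^ (x.1 * x.2) else 0

/-- The weighted sum of `g` over pairs of integers of the same sign. -/
def latSum {l : ℕ} (τ : ℍ) (v : ZMod l) (g : ℤ × ℤ → ℂ) : ℂ := ∑' x, signWeight τ v x * g x

/-- Polynomial growth on the pairs of integers of the same sign. -/
def LatBounded (g : ℤ × ℤ → ℂ) : Prop :=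
  ∃ (A : ℝ) (B : ℕ), ∀ x : ℤ × ℤ, 0 < x.1 * x.2 → ‖g x‖ ≤ A * ((x.1 * x.2 : ℤ) : ℝ) ^ B

/-- The two quadrants of pairs of integers of the same sign. -/
def quadrants : (ℕ+ × ℕ+) ⊕ (ℕ+ × ℕ+) → ℤ × ℤ :=
  Sum.elim (fun p => ((p.1 : ℤ), (p.2 : ℤ))) (fun p => (-(p.1 : ℤ), -(p.2 : ℤ)))

lemma quadrants_injective : Function.Injective quadrants := by
  rintro (⟨a, b⟩ | ⟨a, b⟩) (⟨c, d⟩ | ⟨c, d⟩) h <;>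
    simp only [quadrants, Sum.elim_inl, Sum.elim_inr, Prod.mk.injEq] at h <;>
    obtain ⟨h1, h2⟩ := h
  · obtain rfl : a = c := PNat.eq (by exact_mod_cast h1)
    obtain rfl : b = d := PNat.eq (by exact_mod_cast h2)
    rfl
  · have := a.pos; have := c.pos; omega
  · have := a.pos; have := c.pos; omega
  · obtain rfl : a = c := PNat.eq (by exact_mod_cast neg_injective h1)
    obtain rfl : b = d := PNat.eq (by exact_mod_cast neg_injective h2)
    rfl

lemma mem_range_quadrants {x : ℤ × ℤ} (hx : 0 < x.1 * x.2) : x ∈ Set.range quadrants := by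
  obtain ⟨a, b⟩ := x
  rcases pos_and_pos_or_neg_and_neg_of_mul_pos hx with ⟨h1, h2⟩ | ⟨h1, h2⟩
  · refine ⟨Sum.inl (⟨a.toNat, by simpa using h1⟩, ⟨b.toNat, by simpa using h2⟩), ?_⟩
    have h1' : (0 : ℤ) < a := h1
    have h2' : (0 : ℤ) < b := h2
    simp [quadrants, h1'.le, h2'.le]
  · refine ⟨Sum.inr (⟨(-a).toNat, by simpa using h1⟩, ⟨(-b).toNat, by simpa using h2⟩), ?_⟩
    have h1' : a < 0 := h1
    have h2' : b < 0 := h2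
    simp [quadrants, h1'.le, h2'.le]

lemma hasSum_quadrants {E : Type*} [NormedAddCommGroup E] {f : ℤ × ℤ → E}
    (hf : ∀ x : ℤ × ℤ, ¬ 0 < x.1 * x.2 → f x = 0) {s t : E}
    (hs : HasSum (fun p : ℕ+ × ℕ+ => f ((p.1 : ℤ), (p.2 : ℤ))) s)
    (ht : HasSum (fun p : ℕ+ × ℕ+ => f (-(p.1 : ℤ), -(p.2 : ℤ))) t) : HasSum f (s + t) := by
  refine (quadrants_injective.hasSum_iff fun x hx => hf x fun h => hx (mem_range_quadrants h)).1 ?_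
  exact HasSum.sum hs ht

/-- Write `ρ = r²`: one factor `r ^ (d n)` absorbs the polynomial, the other gives convergence. -/
lemma summable_mul_pow_mul_pow (B : ℕ) {ρ : ℝ} (h0 : 0 ≤ ρ) (h1 : ρ < 1) :
    Summable fun p : ℕ+ × ℕ+ => (((p.1 : ℕ) * p.2 : ℕ) : ℝ) ^ B * ρ ^ ((p.1 : ℕ) * p.2) := by
  obtain ⟨r, hr0, rfl⟩ : ∃ r : ℝ, 0 ≤ r ∧ r * r = ρ := ⟨√ρ, Real.sqrt_nonneg _, Real.mul_self_sqrt h0⟩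
  have hr1 : r < 1 := by nlinarith
  have hlim : Tendsto (fun n : ℕ => (n : ℝ) ^ B * r ^ n) atTop (𝓝 0) :=
    tendsto_pow_const_mul_const_pow_of_abs_lt_one B (by rwa [abs_of_nonneg hr0])
  obtain ⟨A, hA⟩ := hlim.bddAbove_range
  have hs := summable_pow_mul_pow (A := 1) (ρ := r) le_rfl hr0 (by linarith)
  refine Summable.of_nonneg_of_le (fun p => by positivity) (fun p => ?_) (hs.mul_left A)
  have : (((p.1 : ℕ) * p.2 : ℕ) : ℝ) ^ B * r ^ ((p.1 : ℕ) * p.2) ≤ A :=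
    hA (Set.mem_range_self ((p.1 : ℕ) * (p.2 : ℕ)))
  rw [mul_pow, ← mul_assoc, one_pow, one_mul]
  exact mul_le_mul_of_nonneg_right this (by positivity)

variable {l : ℕ} {τ : ℍ}

lemma signWeight_of_not {v : ZMod l} {x : ℤ × ℤ} (hx : ¬ 0 < x.1 * x.2) : signWeight τ v x = 0 :=
  if_neg fun h => hx h.1

lemma norm_signWeight_le (v : ZMod l) (x : ℤ × ℤ) : ‖signWeight τ v x‖ ≤ ‖ex τ‖ ^ (x.1 * x.2) := by
  rw [signWeight]
  split_ifs with h
  · rw [norm_mul, norm_zpow]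
    have : ‖((x.1.sign : ℤ) : ℂ)‖ ≤ 1 := by
      rw [Complex.norm_intCast]
      rcases lt_trichotomy x.1 0 with h | h | h
      · simp [Int.sign_eq_neg_one_of_neg h]
      · simp [h]
      · simp [Int.sign_eq_one_of_pos h]
    exact mul_le_of_le_one_left (by positivity) this
  · rw [norm_zero]; positivity

lemma signWeight_neg (v : ZMod l) (x : ℤ × ℤ) : signWeight τ (-v) (-x) = -signWeight τ v x := by
  simp only [signWeight, Prod.fst_neg, Prod.snd_neg, neg_mul_neg, Int.cast_neg, neg_inj,
    Int.sign_neg]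
  split_ifs <;> simp

lemma norm_signWeight_mul_le {g : ℤ × ℤ → ℂ} {A : ℝ} {B : ℕ}
    (hg : ∀ x : ℤ × ℤ, 0 < x.1 * x.2 → ‖g x‖ ≤ A * ((x.1 * x.2 : ℤ) : ℝ) ^ B) (v : ZMod l)
    {x : ℤ × ℤ} (hx : 0 < x.1 * x.2) : ‖signWeight τ v x * g x‖ ≤
      A * (((x.1 * x.2 : ℤ) : ℝ) ^ B * ‖ex τ‖ ^ (x.1 * x.2)) := by
  rw [norm_mul]
  refine (mul_le_mul (norm_signWeight_le v x) (hg x hx) (norm_nonneg _) (by positivity)).trans_eq ?_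
  ring

lemma summable_pos_signWeight {g : ℤ × ℤ → ℂ} (hg : LatBounded g) (v : ZMod l) :
    Summable fun p : ℕ+ × ℕ+ => signWeight τ v ((p.1 : ℤ), (p.2 : ℤ)) * g ((p.1 : ℤ), (p.2 : ℤ)) := by
  obtain ⟨A, B, h⟩ := hg
  refine Summable.of_norm_bounded
    ((summable_mul_pow_mul_pow B (norm_nonneg _) (norm_ex_lt_one τ)).mul_left A) fun p => ?_
  have hp : 0 < ((p.1 : ℤ), (p.2 : ℤ)).1 * ((p.1 : ℤ), (p.2 : ℤ)).2 := by
    have h1 := p.1.pos; have h2 := p.2.pos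
    positivity
  refine (norm_signWeight_mul_le h v hp).trans_eq ?_
  simp only
  rw [← Nat.cast_mul, zpow_natCast, Int.cast_natCast]

lemma LatBounded.comp_neg {g : ℤ × ℤ → ℂ} (hg : LatBounded g) : LatBounded fun x => g (-x) := by
  obtain ⟨A, B, h⟩ := hg
  refine ⟨A, B, fun x hx => ?_⟩
  simpa using h (-x) (by simpa using hx)

lemma summable_neg_signWeight {g : ℤ × ℤ → ℂ} (hg : LatBounded g) (v : ZMod l) :
    Summable fun p : ℕ+ × ℕ+ => signWeight τ v (-(p.1 : ℤ), -(p.2 : ℤ)) *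
      g (-(p.1 : ℤ), -(p.2 : ℤ)) := by
  refine ((summable_pos_signWeight hg.comp_neg (-v) (τ := τ)).neg).congr fun p => ?_
  have := signWeight_neg (τ := τ) v (-(p.1 : ℤ), -(p.2 : ℤ))
  simp only [Prod.neg_mk, neg_neg] at this
  rw [this]
  simp

lemma hasSum_signWeight {g : ℤ × ℤ → ℂ} (hg : LatBounded g) (v : ZMod l) :
    HasSum (fun x => signWeight τ v x * g x)
      ((∑' p : ℕ+ × ℕ+, signWeight τ v ((p.1 : ℤ), (p.2 : ℤ)) * g ((p.1 : ℤ), (p.2 : ℤ))) +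
       ∑' p : ℕ+ × ℕ+, signWeight τ v (-(p.1 : ℤ), -(p.2 : ℤ)) * g (-(p.1 : ℤ), -(p.2 : ℤ))) :=
  hasSum_quadrants (fun x hx => by rw [signWeight_of_not hx, zero_mul])
    (summable_pos_signWeight hg v).hasSum (summable_neg_signWeight hg v).hasSum

lemma summable_signWeight {g : ℤ × ℤ → ℂ} (hg : LatBounded g) (v : ZMod l) :
    Summable fun x => signWeight τ v x * g x := (hasSum_signWeight hg v).summable

lemma latSum_eq {g : ℤ × ℤ → ℂ} (hg : LatBounded g) (v : ZMod l) :
    latSum τ v g = ∑' p : ℕ+ × ℕ+, (resInd v p.1 * g ((p.1 : ℤ), (p.2 : ℤ)) -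
      resInd (-v) p.1 * g (-(p.1 : ℤ), -(p.2 : ℤ))) * ex τ ^ ((p.1 : ℕ) * p.2) := by
  rw [latSum, (hasSum_signWeight hg v).tsum_eq,
    ← (summable_pos_signWeight hg v).tsum_add (summable_neg_signWeight hg v)]
  refine tsum_congr fun p => ?_
  have h1 : (0 : ℤ) < p.1 := by exact_mod_cast p.1.pos
  have h2 : (0 : ℤ) < p.2 := by exact_mod_cast p.2.pos
  have h3 := mul_pos h1 h2
  have h4 : ex τ ^ ((p.1 : ℤ) * (p.2 : ℤ)) = ex τ ^ ((p.1 : ℕ) * p.2) := by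
    rw [← zpow_natCast]; push_cast; rfl
  simp only [signWeight, neg_mul_neg, h3, true_and, resInd, Int.sign_neg, Int.sign_eq_one_of_pos h1,
    h4, Int.cast_neg, neg_eq_iff_eq_neg]
  split_ifs <;> simp <;> ring

lemma LatBounded.add {g h : ℤ × ℤ → ℂ} (hg : LatBounded g) (hh : LatBounded h) :
    LatBounded fun x => g x + h x := by
  obtain ⟨A, B, hA⟩ := hg
  obtain ⟨A', B', hA'⟩ := hh
  refine ⟨|A| + |A'|, B + B', fun x hx => (norm_add_le _ _).trans ?_⟩
  have h1 : (1 : ℝ) ≤ ((x.1 * x.2 : ℤ) : ℝ) := by exact_mod_cast hx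
  rw [add_mul]
  refine add_le_add ((hA x hx).trans ?_) ((hA' x hx).trans ?_)
  · exact mul_le_mul (le_abs_self _) (pow_le_pow_right₀ h1 (by omega)) (by positivity)
      (abs_nonneg _)
  · exact mul_le_mul (le_abs_self _) (pow_le_pow_right₀ h1 (by omega)) (by positivity)
      (abs_nonneg _)

lemma LatBounded.mul {g h : ℤ × ℤ → ℂ} (hg : LatBounded g) (hh : LatBounded h) :
    LatBounded fun x => g x * h x := by
  obtain ⟨A, B, hA⟩ := hg
  obtain ⟨A', B', hA'⟩ := hh
  refine ⟨A * A', B + B', fun x hx => ?_⟩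
  rw [norm_mul]
  refine (mul_le_mul (hA x hx) (hA' x hx) (norm_nonneg _)
    ((norm_nonneg _).trans (hA x hx))).trans_eq (by ring)

lemma LatBounded.const (c : ℂ) : LatBounded fun _ => c := ⟨‖c‖, 0, fun x _ => by simp⟩

lemma LatBounded.sum {ι : Type*} (s : Finset ι) {g : ι → ℤ × ℤ → ℂ}
    (hg : ∀ i ∈ s, LatBounded (g i)) : LatBounded fun x => ∑ i ∈ s, g i x := by
  classical
  induction s using Finset.induction_on with
  | empty => simpa using LatBounded.const 0
  | insert i s hi ih =>
    simp only [Finset.sum_insert hi]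
    exact (hg i (Finset.mem_insert_self _ _)).add
      (ih fun j hj => hg j (Finset.mem_insert_of_mem hj))

lemma latBounded_fst : LatBounded fun x => (x.1 : ℂ) := by
  refine ⟨1, 1, fun x hx => ?_⟩
  rw [Complex.norm_intCast, one_mul, pow_one, ← abs_of_pos (a := ((x.1 * x.2 : ℤ) : ℝ))
    (by exact_mod_cast hx), Int.cast_mul, abs_mul]
  have h2 : x.2 ≠ 0 := fun h => by simp [h] at hx
  have : (1 : ℝ) ≤ |(x.2 : ℝ)| := by exact_mod_cast Int.one_le_abs h2
  exact le_mul_of_one_le_right (abs_nonneg _) this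

lemma latBounded_snd : LatBounded fun x => (x.2 : ℂ) := by
  refine ⟨1, 1, fun x hx => ?_⟩
  rw [Complex.norm_intCast, one_mul, pow_one, ← abs_of_pos (a := ((x.1 * x.2 : ℤ) : ℝ))
    (by exact_mod_cast hx), Int.cast_mul, abs_mul]
  have h2 : x.1 ≠ 0 := fun h => by simp [h] at hx
  have : (1 : ℝ) ≤ |(x.1 : ℝ)| := by exact_mod_cast Int.one_le_abs h2
  exact le_mul_of_one_le_left (abs_nonneg _) this

lemma latBounded_sign : LatBounded fun x => ((x.1.sign : ℤ) : ℂ) := by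
  refine ⟨1, 0, fun x hx => ?_⟩
  rw [Complex.norm_intCast, pow_zero, mul_one]
  rcases lt_trichotomy x.1 0 with h | h | h
  · simp [Int.sign_eq_neg_one_of_neg h]
  · simp [h]
  · simp [Int.sign_eq_one_of_pos h]

lemma LatBounded.pow {g : ℤ × ℤ → ℂ} (hg : LatBounded g) (n : ℕ) : LatBounded fun x => g x ^ n := by
  induction n with
  | zero => simpa using LatBounded.const 1
  | succ n ih => simpa only [pow_succ] using ih.mul hg

lemma latSum_add {g h : ℤ × ℤ → ℂ} (hg : LatBounded g) (hh : LatBounded h) (v : ZMod l) :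
    latSum τ v (fun x => g x + h x) = latSum τ v g + latSum τ v h := by
  simp only [latSum, mul_add]
  exact (summable_signWeight hg v).tsum_add (summable_signWeight hh v)

lemma latSum_const_mul (c : ℂ) (g : ℤ × ℤ → ℂ) (v : ZMod l) :
    latSum τ v (fun x => c * g x) = c * latSum τ v g := by
  simp only [latSum, mul_left_comm _ c, tsum_mul_left]

lemma latSum_sum {ι : Type*} (s : Finset ι) {g : ι → ℤ × ℤ → ℂ}
    (hg : ∀ i ∈ s, LatBounded (g i)) (v : ZMod l) :
    latSum τ v (fun x => ∑ i ∈ s, g i x) = ∑ i ∈ s, latSum τ v (g i) := by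
  simp only [latSum, Finset.mul_sum]
  exact Summable.tsum_finsetSum fun i hi => summable_signWeight (hg i hi) v

lemma latSum_neg (v : ZMod l) (g : ℤ × ℤ → ℂ) :
    latSum τ (-v) g = -latSum τ v (fun x => g (-x)) := by
  rw [latSum, latSum, ← tsum_neg, ← (Equiv.neg (ℤ × ℤ)).tsum_eq]
  refine tsum_congr fun x => ?_
  rw [Equiv.neg_apply, signWeight_neg, neg_mul]

lemma latSum_congr {v : ZMod l} {g h : ℤ × ℤ → ℂ}
    (hgh : ∀ x : ℤ × ℤ, 0 < x.1 * x.2 → (x.1 : ZMod l) = v → g x = h x) :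
    latSum τ v g = latSum τ v h := by
  refine tsum_congr fun x => ?_
  by_cases hx : 0 < x.1 * x.2 ∧ (x.1 : ZMod l) = v
  · rw [hgh x hx.1 hx.2]
  · rw [signWeight, if_neg hx, zero_mul, zero_mul]

/-- The quadrant of negative pairs supplies the `-a` term: `sign (-d) (-d)^k` accounts for the
factor `(-1)^(k+1)`. -/
theorem stildeTail_eq_latSum [NeZero l] (k : ℕ) (v : ZMod l) :
    stildeTail l (k + 1) v τ = latSum τ v fun x => (x.1 : ℂ) ^ k := by
  rw [stildeTail_succ, latSum_eq (latBounded_fst.pow k)]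
  refine tsum_congr fun p => ?_
  congr 1
  push_cast
  rw [neg_pow ((p.1 : ℕ) : ℂ)]
  ring

theorem dtau_stilde_eq_latSum [NeZero l] (k : ℕ) (v : ZMod l) :
    dtau (stilde l (k + 1) v) τ =
      2 * Real.pi * I * latSum τ v fun x => (x.1 : ℂ) ^ (k + 1) * x.2 := by
  rw [dtau_stilde]
  generalize (2 * Real.pi * I : ℂ) = t
  rw [latSum_eq ((latBounded_fst.pow (k + 1)).mul latBounded_snd), ← tsum_mul_left]
  have hs : Summable fun p : ℕ+ × ℕ+ => (t * (((p.1 : ℕ) * p.2 : ℕ) : ℂ) *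
      (((p.1 : ℕ) : ℂ) ^ k * (resInd v p.1 + (-1) ^ (k + 1) * resInd (-v) p.1))) *
      ex τ ^ ((p.1 : ℕ) * p.2) := by
    refine Summable.of_norm_bounded ((summable_mul_pow_mul_pow (k + 1) (norm_nonneg _)
      (norm_ex_lt_one τ)).mul_left (‖t‖ * 2)) fun p => ?_
    have h1 : ‖resInd v p.1 + (-1) ^ (k + 1) * resInd (-v) p.1‖ ≤ 2 := by
      refine (norm_add_le _ _).trans ?_
      rw [norm_mul, norm_pow, norm_neg, norm_one, one_pow, one_mul]
      linarith [norm_resInd_le v p.1, norm_resInd_le (-v) p.1]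
    have h2 : ((p.1 : ℕ) : ℝ) ^ k ≤ (((p.1 : ℕ) * p.2 : ℕ) : ℝ) ^ k :=
      pow_le_pow_left₀ (Nat.cast_nonneg _)
        (by exact_mod_cast Nat.le_mul_of_pos_right _ p.2.pos) _
    rw [norm_mul, norm_mul, norm_mul t, norm_mul, norm_pow, norm_pow,
      Complex.norm_natCast, Complex.norm_natCast, ← mul_assoc (‖t‖ * 2)]
    refine mul_le_mul_of_nonneg_right ?_ (pow_nonneg (norm_nonneg (ex τ)) _)
    calc _ ≤ ‖t‖ * (((p.1 : ℕ) * p.2 : ℕ) : ℝ) *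
          ((((p.1 : ℕ) * p.2 : ℕ) : ℝ) ^ k * 2) := by gcongr
      _ = _ := by ring
  have h := tsum_pnat_divisors (τ := τ) (f := fun d n => t * ((d * n : ℕ) : ℂ) *
      ((d : ℂ) ^ k * (resInd v d + (-1) ^ (k + 1) * resInd (-v) d))) hs
  refine Eq.trans ?_ (h.trans ?_)
  · rw [qTail]
    refine tsum_congr fun n => ?_
    congr 1
    rw [stildeCoeff, Finset.mul_sum]
    refine Finset.sum_congr rfl fun d hd => ?_
    rw [Nat.mul_div_cancel' (Nat.dvd_of_mem_divisors hd)]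
    simp [resInd]
  · refine tsum_congr fun p => ?_
    push_cast
    rw [neg_pow ((p.1 : ℕ) : ℂ)]
    ring

end ToricForms

namespace ToricForms

open Filter Topology
open scoped Nat

/-! ### Homogeneous polynomials in two variables -/

lemma eq_sum_of_isHomogeneous {P : MvPolynomial (Fin 2) ℂ} {K : ℕ} (hP : P.IsHomogeneous K) :
    P = ∑ p ∈ Finset.HasAntidiagonal.antidiagonal K,
      MvPolynomial.coeff (Finsupp.single 0 p.1 + Finsupp.single 1 p.2) P •
        ((X 0 : MvPolynomial (Fin 2) ℂ) ^ p.1 * X 1 ^ p.2) := by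
  have hmon : ∀ p : ℕ × ℕ, (X 0 : MvPolynomial (Fin 2) ℂ) ^ p.1 * X 1 ^ p.2 =
      monomial (Finsupp.single 0 p.1 + Finsupp.single 1 p.2) 1 := by
    intro p
    rw [X_pow_eq_monomial, X_pow_eq_monomial, monomial_mul, one_mul]
  have hd : ∀ d : Fin 2 →₀ ℕ, d = Finsupp.single 0 (d 0) + Finsupp.single 1 (d 1) := by
    intro d
    ext i
    fin_cases i <;> simp
  ext d
  simp only [coeff_sum, coeff_smul, smul_eq_mul, hmon, coeff_monomial]
  have hinj : ∀ p : ℕ × ℕ, Finsupp.single (0 : Fin 2) p.1 + Finsupp.single 1 p.2 = d ↔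
      p = (d 0, d 1) := by
    intro p
    constructor
    · rintro rfl
      simp
    · rintro rfl
      exact (hd d).symm
  simp only [hinj, mul_ite, mul_one, mul_zero]
  rw [Finset.sum_ite_eq' (Finset.HasAntidiagonal.antidiagonal K) (d 0, d 1)
    fun p => MvPolynomial.coeff (Finsupp.single 0 p.1 + Finsupp.single 1 p.2) P]
  simp only [← hd d]
  split_ifs with h
  · rfl
  · by_contra hne
    have h1 := hP hne
    rw [Finset.HasAntidiagonal.mem_antidiagonal] at h
    refine h ?_
    rw [← h1, Finsupp.weight_apply, Finsupp.sum_fintype _ _ (by simp)]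
    simp

lemma aeval_eq_sum {P : MvPolynomial (Fin 2) ℂ} {K : ℕ} (hP : P.IsHomogeneous K)
    {A : Type*} [CommRing A] [Algebra ℂ A] (f g : A) :
    aeval ![f, g] P = ∑ p ∈ Finset.HasAntidiagonal.antidiagonal K,
      MvPolynomial.coeff (Finsupp.single 0 p.1 + Finsupp.single 1 p.2) P • (f ^ p.1 * g ^ p.2) := by
  conv_lhs => rw [eq_sum_of_isHomogeneous hP]
  simp

/-- The substitution `P(x, y) ↦ P(-y, x - y)`. -/
def rot (P : MvPolynomial (Fin 2) ℂ) : MvPolynomial (Fin 2) ℂ := aeval ![-y, x - y] P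

lemma aeval_rot {A : Type*} [CommRing A] [Algebra ℂ A] (f g : A) (P : MvPolynomial (Fin 2) ℂ) :
    aeval ![f, g] (rot P) = aeval ![-g, f - g] P := by
  have h : (aeval ![f, g]).comp (aeval ![-y, x - y]) =
      (aeval ![-g, f - g] : MvPolynomial (Fin 2) ℂ →ₐ[ℂ] A) := by
    ext i
    fin_cases i <;> simp
  exact DFunLike.congr_fun h P

lemma isHomogeneous_rot {P : MvPolynomial (Fin 2) ℂ} {K : ℕ} (hP : P.IsHomogeneous K) :
    (rot P).IsHomogeneous K := by
  have h := hP.aeval (n := 1) (![-y, x - y] : Fin 2 → MvPolynomial (Fin 2) ℂ) (fun i => by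
    fin_cases i
    · exact (isHomogeneous_X ℂ (1 : Fin 2)).neg
    · exact (isHomogeneous_X ℂ (0 : Fin 2)).sub (isHomogeneous_X ℂ (1 : Fin 2)))
  rwa [one_mul] at h

/-! ### Signs -/

/-- The possible signs of a sum of integers with given signs. -/
def SignAdd (s t r : SignType) : Prop := (s = t → r = s) ∧ (s = 0 → r = t) ∧ (t = 0 → r = s)

instance (s t r : SignType) : Decidable (SignAdd s t r) := by unfold SignAdd; infer_instance

lemma signAdd_sign (a b : ℤ) : SignAdd (SignType.sign a) (SignType.sign b) (SignType.sign (a + b)) := by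
  refine ⟨fun h => ?_, fun h => ?_, fun h => ?_⟩
  · rcases lt_trichotomy a 0 with ha | ha | ha
    · rw [sign_neg ha] at h ⊢
      have hb := sign_eq_neg_one_iff.1 h.symm
      exact sign_neg (by linarith)
    · subst ha
      rw [zero_add, h]
    · rw [sign_pos ha] at h ⊢
      have hb := sign_eq_one_iff.1 h.symm
      exact sign_pos (by linarith)
  · rw [sign_eq_zero_iff.1 h, zero_add]
  · rw [sign_eq_zero_iff.1 h, add_zero]

/-- The product of signs of `d` and `d'`, restricted to a generic configuration. -/
def genSign (sa sb sc sd sd' se : SignType) : SignType :=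
  if sd * sa = 1 ∧ sd' * sb = 1 ∧ sc ≠ 0 ∧ se ≠ 0 then sd * sd' else 0

set_option maxRecDepth 10000 in
-- The sign identity behind the three-term relation, a finite check over sign patterns. The
-- arguments are the signs of `a`, `b`, `a - b`, `d`, `d'`, `d + d'` and of their images under
-- `pairRot`; the hypotheses record `a = b + (a - b)` and the sum `d + d'`.
lemma genSign_cyclic : ∀ sa sb sc sd sd' se : SignType, SignAdd sb sc sa → SignAdd sd sd' se →
    (genSign sa sb sc sd sd' se : ℤ) + (genSign (-sc) (-sa) sb sd' (-se) (-sd) : ℤ) +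
      (genSign (-sb) sc (-sa) (-se) sd (-sd') : ℤ) = 0 := by
  decide

end ToricForms

namespace ToricForms

open Filter Topology
open scoped Nat

/-! ### Double sums -/

variable {l : ℕ} {τ : ℍ} {P : MvPolynomial (Fin 2) ℂ} {K : ℕ}

/-- The general term of the product of two series without constant terms. -/
def pairTerm (τ : ℍ) (u v : ZMod l) (P : MvPolynomial (Fin 2) ℂ) (z : (ℤ × ℤ) × (ℤ × ℤ)) : ℂ :=
  signWeight τ u z.1 * signWeight τ v z.2 * aeval ![(z.2.1 : ℂ), -(z.1.1 : ℂ)] P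

lemma pairTerm_eq (hP : P.IsHomogeneous K) (u v : ZMod l) (z : (ℤ × ℤ) × (ℤ × ℤ)) :
    pairTerm τ u v P z = ∑ p ∈ Finset.HasAntidiagonal.antidiagonal K,
      (MvPolynomial.coeff (Finsupp.single 0 p.1 + Finsupp.single 1 p.2) P * (-1) ^ p.2) *
        ((signWeight τ u z.1 * (z.1.1 : ℂ) ^ p.2) * (signWeight τ v z.2 * (z.2.1 : ℂ) ^ p.1)) := by
  rw [pairTerm, aeval_eq_sum hP, Finset.mul_sum]
  refine Finset.sum_congr rfl fun p _ => ?_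
  rw [neg_pow, smul_eq_mul]
  ring

lemma summable_signWeight_mul (u v : ZMod l) (m n : ℕ) :
    Summable fun z : (ℤ × ℤ) × (ℤ × ℤ) => (signWeight τ u z.1 * (z.1.1 : ℂ) ^ m) *
      (signWeight τ v z.2 * (z.2.1 : ℂ) ^ n) :=
  summable_mul_of_summable_norm (f := fun x : ℤ × ℤ => signWeight τ u x * (x.1 : ℂ) ^ m)
    (g := fun x : ℤ × ℤ => signWeight τ v x * (x.1 : ℂ) ^ n)
    (summable_signWeight (latBounded_fst.pow m) u).norm
    (summable_signWeight (latBounded_fst.pow n) v).norm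

lemma summable_pairTerm (hP : P.IsHomogeneous K) (u v : ZMod l) : Summable (pairTerm τ u v P) := by
  rw [show pairTerm τ u v P = _ from funext (pairTerm_eq hP u v)]
  exact summable_sum fun p _ => (summable_signWeight_mul u v p.2 p.1).mul_left _

lemma tsum_pairTerm [NeZero l] (hP : P.IsHomogeneous K) (u v : ZMod l) :
    ∑' z, pairTerm τ u v P z = ∑ p ∈ Finset.HasAntidiagonal.antidiagonal K,
      (MvPolynomial.coeff (Finsupp.single 0 p.1 + Finsupp.single 1 p.2) P * (-1) ^ p.2) *
        (stildeTail l (p.2 + 1) u τ * stildeTail l (p.1 + 1) v τ) := by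
  simp only [pairTerm_eq hP]
  have hs : ∀ p ∈ Finset.HasAntidiagonal.antidiagonal K, Summable fun z : (ℤ × ℤ) × (ℤ × ℤ) =>
      (MvPolynomial.coeff (Finsupp.single 0 p.1 + Finsupp.single 1 p.2) P * (-1) ^ p.2) *
        ((signWeight τ u z.1 * (z.1.1 : ℂ) ^ p.2) * (signWeight τ v z.2 * (z.2.1 : ℂ) ^ p.1)) :=
    fun p _ => (summable_signWeight_mul u v p.2 p.1).mul_left _
  rw [Summable.tsum_finsetSum hs]
  refine Finset.sum_congr rfl fun p _ => ?_
  rw [tsum_mul_left, stildeTail_eq_latSum, stildeTail_eq_latSum, latSum, latSum,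
    tsum_mul_tsum_of_summable_norm (f := fun x : ℤ × ℤ => signWeight τ u x * (x.1 : ℂ) ^ p.2)
    (g := fun x : ℤ × ℤ => signWeight τ v x * (x.1 : ℂ) ^ p.1) (summable_signWeight (latBounded_fst.pow p.2) u).norm
    (summable_signWeight (latBounded_fst.pow p.1) v).norm]

/-- The part of `pairTerm` away from the degenerate configurations. -/
def pairGeneric (τ : ℍ) (u v : ZMod l) (P : MvPolynomial (Fin 2) ℂ) (z : (ℤ × ℤ) × (ℤ × ℤ)) : ℂ :=
  if z.1.2 ≠ z.2.2 ∧ z.1.1 + z.2.1 ≠ 0 then pairTerm τ u v P z else 0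

lemma summable_ite_pairTerm (hP : P.IsHomogeneous K) (u v : ZMod l)
    (c : (ℤ × ℤ) × (ℤ × ℤ) → Prop) [DecidablePred c] :
    Summable fun z => if c z then pairTerm τ u v P z else 0 := by
  refine Summable.of_norm_bounded (summable_pairTerm (τ := τ) hP u v).norm fun z => ?_
  split_ifs
  · rfl
  · simp

/-- The two degenerate conditions never meet on the support: `a = b` and `d' = -d` make `d a` and
`d' b` opposite, so they cannot both be positive. -/
lemma tsum_pairTerm_eq_add (hP : P.IsHomogeneous K) (u v : ZMod l) :
    ∑' z, pairTerm τ u v P z = ∑' z, pairGeneric τ u v P z +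
      (∑' z, if z.1.2 = z.2.2 then pairTerm τ u v P z else 0) +
      ∑' z, if z.1.1 + z.2.1 = 0 then pairTerm τ u v P z else 0 := by
  have h1 : Summable (pairGeneric τ u v P) := summable_ite_pairTerm hP u v _
  have h2 := summable_ite_pairTerm (τ := τ) hP u v fun z => z.1.2 = z.2.2
  have h3 := summable_ite_pairTerm (τ := τ) hP u v fun z => z.1.1 + z.2.1 = 0
  rw [← h1.tsum_add h2, ← (h1.add h2).tsum_add h3]
  refine tsum_congr fun z => ?_
  by_cases ha : z.1.2 = z.2.2 <;> by_cases hb : z.1.1 + z.2.1 = 0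
  · have hz : pairTerm τ u v P z = 0 := by
      rw [pairTerm]
      by_cases h : 0 < z.1.1 * z.1.2
      · have h' : ¬ 0 < z.2.1 * z.2.2 := by
          rw [← ha, eq_neg_of_add_eq_zero_right hb]; linarith
        rw [signWeight_of_not h', mul_zero, zero_mul]
      · rw [signWeight_of_not h, zero_mul, zero_mul]
    simp [pairGeneric, hz]
  · simp [pairGeneric, ha, hb]
  · simp [pairGeneric, ha, hb]
  · simp [pairGeneric, ha, hb]

/-- A rotation of order three on pairs of pairs of integers. -/
def pairRot : (ℤ × ℤ) × (ℤ × ℤ) ≃ (ℤ × ℤ) × (ℤ × ℤ) where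
  toFun z := ((z.2.1, z.2.2 - z.1.2), (-z.1.1 - z.2.1, -z.1.2))
  invFun z := ((-z.2.1 - z.1.1, -z.2.2), (z.1.1, z.1.2 - z.2.2))
  left_inv := by rintro ⟨⟨a, b⟩, ⟨c, d⟩⟩; simp
  right_inv := by rintro ⟨⟨a, b⟩, ⟨c, d⟩⟩; simp

lemma pairGeneric_eq (u v : ZMod l) (d a d' b : ℤ) :
    pairGeneric τ u v P ((d, a), (d', b)) =
      if (d : ZMod l) = u ∧ (d' : ZMod l) = v then
        ((genSign (SignType.sign a) (SignType.sign b) (SignType.sign (a - b)) (SignType.sign d)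
          (SignType.sign d') (SignType.sign (d + d')) : ℤ) : ℂ) *
        (ex τ ^ (d * a + d' * b) * aeval ![(d' : ℂ), -(d : ℂ)] P) else 0 := by
  have h1 : 0 < d * a ↔ SignType.sign d * SignType.sign a = 1 := by
    rw [← sign_mul, sign_eq_one_iff]
  have h2 : 0 < d' * b ↔ SignType.sign d' * SignType.sign b = 1 := by
    rw [← sign_mul, sign_eq_one_iff]
  have h3 : a ≠ b ↔ SignType.sign (a - b) ≠ 0 := by
    rw [Ne, Ne, sign_eq_zero_iff, sub_eq_zero]
  have h4 : d + d' ≠ 0 ↔ SignType.sign (d + d') ≠ 0 := by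
    rw [Ne, Ne, sign_eq_zero_iff]
  rw [pairGeneric, pairTerm, genSign]
  simp only [signWeight, h1, h2, h3, h4, ite_and, zpow_add₀ (ex_ne_zero _)]
  split_ifs <;> (simp [Int.sign_eq_sign]; try ring)

/-- The rotation preserves `d a + d' b` and the joint residue condition, and `rot` compensates its
effect on the argument of `P`. The three terms thus share one factor and only signs remain. -/
lemma pairGeneric_cyclic {u v w : ZMod l} (h : u + v + w = 0) (z : (ℤ × ℤ) × (ℤ × ℤ)) :
    pairGeneric τ u v P z + pairGeneric τ v w (rot P) (pairRot z) +
      pairGeneric τ w u (rot (rot P)) (pairRot (pairRot z)) = 0 := by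
  obtain ⟨⟨d, a⟩, ⟨d', b⟩⟩ := z
  simp only [pairRot, Equiv.coe_fn_mk]
  rw [pairGeneric_eq, pairGeneric_eq, pairGeneric_eq, aeval_rot, aeval_rot, aeval_rot]
  have c2 : ((d' : ZMod l) = v ∧ ((-d - d' : ℤ) : ZMod l) = w) ↔
      ((d : ZMod l) = u ∧ (d' : ZMod l) = v) := by
    obtain rfl : w = -u - v := by linear_combination h
    push_cast
    constructor
    · rintro ⟨rfl, h2⟩
      exact ⟨by linear_combination -h2, rfl⟩
    · rintro ⟨rfl, rfl⟩
      exact ⟨rfl, rfl⟩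
  have c3 : (((-d - d' : ℤ) : ZMod l) = w ∧ ((-d' - (-d - d') : ℤ) : ZMod l) = u) ↔
      ((d : ZMod l) = u ∧ (d' : ZMod l) = v) := by
    obtain rfl : w = -u - v := by linear_combination h
    push_cast
    constructor
    · rintro ⟨h2, h3⟩
      exact ⟨by linear_combination h3, by linear_combination -h2 - h3⟩
    · rintro ⟨rfl, rfl⟩
      exact ⟨rfl, by ring⟩
  simp only [c2, c3]
  split_ifs
  · have hs := genSign_cyclic (SignType.sign a) (SignType.sign b) (SignType.sign (a - b))
      (SignType.sign d) (SignType.sign d') (SignType.sign (d + d'))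
      (by simpa using signAdd_sign b (a - b)) (signAdd_sign d d')
    have e1 : b - a - -a = b := by ring
    have e2 : d' + (-d - d') = -d := by ring
    have e3 : -a - (b - a) = -b := by ring
    have e4 : -(b - a) = a - b := by ring
    have e5 : -d' - (-d - d') = d := by ring
    have e6 : -b - (a - b) = -a := by ring
    have e7 : -d - d' + d = -d' := by ring
    have e8 : SignType.sign (b - a) = -SignType.sign (a - b) := by rw [← Left.sign_neg, neg_sub]
    have e9 : SignType.sign (-d - d') = -SignType.sign (d + d') := by
      rw [← Left.sign_neg]; congr 1; ring
    have x1 : d' * (b - a) + (-d - d') * -a = d * a + d' * b := by ring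
    have x2 : (-d - d') * -b + d * (a - b) = d * a + d' * b := by ring
    simp only [e1, e2, e3, e4, e5, e6, e7, e8, e9, Left.sign_neg, x1, x2]
    have hs' := congrArg (Int.cast : ℤ → ℂ) hs
    rw [Int.cast_add, Int.cast_add, Int.cast_zero] at hs'
    have y1 : (![- -(d' : ℂ), ((-d - d' : ℤ) : ℂ) - -(d' : ℂ)] : Fin 2 → ℂ) = ![(d' : ℂ), -(d : ℂ)] := by
      push_cast; congr 2 <;> ring
    have y2 : (![-((d : ℂ) - -((-d - d' : ℤ) : ℂ)), - -((-d - d' : ℤ) : ℂ) -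
        ((d : ℂ) - -((-d - d' : ℤ) : ℂ))] : Fin 2 → ℂ) = ![(d' : ℂ), -(d : ℂ)] := by
      push_cast; congr 2 <;> ring
    rw [y1, y2]
    linear_combination (ex τ ^ (d * a + d' * b) * aeval ![(d' : ℂ), -(d : ℂ)] P) * hs'
  · simp

lemma tsum_pairGeneric_cyclic (hP : P.IsHomogeneous K) {u v w : ZMod l} (h : u + v + w = 0) :
    ∑' z, pairGeneric τ u v P z + ∑' z, pairGeneric τ v w (rot P) z +
      ∑' z, pairGeneric τ w u (rot (rot P)) z = 0 := by
  have h1 : Summable (pairGeneric τ u v P) := summable_ite_pairTerm hP u v _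
  have h2 : Summable (pairGeneric τ v w (rot P)) :=
    summable_ite_pairTerm (isHomogeneous_rot hP) v w _
  have h3 : Summable (pairGeneric τ w u (rot (rot P))) :=
    summable_ite_pairTerm (isHomogeneous_rot (isHomogeneous_rot hP)) w u _
  rw [← pairRot.tsum_eq (pairGeneric τ v w (rot P)),
    ← (pairRot.trans pairRot).tsum_eq (pairGeneric τ w u (rot (rot P)))]
  have h2' := pairRot.summable_iff.2 h2
  have h3' := (pairRot.trans pairRot).summable_iff.2 h3
  simp only [Function.comp_def] at h2' h3'
  rw [← h1.tsum_add h2', ← (h1.add h2').tsum_add h3']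
  exact (tsum_congr fun z => pairGeneric_cyclic h z).trans tsum_zero

/-- Coordinates adapted to the configurations with equal second components. -/
def diagEquiv : (ℤ × ℤ) × (ℤ × ℤ) ≃ (ℤ × ℤ) × (ℤ × ℤ) where
  toFun z := ((z.2.1, z.1.2), (z.1.1 - z.2.1, z.1.2 + z.2.2))
  invFun z := ((z.1.1 + z.2.1, z.1.2), (z.1.1, z.2.2 - z.1.2))
  left_inv := by rintro ⟨⟨a, b⟩, ⟨c, d⟩⟩; simp
  right_inv := by rintro ⟨⟨a, b⟩, ⟨c, d⟩⟩; simp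

lemma mem_strictBetween_of_mul_pos {e j n : ℤ} (h1 : 0 < j * n) (h2 : 0 < (e - j) * n) :
    j ∈ strictBetween e := by
  rw [strictBetween, Finset.mem_Ioo, min_lt_iff, lt_max_iff]
  rcases pos_and_pos_or_neg_and_neg_of_mul_pos h1 with ⟨h3, h4⟩ | ⟨h3, h4⟩
  · have := pos_of_mul_pos_left h2 h4.le
    constructor <;> omega
  · have : e - j < 0 := by
      by_contra hc
      nlinarith
    constructor <;> omega

lemma mul_pos_of_mem_strictBetween {e j n : ℤ} (hj : j ∈ strictBetween e) :
    (0 < j * n ↔ 0 < e * n) ∧ (0 < (e - j) * n ↔ 0 < e * n) ∧ j.sign = e.sign ∧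
      (e - j).sign = e.sign := by
  rw [strictBetween, Finset.mem_Ioo, min_lt_iff, lt_max_iff] at hj
  rcases lt_trichotomy e 0 with he | he | he
  · have hneg : ∀ {c : ℤ}, c < 0 → (0 < c * n ↔ n < 0) := fun {c} hc =>
      ⟨fun h => by by_contra hn; nlinarith, fun h => mul_pos_of_neg_of_neg hc h⟩
    have h1 : j < 0 := by omega
    have h2 : e - j < 0 := by omega
    refine ⟨?_, ?_, ?_, ?_⟩
    · rw [hneg h1, hneg he]
    · rw [hneg h2, hneg he]
    · rw [Int.sign_eq_neg_one_of_neg h1, Int.sign_eq_neg_one_of_neg he]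
    · rw [Int.sign_eq_neg_one_of_neg h2, Int.sign_eq_neg_one_of_neg he]
  · omega
  · have h1 : 0 < j := by omega
    have h2 : 0 < e - j := by omega
    refine ⟨?_, ?_, ?_, ?_⟩
    · rw [mul_pos_iff_of_pos_left h1, mul_pos_iff_of_pos_left he]
    · rw [mul_pos_iff_of_pos_left h2, mul_pos_iff_of_pos_left he]
    · rw [Int.sign_eq_one_of_pos h1, Int.sign_eq_one_of_pos he]
    · rw [Int.sign_eq_one_of_pos h2, Int.sign_eq_one_of_pos he]

lemma signWeight_mul_signWeight (u v : ZMod l) {e j n : ℤ} (hj : j ∈ strictBetween e) :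
    signWeight τ u (j, n) * signWeight τ v (e - j, n) =
      if (j : ZMod l) = u then signWeight τ (u + v) (e, n) * e.sign else 0 := by
  obtain ⟨h1, h2, h3, h4⟩ := mul_pos_of_mem_strictBetween (n := n) hj
  simp only [signWeight, h1, h2, h3, h4]
  by_cases hu : (j : ZMod l) = u
  · have hv : ((e - j : ℤ) : ZMod l) = v ↔ (e : ZMod l) = u + v := by
      rw [← hu]; push_cast
      rw [sub_eq_iff_eq_add, add_comm]
    simp only [hu, hv, and_true, if_true]
    by_cases he : 0 < e * n
    · by_cases hc : (e : ZMod l) = u + v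
      · simp only [he, hc, and_self, if_true]
        rw [show e * n = j * n + (e - j) * n by ring, zpow_add₀ (ex_ne_zero _)]
        ring
      · simp [hc]
    · simp [he]
  · simp [hu]

/-- With first components `j` and `e - j` and common second component `n`, the exponent is `e n`.
Both products are positive exactly when `e n` is and `j` lies strictly between `0` and `e`, so the
inner sum is finite. -/
lemma tsum_diag (hP : P.IsHomogeneous K) (u v : ZMod l) :
    (∑' z, if z.1.2 = z.2.2 then pairTerm τ u v P z else 0) =
      latSum τ (u + v) fun x => x.1.sign *
        ∑ j ∈ (strictBetween x.1).filter (fun j : ℤ => (j : ZMod l) = u),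
          aeval ![((x.1 - j : ℤ) : ℂ), -(j : ℂ)] P := by
  have hs := diagEquiv.summable_iff.2
    (summable_ite_pairTerm (τ := τ) hP u v fun z => z.1.2 = z.2.2)
  simp only [Function.comp_def] at hs
  rw [← diagEquiv.tsum_eq, Summable.tsum_prod hs, latSum]
  refine tsum_congr fun x => ?_
  obtain ⟨e, n⟩ := x
  rw [tsum_eq_sum (s := (strictBetween e) ×ˢ {0})]
  · rw [Finset.sum_product, Finset.mul_sum, Finset.mul_sum, Finset.sum_filter]
    refine Finset.sum_congr rfl fun j hj => ?_
    rw [Finset.sum_singleton]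
    simp only [diagEquiv, Equiv.coe_fn_mk, add_zero, if_true, pairTerm]
    rw [signWeight_mul_signWeight u v hj]
    split_ifs
    · ring
    · rw [zero_mul]
  · rintro ⟨j, m⟩ hm
    refine ite_eq_right_iff.2 fun h0 => ?_
    change n = n + m at h0
    change signWeight τ u (j, n) * signWeight τ v (e - j, n + m) * _ = 0
    by_cases h1 : 0 < j * n
    · by_cases h2 : 0 < (e - j) * n
      · refine absurd (Finset.mem_product.2 ⟨mem_strictBetween_of_mul_pos h1 h2, ?_⟩) hm
        simpa using h0
      · rw [← h0, signWeight_of_not (x := (e - j, n)) h2, mul_zero, zero_mul]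
    · rw [signWeight_of_not (x := (j, n)) h1, zero_mul, zero_mul]

/-- Coordinates adapted to the configurations with opposite first components. -/
def antidiagEquiv : (ℤ × ℤ) × (ℤ × ℤ) ≃ (ℤ × ℤ) × (ℤ × ℤ) where
  toFun z := ((z.1.1, z.1.2 + z.2.2), (z.2.1 - z.1.1, z.2.2))
  invFun z := ((z.1.1, z.1.2 - z.2.2), (z.1.1 + z.2.1, z.2.2))
  left_inv := by rintro ⟨⟨a, b⟩, ⟨c, d⟩⟩; simp
  right_inv := by rintro ⟨⟨a, b⟩, ⟨c, d⟩⟩; simp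

lemma card_strictBetween_neg {n : ℤ} (hn : n ≠ 0) :
    ((strictBetween (-n)).card : ℤ) = |n| - 1 := by
  rw [strictBetween, Int.card_Ioo]
  rcases lt_or_gt_of_ne hn with h | h
  · rw [min_eq_left (by omega), max_eq_right (by omega), abs_of_neg h]; omega
  · rw [min_eq_right (by omega), max_eq_left (by omega), abs_of_pos h]; omega

lemma signWeight_mul_signWeight_neg (u v : ZMod l) {d n t : ℤ} (ht : t ∈ strictBetween (-n)) :
    signWeight τ u (d, n + t) * signWeight τ v (-d, t) =
      if u + v = 0 then -(signWeight τ u (d, n) * d.sign) else 0 := by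
  obtain ⟨h1, h2, -, -⟩ := mul_pos_of_mem_strictBetween (n := -d) ht
  have h1' : 0 < -d * t ↔ 0 < d * n := by rw [mul_comm, h1, neg_mul_neg, mul_comm]
  have h2' : 0 < d * (n + t) ↔ 0 < d * n := by
    rw [show d * (n + t) = (-n - t) * -d by ring, h2, neg_mul_neg, mul_comm]
  simp only [signWeight, h1', h2']
  by_cases hu : (d : ZMod l) = u
  · have hv : ((-d : ℤ) : ZMod l) = v ↔ u + v = 0 := by
      rw [← hu]; push_cast
      constructor
      · intro h; rw [← h]; ring
      · intro h; linear_combination -h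
    simp only [hu, hv, and_true]
    by_cases he : 0 < d * n
    · by_cases hc : u + v = 0
      · simp only [he, hc, and_self, if_true]
        rw [show d * n = d * (n + t) + -d * t by ring, zpow_add₀ (ex_ne_zero _), Int.sign_neg]
        push_cast
        ring
      · simp [hc]
    · simp [he]
  · simp [hu]

/-- Here the pairs are `(d, n + t)` and `(-d, t)`, with exponent `d n` independent of `t`. There are
`|n| - 1` admissible `t`; this count produces the factor `n` that later becomes a derivative. -/
lemma tsum_antidiag (hP : P.IsHomogeneous K) (u v : ZMod l) :
    (∑' z, if z.1.1 + z.2.1 = 0 then pairTerm τ u v P z else 0) =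
      if u + v = 0 then latSum τ u fun x =>
        (x.1.sign - x.2) * aeval ![-(x.1 : ℂ), -(x.1 : ℂ)] P else 0 := by
  have hs := antidiagEquiv.summable_iff.2
    (summable_ite_pairTerm (τ := τ) hP u v fun z => z.1.1 + z.2.1 = 0)
  simp only [Function.comp_def] at hs
  rw [← antidiagEquiv.tsum_eq, Summable.tsum_prod hs]
  have hx : ∀ x : ℤ × ℤ, (∑' c, if (antidiagEquiv (x, c)).1.1 + (antidiagEquiv (x, c)).2.1 = 0 then
      pairTerm τ u v P (antidiagEquiv (x, c)) else 0) = if u + v = 0 then signWeight τ u x *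
        ((x.1.sign - x.2) * aeval ![-(x.1 : ℂ), -(x.1 : ℂ)] P) else 0 := by
    rintro ⟨d, n⟩
    rw [tsum_eq_sum (s := {0} ×ˢ (strictBetween (-n)))]
    · rw [Finset.sum_product, Finset.sum_singleton]
      have hc : ∀ t ∈ strictBetween (-n), (if (antidiagEquiv ((d, n), (0, t))).1.1 +
          (antidiagEquiv ((d, n), (0, t))).2.1 = 0 then
          pairTerm τ u v P (antidiagEquiv ((d, n), (0, t))) else 0) =
          if u + v = 0 then -(signWeight τ u (d, n) * d.sign) *
            aeval ![-(d : ℂ), -(d : ℂ)] P else 0 := by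
        intro t ht
        simp only [antidiagEquiv, Equiv.coe_fn_mk, zero_sub, add_neg_cancel, if_true,
          pairTerm]
        rw [signWeight_mul_signWeight_neg u v ht]
        split_ifs
        · push_cast; rfl
        · rw [zero_mul]
      rw [Finset.sum_congr rfl hc, Finset.sum_const, nsmul_eq_mul]
      split_ifs with h0
      · by_cases hdn : 0 < d * n
        · have hn : n ≠ 0 := fun h => by simp [h] at hdn
          have h1 : ((strictBetween (-n)).card : ℂ) * d.sign = n - d.sign := by
            have h2 : ((strictBetween (-n)).card : ℤ) * d.sign = n - d.sign := by
              rw [card_strictBetween_neg hn]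
              rcases pos_and_pos_or_neg_and_neg_of_mul_pos hdn with ⟨h3, h4⟩ | ⟨h3, h4⟩
              · rw [Int.sign_eq_one_of_pos h3, abs_of_pos h4]; ring
              · rw [Int.sign_eq_neg_one_of_neg h3, abs_of_neg h4]; ring
            exact_mod_cast congrArg (Int.cast : ℤ → ℂ) h2
          linear_combination (-(signWeight τ u (d, n)) * aeval ![-(d : ℂ), -(d : ℂ)] P) * h1
        · rw [signWeight_of_not (x := (d, n)) hdn]
          simp
      · simp
    · rintro ⟨e, t⟩ hm
      refine ite_eq_right_iff.2 fun h0 => ?_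
      change d + (e - d) = 0 at h0
      change signWeight τ u (d, n + t) * signWeight τ v (e - d, t) * _ = 0
      obtain rfl : e = 0 := by omega
      by_cases h1 : 0 < d * (n + t)
      · by_cases h2 : 0 < (0 - d) * t
        · refine absurd (Finset.mem_product.2 ⟨by simp, ?_⟩) hm
          refine mem_strictBetween_of_mul_pos (n := -d) ?_ ?_
          · rw [zero_sub] at h2; linarith
          · linarith
        · rw [signWeight_of_not (x := (0 - d, t)) h2, mul_zero, zero_mul]
      · rw [signWeight_of_not (x := (d, n + t)) h1, zero_mul, zero_mul]
  rw [tsum_congr hx]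
  split_ifs
  · rfl
  · exact tsum_zero

end ToricForms

namespace ToricForms

open Filter Topology
open scoped Nat

/-! ### The three-term relation -/

variable {l : ℕ} {τ : ℍ} {P : MvPolynomial (Fin 2) ℂ} {K : ℕ}

lemma rot_rot_rot (P : MvPolynomial (Fin 2) ℂ) : rot (rot (rot P)) = P := by
  have h (Q : MvPolynomial (Fin 2) ℂ) : aeval ![x, y] Q = Q := by
    have h : (aeval ![x, y] : MvPolynomial (Fin 2) ℂ →ₐ[ℂ] _) = AlgHom.id ℂ _ := by
      ext i
      fin_cases i <;> simp
    rw [h]; rfl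
  rw [← h (rot (rot (rot P))), aeval_rot, aeval_rot, aeval_rot]
  conv_rhs => rw [← h P]
  congr 3
  · ring
  · ring_nf

/-- The bilinear combination of constant terms, linear in `P`. -/
def constForm (K : ℕ) (u v : ZMod l) (P : MvPolynomial (Fin 2) ℂ) : ℂ :=
  ∑ p ∈ Finset.HasAntidiagonal.antidiagonal K,
    (MvPolynomial.coeff (Finsupp.single 0 p.1 + Finsupp.single 1 p.2) P * (-1) ^ p.2) *
      (stildeConst l (p.2 + 1) u * stildeConst l (p.1 + 1) v)

/-- The linear extension of `x^r y^s (u, v) ↦ (-1)^s s̃^{(s+1)}_{u/l} s̃^{(r+1)}_{v/l}`. -/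
def prodForm (K : ℕ) (u v : ZMod l) (P : MvPolynomial (Fin 2) ℂ) : ℍ → ℂ :=
  ∑ p ∈ Finset.HasAntidiagonal.antidiagonal K,
    MvPolynomial.coeff (Finsupp.single 0 p.1 + Finsupp.single 1 p.2) P •
      ((-1 : ℂ) ^ p.2 • (stilde l (p.2 + 1) u * stilde l (p.1 + 1) v))

lemma regConst_fst (hP : P.IsHomogeneous K) (u : ZMod l) (d : ℂ) :
    regConst u (aeval ![Polynomial.C d, -Polynomial.X] P) =
      ∑ p ∈ Finset.HasAntidiagonal.antidiagonal K,
        (MvPolynomial.coeff (Finsupp.single 0 p.1 + Finsupp.single 1 p.2) P * (-1) ^ p.2 *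
          stildeConst l (p.2 + 1) u) * d ^ p.1 := by
  rw [aeval_eq_sum hP, map_sum]
  refine Finset.sum_congr rfl fun p _ => ?_
  have h : (Polynomial.C d ^ p.1 * (-Polynomial.X) ^ p.2 : Polynomial ℂ) =
      (d ^ p.1 * (-1) ^ p.2) • Polynomial.X ^ p.2 := by
    rw [neg_pow, Polynomial.smul_eq_C_mul]
    simp [mul_assoc]
  rw [h, map_smul, map_smul, regConst, polyFunctional_X_pow, smul_eq_mul, smul_eq_mul]
  ring

lemma regConst_snd (hP : P.IsHomogeneous K) (v : ZMod l) (d : ℂ) :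
    regConst v (aeval ![Polynomial.X, -Polynomial.C d] P) =
      ∑ p ∈ Finset.HasAntidiagonal.antidiagonal K,
        (MvPolynomial.coeff (Finsupp.single 0 p.1 + Finsupp.single 1 p.2) P * (-1) ^ p.2 *
          stildeConst l (p.1 + 1) v) * d ^ p.2 := by
  rw [aeval_eq_sum hP, map_sum]
  refine Finset.sum_congr rfl fun p _ => ?_
  have h : (Polynomial.X ^ p.1 * (-Polynomial.C d) ^ p.2 : Polynomial ℂ) =
      (d ^ p.2 * (-1) ^ p.2) • Polynomial.X ^ p.1 := by
    rw [neg_pow, Polynomial.smul_eq_C_mul]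
    simp
    ring
  rw [h, map_smul, map_smul, regConst, polyFunctional_X_pow, smul_eq_mul, smul_eq_mul]
  ring

lemma latBounded_regConst_fst (hP : P.IsHomogeneous K) (u : ZMod l) :
    LatBounded fun x => regConst u (aeval ![Polynomial.C (x.1 : ℂ), -Polynomial.X] P) := by
  simp only [regConst_fst hP]
  exact LatBounded.sum _ fun p _ => (LatBounded.const _).mul (latBounded_fst.pow _)

lemma latBounded_regConst_snd (hP : P.IsHomogeneous K) (v : ZMod l) :
    LatBounded fun x => regConst v (aeval ![Polynomial.X, -Polynomial.C (x.1 : ℂ)] P) := by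
  simp only [regConst_snd hP]
  exact LatBounded.sum _ fun p _ => (LatBounded.const _).mul (latBounded_fst.pow _)

lemma latBounded_aeval (hP : P.IsHomogeneous K) {f g : ℤ × ℤ → ℂ} (hf : LatBounded f)
    (hg : LatBounded g) : LatBounded fun x => aeval ![f x, g x] P := by
  simp only [aeval_eq_sum hP, smul_eq_mul]
  exact LatBounded.sum _ fun p _ => (LatBounded.const _).mul ((hf.pow _).mul (hg.pow _))

/-- Expand each product of constant plus tail. In the mixed terms one variable of `P` is summed over
the lattice while the other is fed to `regConst`. -/
lemma prodForm_eq [NeZero l] (hP : P.IsHomogeneous K) (u v : ZMod l) :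
    prodForm K u v P τ = constForm K u v P +
      latSum τ v (fun x => regConst u (aeval ![Polynomial.C (x.1 : ℂ), -Polynomial.X] P)) +
      latSum τ u (fun x => regConst v (aeval ![Polynomial.X, -Polynomial.C (x.1 : ℂ)] P)) +
      ∑' z, pairTerm τ u v P z := by
  simp only [regConst_fst hP, regConst_snd hP]
  rw [latSum_sum _ fun p _ => (LatBounded.const _).mul (latBounded_fst.pow _),
    latSum_sum _ fun p _ => (LatBounded.const _).mul (latBounded_fst.pow _),
    tsum_pairTerm hP, constForm, ← Finset.sum_add_distrib, ← Finset.sum_add_distrib,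
    ← Finset.sum_add_distrib, prodForm, Finset.sum_apply]
  refine Finset.sum_congr rfl fun p _ => ?_
  rw [latSum_const_mul, latSum_const_mul, ← stildeTail_eq_latSum, ← stildeTail_eq_latSum]
  simp only [Pi.smul_apply, Pi.mul_apply, smul_eq_mul, stilde]
  ring

/-- The integral of `P(1, t)` from `0` to `1`. -/
def intConst (K : ℕ) (P : MvPolynomial (Fin 2) ℂ) : ℂ :=
  ∑ p ∈ Finset.HasAntidiagonal.antidiagonal K,
    MvPolynomial.coeff (Finsupp.single 0 p.1 + Finsupp.single 1 p.2) P / (p.2 + 1)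

lemma polyIntegral_neg_aeval (hP : P.IsHomogeneous K) (d : ℂ) :
    polyIntegral (-d) (aeval ![Polynomial.C d, -Polynomial.X] P) =
      -(intConst K P * d ^ (K + 1)) := by
  rw [aeval_eq_sum hP, map_sum, intConst, Finset.sum_mul, ← Finset.sum_neg_distrib]
  refine Finset.sum_congr rfl fun p hp => ?_
  rw [Finset.HasAntidiagonal.mem_antidiagonal] at hp
  have h : (Polynomial.C d ^ p.1 * (-Polynomial.X) ^ p.2 : Polynomial ℂ) =
      (d ^ p.1 * (-1) ^ p.2) • Polynomial.X ^ p.2 := by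
    rw [neg_pow, Polynomial.smul_eq_C_mul]
    simp [mul_assoc]
  rw [h, map_smul, map_smul, polyIntegral, polyFunctional_X_pow, smul_eq_mul, smul_eq_mul, ← hp,
    neg_pow d]
  have h2 : ((-1 : ℂ) ^ p.2) * (-1) ^ p.2 = 1 := by
    rw [← mul_pow]; norm_num
  rw [pow_succ (-1 : ℂ)]
  linear_combination (-MvPolynomial.coeff (Finsupp.single 0 p.1 + Finsupp.single 1 p.2) P * d ^ p.1 *
    d ^ (p.2 + 1) / (p.2 + 1)) * h2

lemma eval_aeval (f g : Polynomial ℂ) (c : ℂ) (P : MvPolynomial (Fin 2) ℂ) :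
    (aeval ![f, g] P).eval c = aeval ![f.eval c, g.eval c] P := by
  have h : (Polynomial.aeval (R := ℂ) c).comp (aeval ![f, g]) =
      (aeval ![f.eval c, g.eval c] : MvPolynomial (Fin 2) ℂ →ₐ[ℂ] ℂ) := by
    ext i
    fin_cases i <;> simp
  exact DFunLike.congr_fun h P

lemma aeval_aeval (f g : Polynomial ℂ) (q : Polynomial ℂ) (P : MvPolynomial (Fin 2) ℂ) :
    Polynomial.aeval q (aeval ![f, g] P) =
      aeval ![Polynomial.aeval q f, Polynomial.aeval q g] P := by
  have h : (Polynomial.aeval (R := ℂ) q).comp (aeval ![f, g]) =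
      (aeval ![Polynomial.aeval q f, Polynomial.aeval q g] :
        MvPolynomial (Fin 2) ℂ →ₐ[ℂ] Polynomial ℂ) := by
    ext i : 1
    fin_cases i <;> simp
  exact DFunLike.congr_fun h P

lemma sum_strictBetween_reflect {u w : ZMod l} {e : ℤ} (h : u + w = e) (f : ℤ → ℂ) :
    ∑ j ∈ (strictBetween e).filter (fun j : ℤ => (j : ZMod l) = w), f j =
      ∑ j ∈ (strictBetween e).filter (fun j : ℤ => (j : ZMod l) = u), f (e - j) := by
  refine Finset.sum_nbij' (fun j => e - j) (fun j => e - j) ?_ ?_ ?_ ?_ ?_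
  · intro j hj
    simp only [strictBetween, Finset.mem_filter, Finset.mem_Ioo] at hj ⊢
    refine ⟨by omega, ?_⟩
    push_cast
    rw [hj.2, ← h]; ring
  · intro j hj
    simp only [strictBetween, Finset.mem_filter, Finset.mem_Ioo] at hj ⊢
    refine ⟨by omega, ?_⟩
    push_cast
    rw [hj.2, ← h]; ring
  · intro j _; ring
  · intro j _; ring
  · intro j _; congr 1; ring

/-- For fixed `d ≡ v`, apply `regConst_add_regConst` with endpoint `-d ≡ u + w`. It trades the
finite inner sum of the equal-second-component terms of the pair `(w, u)` for minus the two mixed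
terms, leaving a multiple of `d ^ (K + 1)` and half endpoint values. -/
lemma latSum_regConst_add [NeZero l] (hP : P.IsHomogeneous K) {u v w : ZMod l} (h : u + v + w = 0) :
    latSum τ v (fun x => regConst u (aeval ![Polynomial.C (x.1 : ℂ), -Polynomial.X] P)) +
      latSum τ v (fun x => regConst w (aeval ![Polynomial.X, -Polynomial.C (x.1 : ℂ)] (rot P))) +
      (∑' z, if z.1.2 = z.2.2 then pairTerm τ w u (rot (rot P)) z else 0) =
    (l : ℂ)⁻¹ * intConst K P * stildeTail l (K + 2) v τ
      - (if u = 0 then latSum τ v (fun x => x.1.sign * aeval ![(x.1 : ℂ), 0] P) else 0) / 2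
      - (if w = 0 then latSum τ v (fun x => x.1.sign * aeval ![(x.1 : ℂ), (x.1 : ℂ)] P) else 0)
        / 2 := by
  have hP1 := isHomogeneous_rot hP
  have hP2 := isHomogeneous_rot hP1
  have hα := latBounded_regConst_fst hP u
  have hβ := latBounded_regConst_snd hP1 w
  have hA : LatBounded fun x => (l : ℂ)⁻¹ * intConst K P * (x.1 : ℂ) ^ (K + 1) :=
    (LatBounded.const _).mul (latBounded_fst.pow _)
  have hB : LatBounded fun x => (if u = 0 then -1 / 2 else 0 : ℂ) *
      (x.1.sign * aeval ![(x.1 : ℂ), 0] P) :=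
    (LatBounded.const _).mul (latBounded_sign.mul
      (latBounded_aeval hP latBounded_fst (LatBounded.const 0)))
  have hC : LatBounded fun x => (if w = 0 then -1 / 2 else 0 : ℂ) *
      (x.1.sign * aeval ![(x.1 : ℂ), (x.1 : ℂ)] P) :=
    (LatBounded.const _).mul (latBounded_sign.mul (latBounded_aeval hP latBounded_fst latBounded_fst))
  have hαβ := (LatBounded.const (-1)).mul (hα.add hβ)
  have hneg (g : ℤ × ℤ → ℂ) : latSum τ (-v) g = latSum τ v fun x => -1 * g (-x) := by
    rw [latSum_neg, latSum_const_mul, neg_one_mul]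
  have hdiag : (∑' z, if z.1.2 = z.2.2 then pairTerm τ w u (rot (rot P)) z else 0) =
      latSum τ v fun x => (((l : ℂ)⁻¹ * intConst K P * (x.1 : ℂ) ^ (K + 1) +
        (if u = 0 then -1 / 2 else 0 : ℂ) * (x.1.sign * aeval ![(x.1 : ℂ), 0] P)) +
        (if w = 0 then -1 / 2 else 0 : ℂ) * (x.1.sign * aeval ![(x.1 : ℂ), (x.1 : ℂ)] P)) + (-1) *
        (regConst u (aeval ![Polynomial.C (x.1 : ℂ), -Polynomial.X] P) +
          regConst w (aeval ![Polynomial.X, -Polynomial.C (x.1 : ℂ)] (rot P))) := by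
    rw [tsum_diag hP2, show w + u = -v by linear_combination h, hneg]
    refine latSum_congr ?_
    rintro ⟨d, n⟩ hdn hd
    have hd0 : -d ≠ 0 := fun h0 => by
      rw [neg_eq_zero] at h0
      simp [h0] at hdn
    have huw : u + w = ((-d : ℤ) : ZMod l) := by
      push_cast
      rw [show (d : ZMod l) = v from hd]
      linear_combination h
    have hF := regConst_add_regConst hd0 huw (aeval ![Polynomial.C (d : ℂ), -Polynomial.X] P)
    rw [aeval_aeval] at hF
    have e1 : aeval ![(Polynomial.X : Polynomial ℂ), -Polynomial.C (d : ℂ)] (rot P) =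
        aeval ![Polynomial.aeval (R := ℂ) (Polynomial.C ((-d : ℤ) : ℂ) - Polynomial.X)
          (Polynomial.C (d : ℂ)),
          Polynomial.aeval (R := ℂ) (Polynomial.C ((-d : ℤ) : ℂ) - Polynomial.X)
            (-Polynomial.X : Polynomial ℂ)] P := by
      rw [aeval_rot]
      congr 3
      · simp
      · simp [add_comm]
    have hS : ∑ j ∈ (strictBetween (-d)).filter (fun j : ℤ => (j : ZMod l) = w),
        aeval ![((-d - j : ℤ) : ℂ), -(j : ℂ)] (rot (rot P)) =
        classSum u (strictBetween (-d)) (aeval ![Polynomial.C (d : ℂ), -Polynomial.X] P) := by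
      rw [sum_strictBetween_reflect huw, classSum]
      refine Finset.sum_congr rfl fun j _ => ?_
      rw [aeval_rot, aeval_rot, eval_aeval]
      congr 3
      · push_cast
        simp
      · push_cast
        simp
    rw [← e1, show (((-d : ℤ) : ℂ)) = -(d : ℂ) by push_cast; rfl, polyIntegral_neg_aeval hP, eval_aeval, eval_aeval] at hF
    simp only [Prod.neg_mk, hS, hF]
    simp [Int.sign_neg]
    split_ifs <;> ring
  rw [hdiag, latSum_add ((hA.add hB).add hC) hαβ, latSum_add (hA.add hB) hC, latSum_add hA hB,
    latSum_const_mul, latSum_const_mul, latSum_const_mul, latSum_const_mul, latSum_add hα hβ,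
    stildeTail_eq_latSum]
  split_ifs <;> ring

/-- Opposite first components require `v + w = 0`, that is `u = 0`. Homogeneity reduces `P(d, 0)` to
its `x^K` coefficient, so the part carrying `n` is a derivative of an Eisenstein series. -/
lemma tsum_antidiag_rot (hP : P.IsHomogeneous K) {u v w : ZMod l} (h : u + v + w = 0) :
    (∑' z, if z.1.1 + z.2.1 = 0 then pairTerm τ v w (rot P) z else 0) =
      if u = 0 then latSum τ v (fun x => x.1.sign * aeval ![(x.1 : ℂ), 0] P) -
        MvPolynomial.coeff (Finsupp.single 0 K) P * latSum τ v (fun x => (x.1 : ℂ) ^ K * x.2)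
      else 0 := by
  have hu : v + w = 0 ↔ u = 0 := by
    rw [← add_right_inj u, ← add_assoc, h, add_zero, eq_comm]
  have hP0 (d : ℂ) : aeval ![d, 0] P = MvPolynomial.coeff (Finsupp.single 0 K) P * d ^ K := by
    rw [aeval_eq_sum hP, Finset.sum_eq_single (K, 0)]
    · simp
    · rintro ⟨a, b⟩ hab hne
      rw [Finset.HasAntidiagonal.mem_antidiagonal] at hab
      have hb : b ≠ 0 := by
        rintro rfl
        exact hne (by simpa using hab)
      simp [hb]
    · simp
  rw [tsum_antidiag (isHomogeneous_rot hP)]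
  simp only [hu, aeval_rot]
  refine if_congr Iff.rfl ?_ rfl
  have h1 : LatBounded fun x => x.1.sign * aeval ![(x.1 : ℂ), 0] P :=
    latBounded_sign.mul (latBounded_aeval hP latBounded_fst (LatBounded.const 0))
  have h2 : LatBounded fun x => -MvPolynomial.coeff (Finsupp.single 0 K) P *
      ((x.1 : ℂ) ^ K * x.2) :=
    (LatBounded.const _).mul ((latBounded_fst.pow K).mul latBounded_snd)
  rw [sub_eq_add_neg, ← neg_mul, ← latSum_const_mul, ← latSum_add h1 h2]
  refine latSum_congr fun x _ _ => ?_
  rw [neg_neg, sub_self, hP0]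
  ring

/-- When `w = 0` the classes of `u` and `v` are opposite. The endpoint term is moved to the class of
`u` in the shape it has for the next rotation, where it will cancel. -/
lemma latSum_rot_rot {v u w : ZMod l} (h : u + v + w = 0) (P : MvPolynomial (Fin 2) ℂ) :
    (if w = 0 then latSum τ v (fun x => x.1.sign * aeval ![(x.1 : ℂ), (x.1 : ℂ)] P) else 0) =
      if w = 0 then latSum τ u (fun x => x.1.sign * aeval ![(x.1 : ℂ), 0] (rot (rot P))) else 0 := by
  refine if_ctx_congr Iff.rfl (fun hw => ?_) fun _ => rfl
  rw [show u = -v by rw [hw] at h; linear_combination h, latSum_neg, ← neg_one_mul,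
    ← latSum_const_mul]
  refine latSum_congr fun x _ _ => ?_
  simp [aeval_rot]

/-- The sum of the degenerate contributions supported on one residue class. -/
lemma class_contribution [NeZero l] (hP : P.IsHomogeneous K) {u v w : ZMod l} (h : u + v + w = 0) :
    latSum τ v (fun x => regConst u (aeval ![Polynomial.C (x.1 : ℂ), -Polynomial.X] P)) +
      latSum τ v (fun x => regConst w (aeval ![Polynomial.X, -Polynomial.C (x.1 : ℂ)] (rot P))) +
      (∑' z, if z.1.2 = z.2.2 then pairTerm τ w u (rot (rot P)) z else 0) +
      (∑' z, if z.1.1 + z.2.1 = 0 then pairTerm τ v w (rot P) z else 0) =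
    (l : ℂ)⁻¹ * intConst K P * stildeTail l (K + 2) v τ
      - (if u = 0 then MvPolynomial.coeff (Finsupp.single 0 K) P else 0) *
        latSum τ v (fun x => (x.1 : ℂ) ^ K * x.2)
      + (if u = 0 then latSum τ v (fun x => x.1.sign * aeval ![(x.1 : ℂ), 0] P) else 0) / 2
      - (if w = 0 then latSum τ u (fun x => x.1.sign * aeval ![(x.1 : ℂ), 0] (rot (rot P))) else 0)
        / 2 := by
  rw [latSum_regConst_add hP h, tsum_antidiag_rot hP h, latSum_rot_rot h]
  split_ifs <;> ring

/-- Add the three rotations of `class_contribution` to the cancellation of the generic parts; the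
half endpoint terms telescope. The constant collects the products of constant terms and the
constants of the weight `K + 3` forms, and need not be evaluated. -/
lemma prodForm_cyclic [NeZero l] (hP : P.IsHomogeneous (K + 1)) {u v w : ZMod l} (h : u + v + w = 0) :
    ∃ (c : ℂ), ∃ f ∈ eisensteinSpan l (K + 3), prodForm (K + 1) u v P +
      prodForm (K + 1) v w (rot P) + prodForm (K + 1) w u (rot (rot P)) = (fun _ => c) + f := by
  have hP1 := isHomogeneous_rot hP
  have hP2 := isHomogeneous_rot hP1
  have h' : v + w + u = 0 := by linear_combination h
  have h'' : w + u + v = 0 := by linear_combination h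
  set g : ZMod l → ZMod l → MvPolynomial (Fin 2) ℂ → ℍ → ℂ := fun u v P =>
    ((l : ℂ)⁻¹ * intConst (K + 1) P) • stilde l (K + 3) v -
      ((if u = 0 then MvPolynomial.coeff (Finsupp.single 0 (K + 1)) P else 0) *
        (2 * Real.pi * I)⁻¹) • dtau (stilde l (K + 1) v) with hg
  have hmem : ∀ u v P, g u v P ∈ eisensteinSpan l (K + 3) := fun u v P =>
    Submodule.sub_mem _
      (Submodule.smul_mem _ _ (Submodule.subset_span (Or.inl ⟨v, rfl⟩)))
      (Submodule.smul_mem _ _ (Submodule.subset_span (Or.inr ⟨v, rfl⟩)))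
  refine ⟨constForm (K + 1) u v P + constForm (K + 1) v w (rot P) +
      constForm (K + 1) w u (rot (rot P)) -
      (l : ℂ)⁻¹ * intConst (K + 1) P * stildeConst l (K + 3) v -
      (l : ℂ)⁻¹ * intConst (K + 1) (rot P) * stildeConst l (K + 3) w -
      (l : ℂ)⁻¹ * intConst (K + 1) (rot (rot P)) * stildeConst l (K + 3) u,
    g u v P + g v w (rot P) + g w u (rot (rot P)),
    add_mem (add_mem (hmem _ _ _) (hmem _ _ _)) (hmem _ _ _), ?_⟩
  funext τ
  have hπ : (2 * Real.pi * I : ℂ) ≠ 0 := Complex.two_pi_I_ne_zero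
  have hgτ : ∀ u v P, g u v P τ = (l : ℂ)⁻¹ * intConst (K + 1) P * stilde l (K + 3) v τ -
      (if u = 0 then MvPolynomial.coeff (Finsupp.single 0 (K + 1)) P else 0) *
        latSum τ v (fun x => (x.1 : ℂ) ^ (K + 1) * x.2) := by
    intro u v P
    simp only [hg, Pi.sub_apply, Pi.smul_apply, smul_eq_mul, dtau_stilde_eq_latSum]
    rw [mul_assoc _ (2 * Real.pi * I : ℂ)⁻¹, inv_mul_cancel_left₀ hπ]
  have c1 := class_contribution (τ := τ) hP h
  have c2 := class_contribution (τ := τ) hP1 h'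
  have c3 := class_contribution (τ := τ) hP2 h''
  rw [rot_rot_rot] at c2 c3
  simp only [Pi.add_apply, hgτ, prodForm_eq hP, prodForm_eq hP1, prodForm_eq hP2,
    tsum_pairTerm_eq_add hP, tsum_pairTerm_eq_add hP1, tsum_pairTerm_eq_add hP2, stilde]
  have c0 := tsum_pairGeneric_cyclic (τ := τ) hP h
  linear_combination c0 + c1 + c2 + c3

end ToricForms

namespace ToricForms

open Filter Topology
open scoped Nat

/-! ### The map on Manin symbols -/

variable {l : ℕ}

lemma stilde_neg (m : ℕ) (a : ZMod l) : stilde l m (-a) = (-1 : ℂ) ^ m • stilde l m a := by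
  have hsq : ((-1 : ℂ) ^ m) * (-1) ^ m = 1 := by rw [← mul_pow]; norm_num
  have hsqQ : ((-1 : ℚ) ^ m) * (-1) ^ m = 1 := by rw [← mul_pow]; norm_num
  have hconst : stildeConst l m (-a) = (-1) ^ m * stildeConst l m a := by
    have h : (((-(l : ℚ) ^ (m - 1) / (2 * m)) *
      ((Polynomial.bernoulli m).eval (((-a).val : ℚ) / l)
        + (-1) ^ m * (Polynomial.bernoulli m).eval ((a.val : ℚ) / l)) : ℚ)) =
      (-1) ^ m * (((-(l : ℚ) ^ (m - 1) / (2 * m)) *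
      ((Polynomial.bernoulli m).eval ((a.val : ℚ) / l)
        + (-1) ^ m * (Polynomial.bernoulli m).eval (((-a).val : ℚ) / l)) : ℚ)) := by
      linear_combination (-(-(l : ℚ) ^ (m - 1) / (2 * m)) *
        (Polynomial.bernoulli m).eval (((-a).val : ℚ) / l)) * hsqQ
    rw [stildeConst, stildeConst, neg_neg, h]
    push_cast
    rfl
  have hcoeff : ∀ n, stildeCoeff l m (-a) n = (-1) ^ m * stildeCoeff l m a n := by
    intro n
    rw [stildeCoeff, stildeCoeff, neg_neg, Finset.mul_sum]
    refine Finset.sum_congr rfl fun d _ => ?_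
    linear_combination (-(d : ℂ) ^ (m - 1) * (if (d : ZMod l) = -a then 1 else 0)) * hsq
  funext τ
  simp only [stilde, Pi.smul_apply, smul_eq_mul, hconst, stildeTail, hcoeff, mul_assoc, tsum_mul_left]
  rw [mul_add]

lemma muValue_mem [NeZero l] {k : ℕ} (hk : 2 < k) {r s : ℕ} (h : r + s = k - 2) (e : PairSet l) :
    muValue r s e ∈ Quasimodular l k := by
  have h1 := mul_mem_quasimodular (stilde_mem s e.1.1) (stilde_mem r e.1.2)
  rw [show s + 1 + (r + 1) = k by omega] at h1
  exact Submodule.smul_mem _ _ h1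

lemma prodForm_mem [NeZero l] (K : ℕ) (u v : ZMod l) (P : MvPolynomial (Fin 2) ℂ) :
    prodForm K u v P ∈ Quasimodular l (K + 2) := by
  refine Submodule.sum_mem _ fun p hp => Submodule.smul_mem _ _ (Submodule.smul_mem _ _ ?_)
  rw [Finset.HasAntidiagonal.mem_antidiagonal] at hp
  have h1 := mul_mem_quasimodular (stilde_mem p.2 u) (stilde_mem p.1 v)
  rwa [show p.2 + 1 + (p.1 + 1) = K + 2 by omega] at h1

/-- The leftover constant is a difference of quasimodular forms of positive weight, hence zero. This
replaces a direct proof of an identity between products of Bernoulli values. -/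
lemma prodForm_cyclic_mem [NeZero l] {K : ℕ} {P : MvPolynomial (Fin 2) ℂ}
    (hP : P.IsHomogeneous (K + 1)) {u v w : ZMod l} (h : u + v + w = 0) :
    prodForm (K + 1) u v P + prodForm (K + 1) v w (rot P) + prodForm (K + 1) w u (rot (rot P)) ∈
      eisensteinSpan l (K + 3) := by
  obtain ⟨c, f, hf, hc⟩ := prodForm_cyclic hP h
  have hmem := add_mem (add_mem (prodForm_mem (K + 1) u v P) (prodForm_mem (K + 1) v w (rot P)))
    (prodForm_mem (K + 1) w u (rot (rot P)))
  rw [hc] at hmem ⊢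
  have hf' := eisensteinSpan_le (l := l) (k := K + 3) (by omega) hf
  have hc0 : (fun _ => c : ℍ → ℂ) ∈ Quasimodular l (K + 3) := by
    simpa using sub_mem hmem hf'
  rw [const_eq_zero_of_mem (by omega) hc0]
  convert hf using 1
  funext τ
  simp

lemma prodForm_smul (K : ℕ) (u v : ZMod l) (c : ℂ) (P : MvPolynomial (Fin 2) ℂ) :
    prodForm K u v (c • P) = c • prodForm K u v P := by
  simp only [prodForm, Finset.smul_sum, coeff_smul, smul_assoc]

lemma prodForm_monomial {K r s : ℕ} (h : r + s = K) (e : PairSet l) :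
    prodForm K e.1.1 e.1.2 (x ^ r * y ^ s) = muValue r s e := by
  have hco : ∀ p : ℕ × ℕ, MvPolynomial.coeff (Finsupp.single 0 p.1 + Finsupp.single 1 p.2)
      (x ^ r * y ^ s) = if p = (r, s) then (1 : ℂ) else 0 := by
    intro p
    rw [x, y, X_pow_eq_monomial, X_pow_eq_monomial, monomial_mul, one_mul, coeff_monomial]
    refine if_congr ⟨fun h => ?_, ?_⟩ rfl rfl
    · have h0 := DFunLike.congr_fun h 0
      have h1 := DFunLike.congr_fun h 1
      simp at h0 h1
      exact Prod.ext h0.symm h1.symm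
    · rintro rfl
      rfl
  rw [prodForm, Finset.sum_eq_single (r, s)]
  · rw [hco, if_pos rfl, one_smul]; rfl
  · intro p _ hp
    rw [hco, if_neg hp, zero_smul]
  · intro hn
    exact absurd (Finset.HasAntidiagonal.mem_antidiagonal.2 h) hn

lemma rot_monomial (r s : ℕ) : rot (x ^ r * y ^ s) = (-1 : ℂ) ^ r • (y ^ r * (x - y) ^ s) := by
  rw [rot, map_mul, map_pow, map_pow, aeval_X, aeval_X]
  simp only [Matrix.cons_val_zero, Matrix.cons_val_one]
  rw [neg_pow y, smul_eq_C_mul]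
  simp [mul_assoc]

lemma rot_rot_monomial (r s : ℕ) :
    rot (rot (x ^ r * y ^ s)) = (-1 : ℂ) ^ s • ((y - x) ^ r * x ^ s) := by
  rw [rot, rot, map_mul, map_pow, map_pow, aeval_X, aeval_X]
  simp only [Matrix.cons_val_zero, Matrix.cons_val_one, map_mul, map_pow, map_neg, map_sub, aeval_X]
  rw [neg_sub, show -y - (x - y) = -x by ring, neg_pow x, smul_eq_C_mul]
  simp only [map_pow, map_neg, map_one]
  ring

/-- The map on formal symbols, with values in functions. -/
def muFun (l k : ℕ) : FreeSymbols l k →ₗ[ℂ] (ℍ → ℂ) :=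
  Finsupp.linearCombination ℂ fun z => muValue z.1.1.1 z.1.1.2 z.2

lemma muFun_freeSymbol {k r s : ℕ} (h : r + s = k - 2) (e : PairSet l) :
    muFun l k (freeSymbol r s h e) = muValue r s e := by
  rw [muFun, freeSymbol, Finsupp.linearCombination_single, one_smul]

lemma muFun_polySymbol (k : ℕ) (P : MvPolynomial (Fin 2) ℂ) (e : PairSet l) :
    muFun l k (polySymbol k P e) = prodForm (k - 2) e.1.1 e.1.2 P := by
  rw [polySymbol, map_sum, prodForm,
    ← Finset.sum_coe_sort (Finset.HasAntidiagonal.antidiagonal (k - 2))]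
  refine Finset.sum_congr rfl fun p _ => ?_
  rw [map_smul, muFun, Finsupp.linearCombination_single, one_smul]
  rfl

/-- This relation holds already for functions, before passing to the quotient, by the parity
`stilde_neg`. -/
lemma muFun_relator₁ {k r s : ℕ} (h : r + s = k - 2) (e : PairSet l) :
    muFun l k (relator₁ r s h e) = 0 := by
  rw [relator₁, map_add, map_smul, muFun_freeSymbol, muFun_freeSymbol, muValue, muValue,
    PairSet.sigma, stilde_neg]
  have hsq : ((-1 : ℂ) ^ r) * (-1) ^ r = 1 := by rw [← mul_pow]; norm_num
  funext τ
  simp only [Pi.add_apply, Pi.smul_apply, Pi.mul_apply, smul_eq_mul, Pi.zero_apply, pow_succ]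
  linear_combination (-(-1 : ℂ) ^ s * stilde l (s + 1) e.1.1 τ * stilde l (r + 1) e.1.2 τ) * hsq

/-- The polynomials in the three-term relator, with their signs, are the successive images of `x^r
y^s` under `rot`. -/
lemma muFun_relator₂_mem [NeZero l] {k r s : ℕ} (hk : 2 < k) (h : r + s = k - 2) (e : PairSet l) :
    muFun l k (relator₂ r s h e) ∈ eisensteinSpan l k := by
  obtain ⟨K, rfl⟩ : ∃ K, k = K + 3 := ⟨k - 3, by omega⟩
  have hP : (x ^ r * y ^ s : MvPolynomial (Fin 2) ℂ).IsHomogeneous (K + 1) := by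
    have h1 := ((isHomogeneous_X ℂ (0 : Fin 2)).pow r).mul ((isHomogeneous_X ℂ (1 : Fin 2)).pow s)
    rwa [show 1 * r + 1 * s = K + 1 by omega] at h1
  have hc := prodForm_cyclic_mem hP (u := e.1.1) (v := e.1.2) (w := -e.1.1 - e.1.2) (by ring)
  rw [rot_rot_monomial, rot_monomial, prodForm_smul, prodForm_smul,
    prodForm_monomial (by omega)] at hc
  rwa [relator₂, map_add, map_add, map_smul, map_smul, muFun_freeSymbol, muFun_polySymbol,
    muFun_polySymbol]

lemma muFun_mem [NeZero l] {k : ℕ} (hk : 2 < k) (w : FreeSymbols l k) :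
    muFun l k w ∈ Quasimodular l k := by
  rw [muFun, Finsupp.linearCombination_apply]
  exact Submodule.sum_mem _ fun z _ => Submodule.smul_mem _ _
    (muValue_mem hk (Finset.HasAntidiagonal.mem_antidiagonal.1 z.1.2) z.2)

lemma muFun_mem_eisensteinSpan [NeZero l] {k : ℕ} (hk : 2 < k) {w : FreeSymbols l k}
    (hw : w ∈ maninRelations l k) : muFun l k w ∈ eisensteinSpan l k := by
  have h : maninRelations l k ≤ (eisensteinSpan l k).comap (muFun l k) := by
    refine Submodule.span_le.2 ?_
    rintro _ (⟨r, s, h, e, rfl⟩ | ⟨r, s, h, e, rfl⟩)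
    · change muFun l k _ ∈ eisensteinSpan l k
      rw [muFun_relator₁]
      exact zero_mem _
    · exact muFun_relator₂_mem hk h e
  exact h hw

/-- The map from Manin symbols to the quotient of quasimodular forms. -/
def muMap (l k : ℕ) [NeZero l] (hk : 2 < k) : ManinSymbols l k →ₗ[ℂ] QuasimodularQuotient l k :=
  (maninRelations l k).liftQ (((eisensteinSpan l k).submoduleOf (Quasimodular l k)).mkQ ∘ₗ
    (muFun l k).codRestrict (Quasimodular l k) (muFun_mem hk)) fun _ hw => by
      rw [LinearMap.mem_ker, LinearMap.comp_apply, Submodule.mkQ_apply,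
        Submodule.Quotient.mk_eq_zero]
      exact muFun_mem_eisensteinSpan hk hw

lemma muMap_maninSymbol [NeZero l] {k : ℕ} (hk : 2 < k) {r s : ℕ} (h : r + s = k - 2)
    (e : PairSet l) : muMap l k hk (maninSymbol r s h e) =
      Submodule.Quotient.mk ⟨muValue r s e, muValue_mem hk h e⟩ := by
  rw [muMap, maninSymbol, Submodule.mkQ_apply, Submodule.liftQ_apply, LinearMap.comp_apply,
    Submodule.mkQ_apply]
  congr 1
  exact Subtype.ext (muFun_freeSymbol h e)

lemma maninSymbols_hom_ext {k : ℕ} {V : Type*} [AddCommGroup V] [Module ℂ V]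
    {f g : ManinSymbols l k →ₗ[ℂ] V} (h : ∀ (r s : ℕ) (h : r + s = k - 2) (e : PairSet l),
      f (maninSymbol r s h e) = g (maninSymbol r s h e)) : f = g := by
  refine Submodule.linearMap_qext _ (Finsupp.lhom_ext' fun z => LinearMap.ext_ring ?_)
  exact h z.1.1.1 z.1.1.2 (Finset.HasAntidiagonal.mem_antidiagonal.1 z.1.2) z.2

/-- Two admissible constants would differ by a constant modular form of positive weight. -/
lemma isModular_const_add_stildeTail_iff [NeZero l] {m : ℕ} {a : ZMod l} (hm : 1 ≤ m)
    (ha : (a, m) ≠ (0, 2)) (C : ℂ) :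
    IsModular l m (fun τ => C + stildeTail l m a τ) ↔ C = stildeConst l m a := by
  obtain ⟨n, rfl⟩ : ∃ n, m = n + 1 := ⟨m - 1, by omega⟩
  have hs := isModular_stilde (l := l) n a fun h => ha (by rw [h.1, h.2])
  constructor
  · intro h
    have hd := sub_mem h.mem hs.mem
    have e : ((fun τ => C + stildeTail l (n + 1) a τ) - stilde l (n + 1) a : ℍ → ℂ) =
        fun _ => C - stildeConst l (n + 1) a := by
      funext τ
      simp only [Pi.sub_apply, stilde]
      ring
    rw [e] at hd
    exact sub_eq_zero.1 (const_eq_zero_of_mem hm hd)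
  · rintro rfl
    exact hs

end ToricForms

end

theorem mainTheorem6 (l k : ℕ) [NeZero l] (hk : 2 < k) :
    -- the constant term of each series is the one determined by modularity, except for `(a, m) = (0, 2)`
    (∀ (m : ℕ) (a : ZMod l), 1 ≤ m → (a, m) ≠ (0, 2) → ∀ C : ℂ,
      ToricForms.IsModular l m (fun τ => C + ToricForms.stildeTail l m a τ) ↔
        C = ToricForms.stildeConst l m a) ∧
    -- the exceptional series is quasimodular of weight two
    ToricForms.stilde l 2 0 ∈ ToricForms.Quasimodular l 2 ∧
    -- the subspace one divides by consists of quasimodular forms of weight `k`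
    ToricForms.eisensteinSpan l k ≤ ToricForms.Quasimodular l k ∧
    -- the map `μ` on symbols takes values in weight `k` quasimodular forms and induces a linear map
    ∃! μ : ToricForms.ManinSymbols l k →ₗ[ℂ] ToricForms.QuasimodularQuotient l k,
      ∀ (r s : ℕ) (h : r + s = k - 2) (e : ToricForms.PairSet l),
        ∃ hmem : ToricForms.muValue r s e ∈ ToricForms.Quasimodular l k,
          μ (ToricForms.maninSymbol r s h e) =
            Submodule.Quotient.mk ⟨ToricForms.muValue r s e, hmem⟩ := by
  refine ⟨fun m a hm ha C => ToricForms.isModular_const_add_stildeTail_iff hm ha C,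
    ToricForms.stilde_mem 1 0, ToricForms.eisensteinSpan_le hk, ToricForms.muMap l k hk,
    fun r s h e => ⟨ToricForms.muValue_mem hk h e, ToricForms.muMap_maninSymbol hk h e⟩,
    fun μ hμ => ToricForms.maninSymbols_hom_ext fun r s h e => ?_⟩
  obtain ⟨_, hr⟩ := hμ r s h e
  exact hr.trans (ToricForms.muMap_maninSymbol hk h e).symm
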